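/- **Theorem ($L^\infty$ well-posedness of the $\epsilon$-Milne problem with geometric correction).** Let $R_\kappa>0$, $\epsilon>0$, $L=\epsilon^{-1/2}$ and $F(\eta)=-\dfrac{\epsilon}{R_\kappa-\epsilon\eta}$. For an in-flow datum $h$, defined for $\sin\phi>0$, and a source $S$ on $[0,L]\times[-\pi,\pi)$, consider the problem $$\sin\phi\,\frac{\partial f}{\partial\eta}+F(\eta)\cos\phi\,\frac{\partial f}{\partial\phi}+f-\bar f=S(\eta,\phi),\qquad f(0,\phi)=h(\phi)\ \text{ for }\sin\phi>0,\qquad f(L,\phi)=f(L,-\phi),$$ where $\bar g(\eta)=\frac1{2\pi}\int_{-\pi}^{\pi}g(\eta,\phi)\,d\phi$, functions of $\phi\in[-\pi,\pi)$ are regarded as $2\pi$-periodic, and $h$, $S$ are bounded and Borel measurable. A *solution* is a bounded Borel function $f$ on $[0,L]\times[-\pi,\pi)$ that satisfies both boundary conditions at every point and the equation along characteristics: whenever $\eta'(s)=\sin\phi(s)$, $\phi'(s)=F(\eta(s))\cos\phi(s)$ and $\eta(s)\in[0,L]$ for $s\in[a,b]$, one has $$f(\eta(b),\phi(b))-f(\eta(a),\phi(a))=\int_a^b\big(\bar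 f-f+S\big)(\eta(s),\phi(s))\,ds .$$ Put $S_Q=\bar S$, $S_R=S-\bar S$, $\langle\sin\phi,S_R\rangle_\phi(y)=\int_{-\pi}^{\pi}\sin\phi\,S_R(y,\phi)\,d\phi$, and $$\|g\|_{2}=\Big(\int_0^L\!\!\int_{-\pi}^{\pi}|g|^2d\phi\,d\eta\Big)^{1/2},\quad \|g\|_{\infty}=\sup_{[0,L]\times[-\pi,\pi)}|g|,\quad |h|_{2,-}=\Big(\int_{\sin\phi>0}|h|^2\sin\phi\,d\phi\Big)^{1/2},\quad |h|_{\infty}=\sup_{\sin\phi>0}|h|.$$ For every $R_{\min}>0$ there are $\epsilon_0>0$ and $C>0$, depending only on $R_{\min}$, such that for all $R_\kappa\ge R_{\min}$, all $0<\epsilon<\epsilon_0$ and all $h$, $S$ as above, the problem has a solution $f$; it is unique, in the sense that every solution equals $f$ at every point of $[0,L]\times[-\pi,\pi)$ outside the grazing set $\{\eta=0,\ \sin\phi=0\}$ (where the problem prescribes nothing); and, with $f$ suitably chosen on the grazing set, there is $f_L\in\mathbb R$ such that $$\begin{aligned}\|f-f_L\|_\infty\le{}& C\big(|h|_{2,-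}+\|S\|_2+|h|_\infty+\|S\|_\infty\big)+C\Big(\int_0^L\Big(\int_\eta^L\langle\sin\phi,S_R\rangle_\phi(y)\,dy\Big)^2d\eta\Big)^{1/2}+C\Big|\int_0^L\langle\sin\phi,S_R\rangle_\phi(y)\,dy\Big|\\&+C\Big|\int_0^L\!\int_\eta^L|S_Q(y)|\,dy\,d\eta\Big|+C\Big(\int_0^L\Big(\int_\eta^L|S_Q(y)|\,dy\Big)^2d\eta\Big)^{1/2}+C\Big(\int_0^L\Big(\int_\eta^L\!\int_y^L|S_Q(z)|\,dz\,dy\Big)^2d\eta\Big)^{1/2},\end{aligned}$$ $$|f_L|\le C\big(|h|_{2,-}+\|S\|_2\big)+C\Big|\int_0^L\langle\sin\phi,S_R\rangle_\phi(y)\,dy\Big|+C\Big|\int_0^L\!\int_\eta^L|S_Q(y)|\,dy\,d\eta\Big| .$$ Moreover, for the same $f$ and $f_L$, $$\begin{aligned}\|f-f_L\|_2\le{}& C\big(|h|_{2,-}+\|S\|_2\big)+C\Big(\int_0^L\Big(\int_\eta^L\langle\sin\phi,S_R\rangle_\phi(y)\,dy\Big)^2d\eta\Big)^{1/2}\\&+C\Big(\int_0^L\Big(\int_\eta^L|S_Q(y)|\,dy\Big)^2d\eta\Big)^{1/2}+C\Big(\int_0^L\Big(\int_\eta^L\!\int_y^L|S_Q(z)|\,dz\,dy\Big)^2d\eta\Big)^{1/2},\end{aligned}$$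 $$\|f-f_L\|_\infty\le C\big(|f_L|+|h|_\infty+\|S\|_\infty+\|f-f_L\|_2\big).$$ -/

import Mathlib

open Real Set MeasureTheory

noncomputable section

namespace EpsMilne

/-! Phase space functions are written `f η φ` with `η ∈ [0, L]` the rescaled normal distance and
`φ` an angle.  The angle is a real number, and phase space functions are `2π`-periodic in it, so
they are the functions on `[0, L] × [-π, π)` with `[-π, π)` regarded as a circle. -/

/-- The length `L = ε^{-1/2}` of the boundary layer. -/
def layerLength (ε : ℝ) : ℝ := ε ^ (-(1 / 2) : ℝ)

/-- The geometric correction `F(η) = -ε / (R - ε η)`, with `R` the radius of curvature. -/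
def force (R ε η : ℝ) : ℝ := -(ε / (R - ε * η))

/-- The velocity average `(1 / 2π) ∫_{-π}^{π} f(η, φ) dφ`. -/
def avg (f : ℝ → ℝ → ℝ) (η : ℝ) : ℝ := (1 / (2 * π)) * ∫ φ in (-π)..π, f η φ

/-- The part `S_Q = S̄` of the source. -/
def srcQ (S : ℝ → ℝ → ℝ) (η : ℝ) : ℝ := avg S η

/-- The part `S_R = S - S̄` of the source. -/
def srcR (S : ℝ → ℝ → ℝ) (η φ : ℝ) : ℝ := S η φ - avg S η

/-- The pairing `⟨sin φ, g⟩_φ (η) = ∫_{-π}^{π} sin φ g(η, φ) dφ`. -/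
def sinPair (g : ℝ → ℝ → ℝ) (η : ℝ) : ℝ := ∫ φ in (-π)..π, sin φ * g η φ

/-- The velocities `φ ∈ [-π, π)` that point into the layer at `η = 0`: those with `sin φ > 0`. -/
def inflow : Set ℝ := {φ | φ ∈ Ico (-π) π ∧ 0 < sin φ}

/-- The grazing set `η = 0`, `sin φ = 0`. -/
def IsGrazing (η φ : ℝ) : Prop := η = 0 ∧ sin φ = 0

/-- The norm of `L²([0, L] × [-π, π))`. -/
def normL2 (L : ℝ) (g : ℝ → ℝ → ℝ) : ℝ := √(∫ η in (0 : ℝ)..L, ∫ φ in (-π)..π, |g η φ| ^ 2)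

/-- The supremum of `|g|` over `[0, L] × [-π, π)`. -/
def normSup (L : ℝ) (g : ℝ → ℝ → ℝ) : ℝ :=
  sSup {y | ∃ η ∈ Icc 0 L, ∃ φ ∈ Ico (-π) π, y = |g η φ|}

/-- The weighted norm `(∫_{sin φ > 0} |h|² sin φ dφ)^{1/2}` of the in-flow data. -/
def inflowNormL2 (h : ℝ → ℝ) : ℝ := √(∫ φ in inflow, |h φ| ^ 2 * sin φ)

/-- The supremum of `|h|` over `sin φ > 0`. -/
def inflowNormSup (h : ℝ → ℝ) : ℝ := sSup {y | ∃ φ ∈ inflow, y = |h φ|}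

/-- `s ↦ (x s, p s)`, `a ≤ s ≤ b`, is an arc of a characteristic curve of the operator
`sin φ ∂_η + F(η) cos φ ∂_φ` that stays in the layer `0 ≤ η ≤ L`. -/
def IsCharacteristic (R ε L a b : ℝ) (x p : ℝ → ℝ) : Prop :=
  ∀ s ∈ Icc a b, x s ∈ Icc 0 L ∧
    HasDerivWithinAt x (sin (p s)) (Icc a b) s ∧
    HasDerivWithinAt p (force R ε (x s) * cos (p s)) (Icc a b) s

/-- Bounded solutions of the `ε`-Milne problem with geometric correction
`sin φ ∂_η f + F(η) cos φ ∂_φ f + f - f̄ = S`, `f(0, φ) = h(φ)` for `sin φ > 0`,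
`f(L, φ) = f(L, -φ)`.  The differential equation is required along characteristics, in integrated
form: `df/ds = f̄ - f + S` along every characteristic arc. -/
structure IsSolution (R ε L : ℝ) (h : ℝ → ℝ) (S f : ℝ → ℝ → ℝ) : Prop where
  measurable : Measurable (Function.uncurry f)
  periodic : ∀ η, Function.Periodic (f η) (2 * π)
  bounded : ∃ M, ∀ η ∈ Icc 0 L, ∀ φ, |f η φ| ≤ M
  transport : ∀ (a b : ℝ) (x p : ℝ → ℝ), a ≤ b → IsCharacteristic R ε L a b x p →
    f (x b) (p b) - f (x a) (p a) =
      ∫ s in a..b, (avg f (x s) - f (x s) (p s) + S (x s) (p s))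
  inflow_bc : ∀ φ ∈ inflow, f 0 φ = h φ
  specular_bc : ∀ φ, f L φ = f L (-φ)

/-- `(∫_0^L (∫_η^L ⟨sin φ, S_R⟩_φ(y) dy)² dη)^{1/2}` -/
def funR₂ (L : ℝ) (S : ℝ → ℝ → ℝ) : ℝ :=
  √(∫ η in (0 : ℝ)..L, (∫ y in η..L, sinPair (srcR S) y) ^ 2)

/-- `|∫_0^L ⟨sin φ, S_R⟩_φ(y) dy|` -/
def funR₁ (L : ℝ) (S : ℝ → ℝ → ℝ) : ℝ := |(∫ y in (0 : ℝ)..L, sinPair (srcR S) y)|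

/-- `|∫_0^L ∫_η^L |S_Q(y)| dy dη|` -/
def funQ₁ (L : ℝ) (S : ℝ → ℝ → ℝ) : ℝ := |(∫ η in (0 : ℝ)..L, (∫ y in η..L, |srcQ S y|))|

/-- `(∫_0^L (∫_η^L |S_Q(y)| dy)² dη)^{1/2}` -/
def funQ₂ (L : ℝ) (S : ℝ → ℝ → ℝ) : ℝ :=
  √(∫ η in (0 : ℝ)..L, (∫ y in η..L, |srcQ S y|) ^ 2)

/-- `(∫_0^L (∫_η^L ∫_y^L |S_Q(z)| dz dy)² dη)^{1/2}` -/
def funQ₃ (L : ℝ) (S : ℝ → ℝ → ℝ) : ℝ :=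
  √(∫ η in (0 : ℝ)..L, (∫ y in η..L, ∫ z in y..L, |srcQ S z|) ^ 2)

end EpsMilne

end

/-! Put ρ = R/ε and pass to u = (ρ - η) cos φ, w = (ρ - η) sin φ. Phase space becomes the annulus ρ
- L ≤ |z| ≤ ρ, the characteristics become vertical lines run downward at unit speed
(`exists_isCharacteristic`, `IsCharacteristic.polar`), and the equation becomes -∂_w f + f = f̄ + S,
where f̄ is a function of |z| alone.

Well-posedness. With f̄ replaced by a given q, the solution is the Duhamel integral `duh` along the
line: it starts on the upper half of the outer circle and, by specular reflection, jumps across the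
inner disk. A path has length at most 2ρ, so q ↦ (average of the solution) is a contraction with
factor 1 - exp(-2ρ). Its fixed point gives existence, and the same inequality gives uniqueness. Only
the grazing points (±ρ, 0) lie on no arc of positive length. The factor degenerates as ε → 0 and
plays no role in the estimates.

L² estimate. Integrating a derivative along characteristics over an annulus, once in Cartesian and
once in polar coordinates, gives a divergence theorem (`flux_sub_flux`). Applied to f, f² and f sin
φ / (ρ - η) it yields balances of mass, energy and momentum. The energy balance controls f - f̄
except for a term f̄ S_Q. The momentum ∫ sin²φ f equals π f̄ plus a moment of f - f̄, and
integrating mass against momentum by parts (`IsSolution.integral_srcQ_mul_momentum`) trades S_Q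
times the momentum for terms with the mass flux, which the tail ∫_η^L |S_Q| bounds. This gives
`IsSolution.energy_le`. Then f̄ is recovered by integrating the momentum balance from η = L, with
f_L = π⁻¹ ∫ sin²φ f(L, φ) dφ. The curvature term there contains the moment against cos 2φ, which
sees only f - f̄, with a weight (ρ - y)⁻¹ ≤ L⁻¹. By Cauchy–Schwarz its square is O(L⁻¹) pointwise,
so it is harmless after integration over [0, L].

Supremum estimate. On a line transversal to the circles the radius is an admissible variable, so the
Duhamel integral of f̄ is bounded by the L² norm of f̄ plus a small multiple of sup |f̄|
(`duh_radial_le`). The remaining directions fill at most a quarter of the circle. Averaging gives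
sup |f̄| ≤ data + sup |f̄| / 2 (`exists_abs_avg_le`), and this is applied to f - f_L. -/

noncomputable section

namespace EpsMilne

section

/-! ### Products of primitives -/

/-- The product rule for primitives of integrable functions. -/
theorem mul_sub_mul_eq_integral_of_primitive {u v U V : ℝ → ℝ} {a b : ℝ} (hab : a ≤ b)
    (hU : IntervalIntegrable U volume a b) (hV : IntervalIntegrable V volume a b)
    (hu : ∀ x ∈ Icc a b, u x = u b + ∫ t in x..b, U t)
    (hv : ∀ x ∈ Icc a b, v x = v b + ∫ t in x..b, V t) :
    u a * v a - u b * v b = ∫ t in a..b, (U t * v t + u t * V t) := by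
  -- The hypotheses describe `u` and `v` on `[a, b]` only. They are replaced by globally defined
  -- absolutely continuous primitives that agree with them there.
  have key : ∀ {u U : ℝ → ℝ}, IntervalIntegrable U volume a b →
      (∀ x ∈ Icc a b, u x = u b + ∫ t in x..b, U t) →
      AbsolutelyContinuousOnInterval (fun x => u b + (-1) * ∫ t in b..x, U t) a b ∧
      (∀ x ∈ Icc a b, u b + (-1) * ∫ t in b..x, U t = u x) ∧
      ∀ᵐ x, x ∈ uIcc a b → deriv (fun x => u b + (-1) * ∫ t in b..x, U t) x = -U x := by
    intro u U hU hu
    refine ⟨?_, fun x hx => ?_, ?_⟩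
    · have h1 : AbsolutelyContinuousOnInterval (fun _ : ℝ => u b) a b :=
        ((LipschitzWith.const (u b)).lipschitzOnWith (s := uIcc a b)).absolutelyContinuousOnInterval
      exact h1.add ((hU.absolutelyContinuousOnInterval_intervalIntegral (c := b)
        (by simp)).const_mul (-1))
    · rw [hu x hx, intervalIntegral.integral_symm b x]; ring
    · filter_upwards [hU.ae_hasDerivAt_integral] with x hx hxm
      have := ((hx hxm b (by simp)).const_mul (-1)).const_add (u b)
      rw [this.deriv]; ring
  obtain ⟨hu1, hu2, hu3⟩ := key hU hu
  obtain ⟨hv1, hv2, hv3⟩ := key hV hv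
  have h := hu1.integral_deriv_mul_eq_sub hv1
  have ha : a ∈ Icc a b := ⟨le_rfl, hab⟩
  have hb : b ∈ Icc a b := ⟨hab, le_rfl⟩
  rw [hu2 a ha, hu2 b hb, hv2 a ha, hv2 b hb] at h
  have : ∫ t in a..b, (U t * v t + u t * V t) = -(u b * v b - u a * v a) := by
    rw [← h, ← intervalIntegral.integral_neg]
    refine intervalIntegral.integral_congr_ae ?_
    filter_upwards [hu3, hv3] with x h1 h2 hx
    have hx' : x ∈ uIcc a b := uIoc_subset_uIcc hx
    have hx'' : x ∈ Icc a b := by rwa [uIcc_of_le hab] at hx'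
    rw [h1 hx', h2 hx', hu2 x hx'', hv2 x hx'']; ring
  rw [this]; ring

/-! ### Cartesian coordinates -/

/-- A phase space function in the coordinates `u = r cos φ`, `w = r sin φ`, `r = ρ - η`. -/
def cart (ρ : ℝ) (G : ℝ → ℝ → ℝ) (u w : ℝ) : ℝ :=
  G (ρ - √(u ^ 2 + w ^ 2)) (Complex.arg ⟨u, w⟩)

/-- `D` is the derivative of `F` along the downward vertical segments in the annulus
`a ≤ |z| ≤ b`. -/
def IsTransport (a b : ℝ) (F D : ℝ → ℝ → ℝ) : Prop :=
  ∀ u w₁ w₂, w₁ ≤ w₂ → (∀ w ∈ Icc w₁ w₂, a ^ 2 ≤ u ^ 2 + w ^ 2 ∧ u ^ 2 + w ^ 2 ≤ b ^ 2) →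
    F u w₁ - F u w₂ = ∫ w in w₁..w₂, D u w

theorem periodic_eq_of_cos_sin {g : ℝ → ℝ} (hg : Function.Periodic g (2 * π)) {p q : ℝ}
    (hc : cos p = cos q) (hs : sin p = sin q) : g p = g q := by
  have h : (p : Real.Angle) = q := Real.Angle.cos_sin_inj hc hs
  obtain ⟨k, hk⟩ := Real.Angle.angle_eq_iff_two_pi_dvd_sub.1 h
  have : p = q + k * (2 * π) := by linarith
  rw [this]
  exact hg.int_mul k q

theorem norm_mk (u w : ℝ) : ‖(⟨u, w⟩ : ℂ)‖ = √(u ^ 2 + w ^ 2) := by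
  rw [Complex.norm_def, Complex.normSq_mk]; congr 1; ring

theorem mk_ne_zero {u w : ℝ} (h : 0 < u ^ 2 + w ^ 2) : (⟨u, w⟩ : ℂ) ≠ 0 := by
  intro h0
  have h1 := congrArg Complex.re h0
  have h2 := congrArg Complex.im h0
  simp at h1 h2
  simp [h1, h2] at h

theorem cos_arg_mk {u w : ℝ} (h : 0 < u ^ 2 + w ^ 2) :
    cos (Complex.arg ⟨u, w⟩) = u / √(u ^ 2 + w ^ 2) := by
  rw [Complex.cos_arg (mk_ne_zero h), norm_mk]

theorem sin_arg_mk (u w : ℝ) :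
    sin (Complex.arg ⟨u, w⟩) = w / √(u ^ 2 + w ^ 2) := by
  rw [Complex.sin_arg, norm_mk]

theorem sqrt_polar {r : ℝ} (hr : 0 ≤ r) (p : ℝ) : √((r * cos p) ^ 2 + (r * sin p) ^ 2) = r := by
  rw [show (r * cos p) ^ 2 + (r * sin p) ^ 2 = r ^ 2 by
    linear_combination r ^ 2 * Real.sin_sq_add_cos_sq p, sqrt_sq hr]

theorem cart_polar {ρ η : ℝ} (hr : 0 < ρ - η) {G : ℝ → ℝ → ℝ}
    (hG : Function.Periodic (G η) (2 * π)) (p : ℝ) :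
    cart ρ G ((ρ - η) * cos p) ((ρ - η) * sin p) = G η p := by
  unfold cart
  have h0 := sqrt_polar hr.le p
  rw [h0, sub_sub_cancel]
  have hpos : 0 < ((ρ - η) * cos p) ^ 2 + ((ρ - η) * sin p) ^ 2 := Real.sqrt_pos.1 (by rw [h0]; exact hr)
  apply periodic_eq_of_cos_sin hG
  · rw [cos_arg_mk hpos, h0]; field_simp
  · rw [sin_arg_mk, h0]; field_simp

theorem measurable_mk : Measurable fun z : ℝ × ℝ => (⟨z.1, z.2⟩ : ℂ) :=
  Complex.measurableEquivRealProd.symm.measurable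

theorem measurable_cart (ρ : ℝ) {G : ℝ → ℝ → ℝ} (hG : Measurable (Function.uncurry G)) :
    Measurable (Function.uncurry (cart ρ G)) := by
  have h : Measurable fun z : ℝ × ℝ => (ρ - √(z.1 ^ 2 + z.2 ^ 2), Complex.arg ⟨z.1, z.2⟩) :=
    Measurable.prodMk (by fun_prop) (Complex.measurable_arg.comp measurable_mk)
  exact hG.comp h

/-! ### Characteristics are straight lines -/

theorem force_eq {R ε : ℝ} (hε : 0 < ε) (η : ℝ) : force R ε η = -(1 / (R / ε - η)) := by
  unfold force
  congr 1
  rw [div_sub' hε.ne', one_div_div]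

theorem hasDerivAt_arg_line {u c σ s : ℝ} (h : (⟨u, c + σ * s⟩ : ℂ) ∈ Complex.slitPlane) :
    HasDerivAt (fun s => Complex.arg ⟨u, c + σ * s⟩) (σ * u / (u ^ 2 + (c + σ * s) ^ 2)) s := by
  have h1 : HasDerivAt (fun s : ℝ => (⟨u, c + σ * s⟩ : ℂ)) ⟨0, σ⟩ s := by
    have h2 : HasDerivAt (fun s : ℝ => c + σ * s) σ s := by
      simpa using ((hasDerivAt_id s).const_mul σ).const_add c
    have h3 := (h2.ofReal_comp.mul_const Complex.I).const_add (u : ℂ)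
    have h6 : (fun s : ℝ => (⟨u, c + σ * s⟩ : ℂ)) =
        fun x : ℝ => (u : ℂ) + ((c + σ * x : ℝ) : ℂ) * Complex.I := by
      ext1 t; simp [Complex.ext_iff]
    rw [h6]
    exact h3.congr_deriv (by simp [Complex.ext_iff])
  have h4 := Complex.imCLM.hasFDerivAt.comp_hasDerivAt s (h1.clog_real h)
  have h5 : (⇑Complex.imCLM ∘ fun t : ℝ => Complex.log ⟨u, c + σ * t⟩) =
      fun s => Complex.arg ⟨u, c + σ * s⟩ := by
    ext t; simp [Complex.log_im]
  rw [h5] at h4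
  refine h4.congr_deriv ?_
  simp [Complex.div_im, Complex.normSq_mk]
  ring

theorem hasDerivAt_sqrt_line {u c s : ℝ} (h : 0 < u ^ 2 + (c - s) ^ 2) (ρ : ℝ) :
    HasDerivAt (fun s => ρ - √(u ^ 2 + (c - s) ^ 2)) ((c - s) / √(u ^ 2 + (c - s) ^ 2)) s := by
  have h1 : HasDerivAt (fun s => u ^ 2 + (c - s) ^ 2) (2 * (c - s) * (-1)) s := by
    have := (((hasDerivAt_id s).const_sub c).pow 2).const_add (u ^ 2)
    simpa using this
  refine ((h1.sqrt h.ne').const_sub ρ).congr_deriv ?_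
  have := (Real.sqrt_pos.2 h).ne'
  field_simp

/-- Vertical segments in the annulus are characteristics. -/
theorem exists_isCharacteristic {R ε L : ℝ} (hε : 0 < ε) (hL : 0 < R / ε - L) (hR : 0 < R / ε)
    {u w₁ w₂ : ℝ} (hann : ∀ w ∈ Icc w₁ w₂,
      (R / ε - L) ^ 2 ≤ u ^ 2 + w ^ 2 ∧ u ^ 2 + w ^ 2 ≤ (R / ε) ^ 2) :
    ∃ p : ℝ → ℝ, IsCharacteristic R ε L 0 (w₂ - w₁)
        (fun s => R / ε - √(u ^ 2 + (w₂ - s) ^ 2)) p ∧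
      ∀ s ∈ Icc 0 (w₂ - w₁), cos (p s) = cos (Complex.arg ⟨u, w₂ - s⟩) ∧
        sin (p s) = sin (Complex.arg ⟨u, w₂ - s⟩) := by
  have hmem : ∀ s ∈ Icc 0 (w₂ - w₁), w₂ - s ∈ Icc w₁ w₂ := fun s hs =>
    ⟨by linarith [hs.2], by linarith [hs.1]⟩
  have hpos : ∀ s ∈ Icc 0 (w₂ - w₁), 0 < u ^ 2 + (w₂ - s) ^ 2 := fun s hs =>
    lt_of_lt_of_le (by positivity) (hann _ (hmem s hs)).1
  have build : ∀ p : ℝ → ℝ,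
      (∀ s ∈ Icc 0 (w₂ - w₁), cos (p s) = cos (Complex.arg ⟨u, w₂ - s⟩) ∧
        sin (p s) = sin (Complex.arg ⟨u, w₂ - s⟩)) →
      (∀ s ∈ Icc 0 (w₂ - w₁), HasDerivAt p (-u / (u ^ 2 + (w₂ - s) ^ 2)) s) →
      IsCharacteristic R ε L 0 (w₂ - w₁) (fun s => R / ε - √(u ^ 2 + (w₂ - s) ^ 2)) p := by
    intro p hcs hd s hs
    have hp := hpos s hs
    have hq := Real.sqrt_pos.2 hp
    refine ⟨⟨?_, ?_⟩, ?_, ?_⟩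
    · rw [sub_nonneg]
      exact (Real.sqrt_le_left hR.le).2 (hann _ (hmem s hs)).2
    · have := Real.le_sqrt_of_sq_le (hann _ (hmem s hs)).1
      linarith
    · rw [(hcs s hs).2, sin_arg_mk]
      exact (hasDerivAt_sqrt_line hp _).hasDerivWithinAt
    · rw [(hcs s hs).1, cos_arg_mk hp, force_eq hε]
      refine (hd s hs).hasDerivWithinAt.congr_deriv ?_
      rw [sub_sub_cancel]
      have h2 := Real.sq_sqrt hp.le
      rw [neg_mul, one_div_mul_eq_div, div_div, ← sq, h2, neg_div]
  -- The angle must be differentiable along the segment, so the branch cut of `arg` has to be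
  -- avoided. The half plane `u ≥ 0` without the origin lies in the slit plane. For `u < 0` the
  -- point is rotated by π first.
  by_cases hu : 0 ≤ u
  · refine ⟨fun s => Complex.arg ⟨u, w₂ - s⟩, ?_, fun s _ => ⟨rfl, rfl⟩⟩
    refine build _ (fun s _ => ⟨rfl, rfl⟩) fun s hs => ?_
    have hsl : (⟨u, w₂ + (-1) * s⟩ : ℂ) ∈ Complex.slitPlane := by
      rw [Complex.mem_slitPlane_iff]
      rcases hu.lt_or_eq with h | h
      · exact Or.inl h
      · right
        have := hpos s hs
        rw [← h] at this
        intro h0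
        simp only at h0
        have : w₂ - s = 0 := by linarith
        simp [this] at *
    have h1 : (fun s => Complex.arg ⟨u, w₂ - s⟩) = fun s => Complex.arg ⟨u, w₂ + (-1) * s⟩ := by
      ext t; congr 2; ring
    rw [h1]
    exact (hasDerivAt_arg_line hsl).congr_deriv (by congr 1 <;> ring)
  · push Not at hu
    have hcs : ∀ s ∈ Icc 0 (w₂ - w₁),
        cos (Complex.arg ⟨-u, -w₂ + 1 * s⟩ + π) = cos (Complex.arg ⟨u, w₂ - s⟩) ∧
        sin (Complex.arg ⟨-u, -w₂ + 1 * s⟩ + π) = sin (Complex.arg ⟨u, w₂ - s⟩) := by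
      intro s hs
      have h1 : (-u) ^ 2 + (-w₂ + 1 * s) ^ 2 = u ^ 2 + (w₂ - s) ^ 2 := by ring
      have hp := hpos s hs
      rw [cos_add_pi, sin_add_pi, cos_arg_mk (h1 ▸ hp), sin_arg_mk, cos_arg_mk hp, sin_arg_mk, h1]
      constructor <;> ring
    refine ⟨fun s => Complex.arg ⟨-u, -w₂ + 1 * s⟩ + π, build _ hcs fun s hs => ?_, hcs⟩
    have hsl : (⟨-u, -w₂ + 1 * s⟩ : ℂ) ∈ Complex.slitPlane := by
      rw [Complex.mem_slitPlane_iff]; left; simpa using hu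
    exact ((hasDerivAt_arg_line hsl).add_const π).congr_deriv (by congr 1 <;> ring)

theorem cart_eq_of_cos_sin {ρ u w p : ℝ} {G : ℝ → ℝ → ℝ} (hG : ∀ η, Function.Periodic (G η) (2 * π))
    (hc : cos p = cos (Complex.arg ⟨u, w⟩)) (hs : sin p = sin (Complex.arg ⟨u, w⟩)) :
    cart ρ G u w = G (ρ - √(u ^ 2 + w ^ 2)) p :=
  (periodic_eq_of_cos_sin (hG _) hc hs).symm

/-- Each vertical segment in the annulus lifts to a characteristic arc, with time running from the
upper endpoint down. -/
theorem IsSolution.isTransport {R ε L : ℝ} (hε : 0 < ε) (hL : 0 < R / ε - L) (hR : 0 < R / ε)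
    {h : ℝ → ℝ} {S f : ℝ → ℝ → ℝ} (hS : ∀ η, Function.Periodic (S η) (2 * π))
    (hf : IsSolution R ε L h S f) :
    IsTransport (R / ε - L) (R / ε) (cart (R / ε) f)
      (cart (R / ε) fun η φ => avg f η - f η φ + S η φ) := by
  intro u w₁ w₂ hw hann
  obtain ⟨p, hp, hcs⟩ := exists_isCharacteristic hε hL hR hann
  have hT := hf.transport 0 (w₂ - w₁) _ p (by linarith) hp
  have hD : ∀ η, Function.Periodic (fun φ => avg f η - f η φ + S η φ) (2 * π) := by
    intro η φ
    simp only [hf.periodic η φ, hS η φ]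
  have h0 := hcs 0 ⟨le_rfl, by linarith⟩
  have h1 := hcs (w₂ - w₁) ⟨by linarith, le_rfl⟩
  rw [sub_zero] at h0
  rw [sub_sub_cancel] at h1
  simp only [sub_sub_cancel, sub_zero] at hT
  rw [cart_eq_of_cos_sin hf.periodic h0.1 h0.2, cart_eq_of_cos_sin hf.periodic h1.1 h1.2, hT]
  have h2 := intervalIntegral.integral_comp_sub_left
    (f := fun w => cart (R / ε) (fun η φ => avg f η - f η φ + S η φ) u w) (a := 0) (b := w₂ - w₁) w₂
  rw [sub_sub_cancel, sub_zero] at h2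
  rw [← h2]
  refine intervalIntegral.integral_congr fun s hs => ?_
  rw [uIcc_of_le (by linarith)] at hs
  exact (cart_eq_of_cos_sin hD (hcs s hs).1 (hcs s hs).2).symm

/-- Along a characteristic `r cos φ` is conserved and `r sin φ` decreases at unit speed. -/
theorem IsCharacteristic.polar {R ε L a b : ℝ} {x p : ℝ → ℝ} (hε : 0 < ε) (hL : 0 < R / ε - L)
    (hc : IsCharacteristic R ε L a b x p) {s : ℝ} (hs : s ∈ Icc a b) :
    (R / ε - x s) * cos (p s) = (R / ε - x a) * cos (p a) ∧
      (R / ε - x s) * sin (p s) = (R / ε - x a) * sin (p a) - (s - a) := by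
  have ha : a ∈ Icc a b := ⟨le_rfl, hs.1.trans hs.2⟩
  have hr : ∀ t ∈ Icc a b, R / ε - x t ≠ 0 := fun t ht => by
    have := (hc t ht).1.2
    intro h; linarith
  have h1 : ∀ t ∈ Icc a b,
      HasDerivWithinAt (fun t => (R / ε - x t) * cos (p t)) 0 (Icc a b) t := by
    intro t ht
    obtain ⟨_, hx, hp⟩ := hc t ht
    refine ((hx.const_sub (R / ε)).mul hp.cos).congr_deriv ?_
    rw [force_eq hε]
    have := hr t ht
    generalize R / ε - x t = r at this ⊢
    field_simp
    ring
  have h2 : ∀ t ∈ Icc a b,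
      HasDerivWithinAt (fun t => (R / ε - x t) * sin (p t) + t) 0 (Icc a b) t := by
    intro t ht
    obtain ⟨_, hx, hp⟩ := hc t ht
    refine (((hx.const_sub (R / ε)).mul hp.sin).add (hasDerivWithinAt_id t _)).congr_deriv ?_
    rw [force_eq hε]
    have := hr t ht
    generalize R / ε - x t = r at this ⊢
    field_simp
    linear_combination -Real.sin_sq_add_cos_sq (p t)
  -- Both quantities have derivative zero on the interval; the mean value inequality with constant 0
  -- makes them constant.
  have e1 := (convex_Icc a b).norm_image_sub_le_of_norm_hasDerivWithin_le (C := 0) h1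
    (by simp) ha hs
  have e2 := (convex_Icc a b).norm_image_sub_le_of_norm_hasDerivWithin_le (C := 0) h2
    (by simp) ha hs
  rw [zero_mul, norm_le_zero_iff] at e1 e2
  constructor <;> linarith

end

section

/-! ### The divergence theorem in the annulus -/

theorem integrableOn_of_bdd {α : Type*} [MeasurableSpace α] {μ : Measure α} {s : Set α}
    {g : α → ℝ} {M : ℝ} (hg : Measurable g) (hs : MeasurableSet s) (hμ : μ s ≠ ⊤)
    (hM : ∀ x ∈ s, |g x| ≤ M) : IntegrableOn g s μ :=
  Measure.integrableOn_of_bounded hμ hg.aestronglyMeasurable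
    ((ae_restrict_iff' hs).2 (ae_of_all _ hM))

theorem intervalIntegrable_of_bdd {g : ℝ → ℝ} {a b M : ℝ} (hg : Measurable g) (hab : a ≤ b)
    (hM : ∀ x ∈ Icc a b, |g x| ≤ M) : IntervalIntegrable g volume a b := by
  rw [intervalIntegrable_iff_integrableOn_Ioc_of_le hab]
  exact integrableOn_of_bdd hg measurableSet_Ioc (by simp) fun x hx => hM x (Ioc_subset_Icc_self hx)

theorem measurableSet_and_le {α : Type*} [MeasurableSpace α] {g : α → ℝ} (hg : Measurable g)
    (a b : ℝ) : MeasurableSet {z | a ≤ g z ∧ g z ≤ b} := by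
  have : {z | a ≤ g z ∧ g z ≤ b} = g ⁻¹' Icc a b := by ext; simp
  rw [this]
  exact hg measurableSet_Icc

/-- No periodicity is needed on the principal branch. This form serves the polar side of the
divergence theorem, where `D` need not be periodic. -/
theorem cart_polar_of_mem {ρ η : ℝ} (hr : 0 < ρ - η) (G : ℝ → ℝ → ℝ) {p : ℝ}
    (hp : p ∈ Ioc (-π) π) : cart ρ G ((ρ - η) * cos p) ((ρ - η) * sin p) = G η p := by
  unfold cart
  rw [sqrt_polar hr.le p, sub_sub_cancel]
  congr 1
  convert Complex.arg_mul_cos_add_sin_mul_I hr hp using 2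
  simp [Complex.ext_iff, Complex.cos_ofReal_re, Complex.sin_ofReal_re]

/-- The substitution u = r cos φ, which maps (0, π) injectively onto (-r, r) with Jacobian r sin φ.
-/
theorem integral_mul_sin_eq_of_comp_cos {r : ℝ} (hr : 0 < r) {g H : ℝ → ℝ}
    (h : ∀ φ ∈ Ioo 0 π, g (r * cos φ) = H φ) :
    r * ∫ φ in (0 : ℝ)..π, sin φ * H φ = ∫ u in Ioo (-r) r, g u := by
  have himg : (fun φ => r * cos φ) '' Ioo 0 π = Ioo (-r) r := by
    have h1 : cos '' Ioo 0 π = Ioo (-1) 1 := by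
      ext x; constructor
      · rintro ⟨p, hp, rfl⟩
        refine ⟨?_, ?_⟩
        · rw [← cos_pi]; exact cos_lt_cos_of_nonneg_of_le_pi hp.1.le le_rfl hp.2
        · rw [← cos_zero]; exact cos_lt_cos_of_nonneg_of_le_pi le_rfl hp.2.le hp.1
      · rintro ⟨h1, h2⟩
        exact ⟨arccos x, ⟨arccos_pos.2 h2, by
          refine lt_of_le_of_ne (arccos_le_pi x) fun h => ?_
          rw [arccos_eq_pi] at h; linarith⟩, cos_arccos h1.le h2.le⟩
    have h2 : (fun φ => r * cos φ) = (fun x => r * x) ∘ cos := rfl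
    rw [h2, image_comp, h1]
    ext x; constructor
    · rintro ⟨y, hy, rfl⟩
      exact ⟨by nlinarith [hy.1], by nlinarith [hy.2]⟩
    · rintro ⟨h1, h2⟩
      exact ⟨x / r, ⟨by rw [lt_div_iff₀ hr]; linarith, by rw [div_lt_iff₀ hr]; linarith⟩,
        by field_simp⟩
  have hinj : InjOn (fun φ => r * cos φ) (Ioo 0 π) := fun x hx y hy hxy =>
    injOn_cos (Ioo_subset_Icc_self hx) (Ioo_subset_Icc_self hy) (mul_left_cancel₀ hr.ne' hxy)
  rw [← himg, integral_image_eq_integral_abs_deriv_smul measurableSet_Ioo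
    (fun x _ => ((hasDerivAt_cos x).const_mul r).hasDerivWithinAt) hinj,
    intervalIntegral.integral_of_le pi_pos.le, integral_Ioc_eq_integral_Ioo, ← integral_const_mul]
  refine setIntegral_congr_fun measurableSet_Ioo fun φ hφ => ?_
  have hs := sin_pos_of_mem_Ioo hφ
  simp only [h φ hφ, smul_eq_mul, abs_mul, abs_neg, abs_of_pos hr, abs_of_pos hs]
  ring

/-- The jump of `F` across the disk of radius `r` on the vertical line at `u`. -/
def chordJump (ρ : ℝ) (F : ℝ → ℝ → ℝ) (r u : ℝ) : ℝ :=
  cart ρ F u (√(r ^ 2 - u ^ 2)) - cart ρ F u (-√(r ^ 2 - u ^ 2))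

theorem measurable_chordJump (ρ : ℝ) {F : ℝ → ℝ → ℝ} (hF : Measurable (Function.uncurry F))
    (r : ℝ) : Measurable (chordJump ρ F r) := by
  have h := measurable_cart ρ hF
  exact (h.comp (Measurable.prodMk measurable_id (by fun_prop : Measurable fun u : ℝ =>
    √(r ^ 2 - u ^ 2)))).sub (h.comp (Measurable.prodMk measurable_id
      (by fun_prop : Measurable fun u : ℝ => -√(r ^ 2 - u ^ 2))))

theorem abs_cart_le {ρ L M : ℝ} (hρ : 0 < ρ) {F : ℝ → ℝ → ℝ}
    (hM : ∀ η ∈ Icc 0 L, ∀ φ, |F η φ| ≤ M) {u w : ℝ} (h1 : (ρ - L) ^ 2 ≤ u ^ 2 + w ^ 2)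
    (h2 : u ^ 2 + w ^ 2 ≤ ρ ^ 2) : |cart ρ F u w| ≤ M := by
  refine hM _ ⟨?_, ?_⟩ _
  · rw [sub_nonneg]; exact (Real.sqrt_le_left hρ.le).2 h2
  · have := Real.le_sqrt_of_sq_le h1; linarith

theorem sq_le_sq_of_mem_Ioo {r u : ℝ} (hu : u ∈ Ioo (-r) r) : u ^ 2 ≤ r ^ 2 :=
  sq_le_sq' hu.1.le hu.2.le

theorem abs_chordJump_le {ρ L M r u : ℝ} (hL : 0 < ρ - L) (h1 : ρ - L ≤ r) (h2 : r ≤ ρ)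
    {F : ℝ → ℝ → ℝ} (hM : ∀ η ∈ Icc 0 L, ∀ φ, |F η φ| ≤ M) (hu : u ∈ Ioo (-r) r) :
    |chordJump ρ F r u| ≤ 2 * M := by
  have e : √(r ^ 2 - u ^ 2) ^ 2 = r ^ 2 - u ^ 2 :=
    Real.sq_sqrt (by linarith [sq_le_sq_of_mem_Ioo hu])
  have e' : (-√(r ^ 2 - u ^ 2)) ^ 2 = r ^ 2 - u ^ 2 := by rw [neg_sq, e]
  have i1 : (ρ - L) ^ 2 ≤ r ^ 2 := by gcongr
  have i2 : r ^ 2 ≤ ρ ^ 2 := by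
    have : 0 ≤ r := by linarith
    gcongr
  have hρ0 : 0 < ρ := by linarith
  have a1 := abs_cart_le (u := u) (w := √(r ^ 2 - u ^ 2)) hρ0 hM
    (by rw [e]; linarith) (by rw [e]; linarith)
  have a2 := abs_cart_le (u := u) (w := -√(r ^ 2 - u ^ 2)) hρ0 hM
    (by rw [e']; linarith) (by rw [e']; linarith)
  calc |chordJump ρ F r u| ≤ _ := abs_sub _ _
    _ ≤ 2 * M := by linarith

theorem arg_conj_cos_sin {u w : ℝ} (h : 0 < u ^ 2 + w ^ 2) :
    cos (-Complex.arg ⟨u, w⟩) = cos (Complex.arg ⟨u, -w⟩) ∧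
      sin (-Complex.arg ⟨u, w⟩) = sin (Complex.arg ⟨u, -w⟩) := by
  rw [cos_neg, sin_neg, cos_arg_mk h, sin_arg_mk, cos_arg_mk (by rwa [neg_sq]), sin_arg_mk, neg_sq]
  exact ⟨rfl, by ring⟩

/-- The flux through a circle as an integral over vertical lines. -/
theorem flux_eq_integral_chordJump {ρ η M : ℝ} (hr : 0 < ρ - η) {F : ℝ → ℝ → ℝ}
    (hF : Measurable (Function.uncurry F)) (hp : ∀ η, Function.Periodic (F η) (2 * π))
    (hM : ∀ φ, |F η φ| ≤ M) :
    (ρ - η) * ∫ φ in (-π)..π, sin φ * F η φ = ∫ u in Ioo (-(ρ - η)) (ρ - η), chordJump ρ F (ρ - η) u := by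
  set r := ρ - η with hrdef
  have hFη : Measurable (F η) := hF.of_uncurry_left
  have hw : ∀ φ ∈ Ioo 0 π, √(r ^ 2 - (r * cos φ) ^ 2) = r * sin φ := by
    intro φ hφ
    rw [show r ^ 2 - (r * cos φ) ^ 2 = (r * sin φ) ^ 2 by
      linear_combination -r ^ 2 * Real.sin_sq_add_cos_sq φ]
    exact Real.sqrt_sq (mul_pos hr (sin_pos_of_mem_Ioo hφ)).le
  have h1 := integral_mul_sin_eq_of_comp_cos hr (g := fun u => cart ρ F u (√(r ^ 2 - u ^ 2)))
    (H := F η) fun φ hφ => by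
      simp only [hw φ hφ]
      exact cart_polar hr (hp η) φ
  have h2 := integral_mul_sin_eq_of_comp_cos hr (g := fun u => cart ρ F u (-√(r ^ 2 - u ^ 2)))
    (H := fun φ => F η (-φ)) fun φ hφ => by
      simp only [hw φ hφ]
      have := cart_polar hr (hp η) (-φ)
      rwa [cos_neg, sin_neg, mul_neg] at this
  have hint : ∀ a b : ℝ, IntervalIntegrable (fun φ => sin φ * F η φ) volume a b := by
    intro a b
    have : ∀ a b : ℝ, a ≤ b → IntervalIntegrable (fun φ => sin φ * F η φ) volume a b :=
      fun a b hab => intervalIntegrable_of_bdd (M := 1 * M) (by fun_prop) hab fun φ _ => by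
        rw [abs_mul]
        have := abs_sin_le_one φ
        have := hM φ
        gcongr
    rcases le_total a b with h | h
    · exact this a b h
    · exact (this b a h).symm
  have h3 : ∫ φ in (-π)..0, sin φ * F η φ = -∫ φ in (0 : ℝ)..π, sin φ * F η (-φ) := by
    have := intervalIntegral.integral_comp_neg (a := 0) (b := π) fun φ => sin φ * F η φ
    rw [neg_zero] at this
    rw [← this, ← intervalIntegral.integral_neg]
    refine intervalIntegral.integral_congr fun φ _ => ?_
    simp only [sin_neg]; ring
  rw [← intervalIntegral.integral_add_adjacent_intervals (hint (-π) 0) (hint 0 π), h3, mul_add,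
    mul_neg, h1, h2, neg_add_eq_sub]
  have hbd : ∀ u ∈ Ioo (-r) r, ∀ w : ℝ, w ^ 2 = r ^ 2 - u ^ 2 → |cart ρ F u w| ≤ M := by
    intro u hu w hw
    unfold cart
    rw [show u ^ 2 + w ^ 2 = r ^ 2 by linarith, Real.sqrt_sq hr.le, hrdef, sub_sub_cancel]
    exact hM _
  have hs : ∀ u ∈ Ioo (-r) r, √(r ^ 2 - u ^ 2) ^ 2 = r ^ 2 - u ^ 2 := fun u hu =>
    Real.sq_sqrt (by linarith [sq_le_sq_of_mem_Ioo hu])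
  have hc := measurable_cart ρ hF
  rw [← integral_sub]
  · rfl
  · exact integrableOn_of_bdd (hc.comp (Measurable.prodMk measurable_id (by fun_prop :
      Measurable fun u : ℝ => √(r ^ 2 - u ^ 2)))) measurableSet_Ioo (by simp)
      fun u hu => hbd u hu _ (hs u hu)
  · exact integrableOn_of_bdd (hc.comp (Measurable.prodMk measurable_id (by fun_prop :
      Measurable fun u : ℝ => -√(r ^ 2 - u ^ 2)))) measurableSet_Ioo (by simp)
      fun u hu => hbd u hu _ (by rw [neg_sq, hs u hu])

/-- The integral of `D` over the part of a vertical line in the annulus `a ≤ |z| ≤ r`. -/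
theorem integral_slice {ρ a r u : ℝ} (ha : 0 < a) (har : a ≤ r) (hrρ : r ≤ ρ) {F D : ℝ → ℝ → ℝ}
    {M : ℝ} (hD : Measurable (Function.uncurry D))
    (hM : ∀ w, a ^ 2 ≤ u ^ 2 + w ^ 2 → u ^ 2 + w ^ 2 ≤ r ^ 2 → |cart ρ D u w| ≤ M)
    (hT : IsTransport a ρ (cart ρ F) (cart ρ D)) (hu : u ∈ Ioo (-r) r) :
    ∫ w in {w | a ^ 2 ≤ u ^ 2 + w ^ 2 ∧ u ^ 2 + w ^ 2 ≤ r ^ 2}, cart ρ D u w =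
      (Ioo (-a) a).indicator (chordJump ρ F a) u - chordJump ρ F r u := by
  have hr0 : u ^ 2 ≤ r ^ 2 := sq_le_sq_of_mem_Ioo hu
  have hrρ2 : r ^ 2 ≤ ρ ^ 2 := by
    have : 0 ≤ r := by linarith
    gcongr
  have har2 : a ^ 2 ≤ r ^ 2 := by gcongr
  set W := √(r ^ 2 - u ^ 2) with hW
  have hWs : W ^ 2 = r ^ 2 - u ^ 2 := Real.sq_sqrt (by linarith)
  have hW0 : 0 ≤ W := Real.sqrt_nonneg _
  have hDm : Measurable (cart ρ D u) := (measurable_cart ρ hD).of_uncurry_left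
  -- If the line meets the open inner disk, the slice consists of two segments, whose four endpoint
  -- values group into the two chord jumps. Otherwise, tangency included, it is a single segment.
  by_cases hua : u ∈ Ioo (-a) a
  · have hu2 := sq_le_sq_of_mem_Ioo hua
    set V := √(a ^ 2 - u ^ 2) with hV
    have hVs : V ^ 2 = a ^ 2 - u ^ 2 := Real.sq_sqrt (by linarith)
    have hV0 : 0 < V := Real.sqrt_pos.2 (by nlinarith [hua.1, hua.2])
    have hVW : V ≤ W := by apply Real.sqrt_le_sqrt; linarith
    have hset : {w | a ^ 2 ≤ u ^ 2 + w ^ 2 ∧ u ^ 2 + w ^ 2 ≤ r ^ 2} =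
        Icc (-W) (-V) ∪ Icc V W := by
      ext w
      simp only [mem_ofPred_eq, mem_union, mem_Icc]
      constructor
      · rintro ⟨h1, h2⟩
        have h3 : V ^ 2 ≤ w ^ 2 := by linarith
        have h4 : w ^ 2 ≤ W ^ 2 := by linarith
        have h5 := abs_le_of_sq_le_sq' h4 hW0
        rcases le_total 0 w with hw | hw
        · exact Or.inr ⟨(sq_le_sq₀ hV0.le hw).1 h3, h5.2⟩
        · exact Or.inl ⟨h5.1, by nlinarith⟩
      · rintro (⟨h1, h2⟩ | ⟨h1, h2⟩) <;> constructor <;> nlinarith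
    have hb1 : ∀ w ∈ Icc (-W) (-V), a ^ 2 ≤ u ^ 2 + w ^ 2 ∧ u ^ 2 + w ^ 2 ≤ r ^ 2 :=
      fun w hw => hset.symm.subset (Or.inl hw)
    have hb2 : ∀ w ∈ Icc V W, a ^ 2 ≤ u ^ 2 + w ^ 2 ∧ u ^ 2 + w ^ 2 ≤ r ^ 2 :=
      fun w hw => hset.symm.subset (Or.inr hw)
    rw [hset, setIntegral_union ?_ measurableSet_Icc
      (integrableOn_of_bdd hDm measurableSet_Icc (by simp) fun w hw =>
        hM w (hb1 w hw).1 (hb1 w hw).2)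
      (integrableOn_of_bdd hDm measurableSet_Icc (by simp) fun w hw =>
        hM w (hb2 w hw).1 (hb2 w hw).2),
      integral_Icc_eq_integral_Ioc, integral_Icc_eq_integral_Ioc,
      ← intervalIntegral.integral_of_le (by linarith), ← intervalIntegral.integral_of_le hVW,
      ← hT u _ _ (by linarith) fun w hw => ⟨(hb1 w hw).1, (hb1 w hw).2.trans hrρ2⟩,
      ← hT u _ _ hVW fun w hw => ⟨(hb2 w hw).1, (hb2 w hw).2.trans hrρ2⟩,
      indicator_of_mem hua, chordJump, chordJump]
    · ring
    · rw [Set.disjoint_left]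
      rintro w ⟨_, h1⟩ ⟨h2, _⟩
      linarith
  · have hu2 : a ^ 2 ≤ u ^ 2 := by
      by_contra h
      exact hua (abs_lt.1 (abs_lt_of_sq_lt_sq (not_le.1 h) ha.le))
    have hset : {w | a ^ 2 ≤ u ^ 2 + w ^ 2 ∧ u ^ 2 + w ^ 2 ≤ r ^ 2} = Icc (-W) W := by
      ext w
      simp only [mem_ofPred_eq, mem_Icc]
      constructor
      · rintro ⟨h1, h2⟩
        exact abs_le_of_sq_le_sq' (by linarith) hW0
      · rintro ⟨h1, h2⟩
        constructor <;> nlinarith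
    have hb1 : ∀ w ∈ Icc (-W) W, a ^ 2 ≤ u ^ 2 + w ^ 2 ∧ u ^ 2 + w ^ 2 ≤ r ^ 2 :=
      fun w hw => hset.symm.subset hw
    rw [hset, integral_Icc_eq_integral_Ioc, ← intervalIntegral.integral_of_le (by linarith),
      ← hT u _ _ (by linarith) fun w hw => ⟨(hb1 w hw).1, (hb1 w hw).2.trans hrρ2⟩,
      indicator_of_notMem hua, chordJump]
    ring

/-- The divergence theorem: `∂_η (r ⟨sin φ, F⟩) = r ⟨D⟩` if `D` is the derivative of `F` along
characteristics. -/
theorem flux_sub_flux {ρ L η M : ℝ} (hL : 0 < ρ - L) (hη : η ∈ Icc 0 L) {F D : ℝ → ℝ → ℝ}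
    (hF : Measurable (Function.uncurry F)) (hFp : ∀ η, Function.Periodic (F η) (2 * π))
    (hFM : ∀ η ∈ Icc 0 L, ∀ φ, |F η φ| ≤ M)
    (hD : Measurable (Function.uncurry D)) (hDM : ∀ η ∈ Icc 0 L, ∀ φ, |D η φ| ≤ M)
    (hT : IsTransport (ρ - L) ρ (cart ρ F) (cart ρ D)) :
    ((ρ - η) * ∫ φ in (-π)..π, sin φ * F η φ) - (ρ - L) * ∫ φ in (-π)..π, sin φ * F L φ =
      -∫ y in η..L, (ρ - y) * ∫ φ in (-π)..π, D y φ := by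
  have hLη : ρ - L ≤ ρ - η := by linarith [hη.2]
  have hr : 0 < ρ - η := by linarith
  have hrρ : ρ - η ≤ ρ := by linarith [hη.1]
  have hr2 : (ρ - η) ^ 2 ≤ ρ ^ 2 := by gcongr
  rw [flux_eq_integral_chordJump hr hF hFp (hFM η hη),
    flux_eq_integral_chordJump hL hF hFp (hFM L ⟨hη.1.trans hη.2, le_rfl⟩)]
  set r := ρ - η with hrdef
  set a := ρ - L with hadef
  -- The integral of `D` over this annulus is computed twice: by Fubini over vertical lines it is
  -- the difference of the fluxes, and in polar coordinates it is the radial integral on the right.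
  set A : Set (ℝ × ℝ) := {z | a ^ 2 ≤ z.1 ^ 2 + z.2 ^ 2 ∧ z.1 ^ 2 + z.2 ^ 2 ≤ r ^ 2} with hA
  have hAm : MeasurableSet A := measurableSet_and_le
    (by fun_prop : Measurable fun z : ℝ × ℝ => z.1 ^ 2 + z.2 ^ 2) _ _
  have hAsub : A ⊆ Icc (-r) r ×ˢ Icc (-r) r := by
    rintro ⟨u, w⟩ ⟨_, h⟩
    simp only at h
    exact ⟨abs_le_of_sq_le_sq' (by nlinarith) hr.le, abs_le_of_sq_le_sq' (by nlinarith) hr.le⟩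
  have hAfin : volume A ≠ ⊤ := by
    refine ne_top_of_le_ne_top ?_ (measure_mono hAsub)
    exact (isCompact_Icc.prod isCompact_Icc).measure_ne_top
  have hDb : ∀ u w, a ^ 2 ≤ u ^ 2 + w ^ 2 → u ^ 2 + w ^ 2 ≤ r ^ 2 → |cart ρ D u w| ≤ M :=
    fun u w h1 h2 => abs_cart_le (by linarith) hDM h1 (h2.trans hr2)
  have hEint : Integrable (A.indicator (Function.uncurry (cart ρ D))) := by
    rw [integrable_indicator_iff hAm]
    exact integrableOn_of_bdd (measurable_cart ρ hD) hAm hAfin fun z hz => hDb _ _ hz.1 hz.2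
  have hpol := integral_comp_polarCoord_symm (A.indicator (Function.uncurry (cart ρ D)))
  -- Cartesian side
  have hcart : ∫ z, A.indicator (Function.uncurry (cart ρ D)) z =
      (∫ u in Ioo (-a) a, chordJump ρ F a u) - ∫ u in Ioo (-r) r, chordJump ρ F r u := by
    rw [Measure.volume_eq_prod, integral_prod _ hEint]
    have hin : ∀ u, ∫ w, A.indicator (Function.uncurry (cart ρ D)) (u, w) =
        ∫ w in {w | a ^ 2 ≤ u ^ 2 + w ^ 2 ∧ u ^ 2 + w ^ 2 ≤ r ^ 2}, cart ρ D u w := by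
      intro u
      rw [← integral_indicator]
      · rfl
      · exact measurableSet_and_le (by fun_prop : Measurable fun w : ℝ => u ^ 2 + w ^ 2) _ _
    simp_rw [hin]
    have hz : ∀ u, u ∉ Icc (-r) r → ∫ w in {w | a ^ 2 ≤ u ^ 2 + w ^ 2 ∧ u ^ 2 + w ^ 2 ≤ r ^ 2},
        cart ρ D u w = 0 := by
      intro u hu
      have : {w | a ^ 2 ≤ u ^ 2 + w ^ 2 ∧ u ^ 2 + w ^ 2 ≤ r ^ 2} = ∅ := by
        ext w
        simp only [mem_ofPred_eq, mem_empty_iff_false, iff_false]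
        rintro ⟨_, h⟩
        exact hu (abs_le_of_sq_le_sq' (by nlinarith) hr.le)
      rw [this, setIntegral_empty]
    rw [← setIntegral_eq_integral_of_forall_compl_eq_zero hz, integral_Icc_eq_integral_Ioo,
      setIntegral_congr_fun measurableSet_Ioo fun u hu =>
        integral_slice hL hLη hrρ hD (hDb u) hT hu]
    have hi : ∀ r', a ≤ r' → r' ≤ r → IntegrableOn (chordJump ρ F r') (Ioo (-r') r') := by
      intro r' h1 h2
      exact integrableOn_of_bdd (measurable_chordJump ρ hF r') measurableSet_Ioo (by simp)
        fun u hu => abs_chordJump_le hL h1 (by linarith) hFM hu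
    rw [integral_sub _ (hi r hLη le_rfl), setIntegral_indicator measurableSet_Ioo,
      inter_eq_self_of_subset_right (Ioo_subset_Ioo (by linarith) hLη)]
    exact ((integrable_indicator_iff measurableSet_Ioo).2 (hi a le_rfl hLη)).integrableOn
  -- polar side
  have hpolar : ∫ p in polarCoord.target, p.1 • A.indicator (Function.uncurry (cart ρ D))
      (polarCoord.symm p) = ∫ y in η..L, (ρ - y) * ∫ φ in (-π)..π, D y φ := by
    have h1 : ∀ p ∈ polarCoord.target, p.1 • A.indicator (Function.uncurry (cart ρ D))
        (polarCoord.symm p) = (Icc a r ×ˢ univ).indicator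
          (fun p : ℝ × ℝ => p.1 * D (ρ - p.1) p.2) p := by
      rintro ⟨s, φ⟩ hp
      rw [polarCoord_target] at hp
      have hs : 0 < s := hp.1
      have hφ : φ ∈ Ioo (-π) π := hp.2
      have hsum : (s * cos φ) ^ 2 + (s * sin φ) ^ 2 = s ^ 2 := by
        linear_combination s ^ 2 * Real.sin_sq_add_cos_sq φ
      have hmem : (polarCoord.symm (s, φ)) ∈ A ↔ ((s, φ) : ℝ × ℝ) ∈ Icc a r ×ˢ (univ : Set ℝ) := by
        simp only [polarCoord_symm_apply, hA, mem_ofPred_eq, hsum, mem_prod, mem_Icc, mem_univ,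
          and_true]
        rw [sq_le_sq₀ hL.le hs.le, sq_le_sq₀ hs.le hr.le]
      by_cases hm : ((s, φ) : ℝ × ℝ) ∈ Icc a r ×ˢ (univ : Set ℝ)
      · rw [indicator_of_mem hm, indicator_of_mem (hmem.2 hm)]
        have := cart_polar_of_mem (ρ := ρ) (η := ρ - s) (by rwa [sub_sub_cancel]) D
          (Ioo_subset_Ioc_self hφ)
        rw [sub_sub_cancel] at this
        simp only [polarCoord_symm_apply, Function.uncurry_apply_pair, this, smul_eq_mul]
      · rw [indicator_of_notMem hm, indicator_of_notMem (mt hmem.1 hm), smul_zero]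
    have hsub : (Icc a r ×ˢ (univ : Set ℝ)) ∩ polarCoord.target = Icc a r ×ˢ Ioo (-π) π := by
      ext ⟨s, φ⟩
      simp only [polarCoord_target, mem_inter_iff, mem_prod, mem_univ, and_true, mem_Ioi]
      constructor
      · rintro ⟨h1, h2, h3⟩; exact ⟨h1, h3⟩
      · rintro ⟨h1, h2⟩; exact ⟨h1, hL.trans_le h1.1, h2⟩
    rw [setIntegral_congr_fun polarCoord.open_target.measurableSet h1,
      setIntegral_indicator (measurableSet_Icc.prod MeasurableSet.univ), inter_comm, hsub,
      Measure.volume_eq_prod, setIntegral_prod, integral_Icc_eq_integral_Ioc,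
      ← intervalIntegral.integral_of_le hLη]
    · have h2 := intervalIntegral.integral_comp_sub_left (a := η) (b := L)
        (fun s => s * ∫ φ in (-π)..π, D (ρ - s) φ) ρ
      simp only [sub_sub_cancel] at h2
      rw [h2]
      refine intervalIntegral.integral_congr fun s _ => ?_
      simp only
      rw [integral_const_mul, intervalIntegral.integral_of_le (by linarith [pi_pos]),
        integral_Ioc_eq_integral_Ioo]
    · refine integrableOn_of_bdd (M := r * M) ?_ (measurableSet_Icc.prod measurableSet_Ioo) ?_ ?_
      · exact measurable_fst.mul (hD.comp
          ((measurable_const.sub measurable_fst).prodMk measurable_snd))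
      · rw [← Measure.volume_eq_prod]
        refine ne_top_of_le_ne_top ?_ (measure_mono (prod_mono subset_rfl Ioo_subset_Icc_self))
        exact (isCompact_Icc.prod isCompact_Icc).measure_ne_top
      · rintro ⟨s, φ⟩ ⟨hs, hφ⟩
        simp only [mem_Icc] at hs
        rw [abs_mul]
        have h3 := hDM (ρ - s) ⟨by linarith [hs.2], by linarith [hs.1]⟩ φ
        have h4 : |s| ≤ r := abs_le.2 ⟨by linarith [hs.1], hs.2⟩
        gcongr
  rw [← hpolar, hpol, hcart]
  ring

end

section

/-! ### The Duhamel formula -/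

/-- The annulus `a ≤ |z| ≤ b`. -/
def InAnnulus (a b u w : ℝ) : Prop := a ^ 2 ≤ u ^ 2 + w ^ 2 ∧ u ^ 2 + w ^ 2 ≤ b ^ 2

/-- The contribution of the source `G` on a vertical segment. -/
def seg (G : ℝ → ℝ → ℝ) (u w w₂ : ℝ) : ℝ := ∫ t in w..w₂, exp (-(t - w)) * G u t

/-- The solution of `-∂_w f + f = G` with value `h` on the upper half of the circle of radius
`b`. -/
def duhUp (b : ℝ) (h : ℝ → ℝ) (G : ℝ → ℝ → ℝ) (u w : ℝ) : ℝ :=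
  -- The point where the line enters through the upper outer half circle has angle `arccos (u / b)`.
  exp (-(√(b ^ 2 - u ^ 2) - w)) * h (arccos (u / b)) + seg G u w (√(b ^ 2 - u ^ 2))

open Classical in
/-- The solution of `-∂_w f + f = G` in the annulus with in-flow data `h` at `|z| = b` and specular
reflection at `|z| = a`. -/
def duh (a b : ℝ) (h : ℝ → ℝ) (G : ℝ → ℝ → ℝ) (u w : ℝ) : ℝ :=
  -- Within the annulus this selects the points in the shadow below the inner disk. The strict
  -- inequality lets tangent lines pass without reflection.
  if u ^ 2 < a ^ 2 ∧ w < 0 then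
    exp (-(-√(a ^ 2 - u ^ 2) - w)) * duhUp b h G u (√(a ^ 2 - u ^ 2)) +
      seg G u w (-√(a ^ 2 - u ^ 2))
  else duhUp b h G u w

/-- Going upward from (u, w), one either reaches the outer circle inside the annulus, or hits the
inner circle at height -V and continues from its mirror point at height V. All later statements on
`duh` split along this dichotomy. -/
theorem duh_cases {a b u w : ℝ} (ha : 0 < a) (hab : a ≤ b) (hz : InAnnulus a b u w) :
    (w ≤ √(b ^ 2 - u ^ 2) ∧ (∀ t ∈ Icc w (√(b ^ 2 - u ^ 2)), InAnnulus a b u t) ∧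
      (0 ≤ w ∨ a ^ 2 ≤ u ^ 2) ∧ ∀ h G, duh a b h G u w = duhUp b h G u w) ∨
    ∃ V, 0 < V ∧ V ≤ √(b ^ 2 - u ^ 2) ∧ w ≤ -V ∧ V ^ 2 = a ^ 2 - u ^ 2 ∧
      (∀ t ∈ Icc w (-V), InAnnulus a b u t) ∧
      (∀ t ∈ Icc V (√(b ^ 2 - u ^ 2)), InAnnulus a b u t) ∧
      ∀ h G, duh a b h G u w = exp (-(-V - w)) * duhUp b h G u V + seg G u w (-V) := by
  obtain ⟨h1, h2⟩ := hz
  have hab2 : a ^ 2 ≤ b ^ 2 := by gcongr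
  have hWs : √(b ^ 2 - u ^ 2) ^ 2 = b ^ 2 - u ^ 2 := Real.sq_sqrt (by nlinarith)
  have hW0 : 0 ≤ √(b ^ 2 - u ^ 2) := Real.sqrt_nonneg _
  set W := √(b ^ 2 - u ^ 2)
  have hw := abs_le_of_sq_le_sq' (show w ^ 2 ≤ W ^ 2 by linarith) hW0
  by_cases hc : u ^ 2 < a ^ 2 ∧ w < 0
  · right
    have hVs : √(a ^ 2 - u ^ 2) ^ 2 = a ^ 2 - u ^ 2 := Real.sq_sqrt (by linarith [hc.1])
    have hV0 : 0 < √(a ^ 2 - u ^ 2) := Real.sqrt_pos.2 (by linarith [hc.1])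
    refine ⟨√(a ^ 2 - u ^ 2), hV0, Real.sqrt_le_sqrt (by linarith), ?_, hVs, ?_, ?_, fun h G => ?_⟩
    · nlinarith [hc.2]
    · rintro t ⟨t1, t2⟩
      constructor <;> nlinarith
    · rintro t ⟨t1, t2⟩
      constructor <;> nlinarith
    · rw [duh, if_pos hc]
  · left
    have hor : 0 ≤ w ∨ a ^ 2 ≤ u ^ 2 := by
      by_contra h
      push Not at h
      exact hc ⟨h.2, h.1⟩
    refine ⟨hw.2, ?_, hor, fun h G => by rw [duh, if_neg hc]⟩
    rintro t ⟨t1, t2⟩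
    rcases hor with h | h
    · constructor <;> nlinarith
    · constructor <;> nlinarith

/-! #### Integrals over segments -/

theorem integral_exp_seg (w w₂ : ℝ) : ∫ t in w..w₂, exp (-(t - w)) = 1 - exp (-(w₂ - w)) := by
  have h : ∀ t ∈ uIcc w w₂, HasDerivAt (fun t => -exp (-(t - w))) (exp (-(t - w))) t := by
    intro t _
    refine ((((hasDerivAt_id t).sub_const w).neg).exp.neg).congr_deriv ?_
    simp
  rw [intervalIntegral.integral_eq_sub_of_hasDerivAt h
    ((by fun_prop : Continuous fun t => exp (-(t - w))).intervalIntegrable _ _)]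
  simp
  ring

theorem intervalIntegrable_exp_mul {g : ℝ → ℝ} {w w₂ : ℝ} (c : ℝ)
    (hg : IntervalIntegrable g volume w w₂) :
    IntervalIntegrable (fun t => exp (-(t - c)) * g t) volume w w₂ :=
  hg.continuousOn_mul (by fun_prop)

theorem seg_sub {G G' : ℝ → ℝ → ℝ} {u w w₂ : ℝ} (hG : IntervalIntegrable (G u) volume w w₂)
    (hG' : IntervalIntegrable (G' u) volume w w₂) :
    seg (fun u w => G u w - G' u w) u w w₂ = seg G u w w₂ - seg G' u w w₂ := by
  unfold seg
  rw [← intervalIntegral.integral_sub (intervalIntegrable_exp_mul w hG)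
    (intervalIntegrable_exp_mul w hG')]
  simp only [mul_sub]

theorem abs_seg_le {G g : ℝ → ℝ → ℝ} {u w w₂ : ℝ} (hw : w ≤ w₂)
    (hg : IntervalIntegrable (g u) volume w w₂)
    (h : ∀ t ∈ Icc w w₂, |G u t| ≤ g u t) : |seg G u w w₂| ≤ seg g u w w₂ := by
  unfold seg
  rw [← Real.norm_eq_abs]
  refine intervalIntegral.norm_integral_le_of_norm_le hw (ae_of_all _ fun t ht => ?_)
    (intervalIntegrable_exp_mul w hg)
  rw [norm_mul, Real.norm_of_nonneg (exp_pos _).le]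
  exact mul_le_mul_of_nonneg_left (h t (Ioc_subset_Icc_self ht)) (exp_pos _).le

theorem seg_const (M u w w₂ : ℝ) : seg (fun _ _ => M) u w w₂ = M * (1 - exp (-(w₂ - w))) := by
  unfold seg
  rw [intervalIntegral.integral_mul_const, integral_exp_seg, mul_comm]

theorem seg_add_seg {G : ℝ → ℝ → ℝ} {u w w₁ w₂ : ℝ} (h1 : w ≤ w₁) (h2 : w₁ ≤ w₂)
    (hG : IntervalIntegrable (G u) volume w w₂) :
    seg G u w w₁ + exp (-(w₁ - w)) * seg G u w₁ w₂ = seg G u w w₂ := by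
  unfold seg
  have hi := intervalIntegrable_exp_mul w hG
  have hi1 : IntervalIntegrable (fun t => exp (-(t - w)) * G u t) volume w w₁ :=
    hi.mono_set (by rw [uIcc_of_le h1, uIcc_of_le (h1.trans h2)]; exact Icc_subset_Icc_right h2)
  have hi2 : IntervalIntegrable (fun t => exp (-(t - w)) * G u t) volume w₁ w₂ :=
    hi.mono_set (by rw [uIcc_of_le h2, uIcc_of_le (h1.trans h2)]; exact Icc_subset_Icc_left h1)
  rw [← intervalIntegral.integral_add_adjacent_intervals hi1 hi2,
    ← intervalIntegral.integral_const_mul]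
  congr 1
  refine intervalIntegral.integral_congr fun t _ => ?_
  rw [← mul_assoc, ← exp_add]
  congr 2
  ring

/-- Duhamel's formula on a segment. -/
theorem eq_exp_mul_add_seg {F G : ℝ → ℝ → ℝ} {u w₁ w₂ : ℝ} (hw : w₁ ≤ w₂)
    (hF : IntervalIntegrable (F u) volume w₁ w₂) (hG : IntervalIntegrable (G u) volume w₁ w₂)
    (hT : ∀ w ∈ Icc w₁ w₂, F u w - F u w₂ = ∫ t in w..w₂, (G u t - F u t)) :
    F u w₁ = exp (-(w₂ - w₁)) * F u w₂ + seg G u w₁ w₂ := by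
  have hE : IntervalIntegrable (fun t => exp (-(t - w₁))) volume w₁ w₂ :=
    (by fun_prop : Continuous fun t => exp (-(t - w₁))).intervalIntegrable _ _
  -- The integrating factor exp(-(t - w₁)) turns the equation into an exact derivative.
  have h := mul_sub_mul_eq_integral_of_primitive (u := F u) (v := fun t => exp (-(t - w₁)))
    (V := fun t => exp (-(t - w₁))) hw (hG.sub hF) hE
    (fun x hx => by linarith [hT x hx]) fun x _ => by
      have h1 : ∀ t ∈ uIcc x w₂, HasDerivAt (fun t => -exp (-(t - w₁))) (exp (-(t - w₁))) t := by
        intro t _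
        refine ((((hasDerivAt_id t).sub_const w₁).neg).exp.neg).congr_deriv ?_
        simp
      rw [intervalIntegral.integral_eq_sub_of_hasDerivAt h1
        ((by fun_prop : Continuous fun t => exp (-(t - w₁))).intervalIntegrable _ _)]
      ring
  have h2 : seg G u w₁ w₂ = F u w₁ * exp (-(w₁ - w₁)) - F u w₂ * exp (-(w₂ - w₁)) := by
    rw [h, seg]
    refine intervalIntegral.integral_congr fun t _ => ?_
    ring
  rw [h2]
  simp
  ring

/-- The converse of Duhamel's formula on a segment. -/
theorem sub_eq_integral_of_eq_seg {F G : ℝ → ℝ → ℝ} {u w₁ w₂ : ℝ} (hw : w₁ ≤ w₂)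
    (hG : IntervalIntegrable (G u) volume w₁ w₂)
    (hF : ∀ w ∈ Icc w₁ w₂, F u w = exp (-(w₂ - w)) * F u w₂ + seg G u w w₂) :
    F u w₁ - F u w₂ = ∫ t in w₁..w₂, (G u t - F u t) := by
  -- The factor `exp w` is pulled out, so that the remaining integrand does not depend on the lower
  -- endpoint.
  have hseg : ∀ w, seg G u w w₂ = exp w * ∫ t in w..w₂, exp (-(t - 0)) * G u t := by
    intro w
    rw [seg, ← intervalIntegral.integral_const_mul]
    refine intervalIntegral.integral_congr fun t _ => ?_
    rw [← mul_assoc, ← exp_add]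
    congr 2
    ring
  have hF' : ∀ w ∈ Icc w₁ w₂, (exp (-w₂) * F u w₂ + ∫ t in w..w₂, exp (-(t - 0)) * G u t) *
      exp w = F u w := by
    intro w hwm
    rw [hF w hwm, hseg, show -(w₂ - w) = w + -w₂ by ring, exp_add]
    ring
  have hE : IntervalIntegrable (fun t => -exp t) volume w₁ w₂ :=
    (by fun_prop : Continuous fun t => -exp t).intervalIntegrable _ _
  have h := mul_sub_mul_eq_integral_of_primitive
    (u := fun w => exp (-w₂) * F u w₂ + ∫ t in w..w₂, exp (-(t - 0)) * G u t) (v := exp)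
    (V := fun t => -exp t) hw (intervalIntegrable_exp_mul 0 hG) hE
    (fun x hx => by simp) fun x _ => by
      rw [intervalIntegral.integral_neg, integral_exp]; ring
  rw [hF' w₁ ⟨le_rfl, hw⟩, hF' w₂ ⟨hw, le_rfl⟩] at h
  rw [h]
  refine intervalIntegral.integral_congr fun t ht => ?_
  rw [uIcc_of_le hw] at ht
  rw [mul_neg, hF' t ht, mul_comm (exp (-(t - 0))), mul_assoc, ← exp_add]
  simp
  ring

/-! #### Algebra and bounds of the Duhamel formula -/

variable {a b u w M : ℝ}

/-- Integrability of a source on the vertical segments in the annulus. -/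
def SegIntegrable (a b : ℝ) (G : ℝ → ℝ → ℝ) : Prop :=
  ∀ u w₁ w₂, w₁ ≤ w₂ → (∀ t ∈ Icc w₁ w₂, InAnnulus a b u t) →
    IntervalIntegrable (G u) volume w₁ w₂

theorem segIntegrable_of_bdd {G : ℝ → ℝ → ℝ} (hG : Measurable (Function.uncurry G))
    (hM : ∀ u w, InAnnulus a b u w → |G u w| ≤ M) : SegIntegrable a b G :=
  fun _ _ _ hw h => intervalIntegrable_of_bdd hG.of_uncurry_left hw fun t ht => hM _ t (h t ht)

theorem duh_sub (ha : 0 < a) (hab : a ≤ b) (hz : InAnnulus a b u w) {G G' : ℝ → ℝ → ℝ}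
    (hG : SegIntegrable a b G) (hG' : SegIntegrable a b G') (h h' : ℝ → ℝ) :
    duh a b (fun φ => h φ - h' φ) (fun u w => G u w - G' u w) u w =
      duh a b h G u w - duh a b h' G' u w := by
  rcases duh_cases ha hab hz with ⟨h1, h2, -, h3⟩ | ⟨V, h1, h2, h3, -, h4, h5, h6⟩
  · simp only [h3, duhUp, seg_sub (hG _ _ _ h1 h2) (hG' _ _ _ h1 h2)]
    ring
  · simp only [h6, duhUp, seg_sub (hG _ _ _ h3 h4) (hG' _ _ _ h3 h4),
      seg_sub (hG _ _ _ h2 h5) (hG' _ _ _ h2 h5)]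
    ring

theorem arccos_mem_inflow (hb : 0 < b) (hu : u ^ 2 < b ^ 2) : arccos (u / b) ∈ inflow := by
  have h := abs_lt_of_sq_lt_sq' hu hb.le
  have h1 : u / b < 1 := by rw [div_lt_one hb]; exact h.2
  have h2 : -1 < u / b := by rw [lt_div_iff₀ hb]; linarith [h.1]
  have h3 : 0 < arccos (u / b) := arccos_pos.2 h1
  have h4 : arccos (u / b) < π := by
    refine lt_of_le_of_ne (arccos_le_pi _) fun h => ?_
    rw [arccos_eq_pi] at h; linarith
  exact ⟨⟨by linarith [pi_pos], h4⟩, sin_pos_of_pos_of_lt_pi h3 h4⟩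

theorem abs_duhUp_le (hb : 0 < b) (hu : u ^ 2 < b ^ 2) {h : ℝ → ℝ} {G g : ℝ → ℝ → ℝ}
    {H : ℝ} (hH : ∀ φ ∈ inflow, |h φ| ≤ H) (hw : w ≤ √(b ^ 2 - u ^ 2))
    (hg : IntervalIntegrable (g u) volume w (√(b ^ 2 - u ^ 2)))
    (hGg : ∀ t ∈ Icc w (√(b ^ 2 - u ^ 2)), |G u t| ≤ g u t) :
    |duhUp b h G u w| ≤ duhUp b (fun _ => H) g u w := by
  unfold duhUp
  refine (abs_add_le _ _).trans (add_le_add ?_ (abs_seg_le hw hg hGg))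
  rw [abs_mul, abs_of_pos (exp_pos _)]
  exact mul_le_mul_of_nonneg_left (hH _ (arccos_mem_inflow hb hu)) (exp_pos _).le

theorem abs_duh_le (ha : 0 < a) (hab : a ≤ b) (hz : InAnnulus a b u w) (hu : u ^ 2 < b ^ 2)
    {h : ℝ → ℝ} {G g : ℝ → ℝ → ℝ} {H : ℝ} (hH : ∀ φ ∈ inflow, |h φ| ≤ H)
    (hg : SegIntegrable a b g) (hGg : ∀ u w, InAnnulus a b u w → |G u w| ≤ g u w) :
    |duh a b h G u w| ≤ duh a b (fun _ => H) g u w := by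
  rcases duh_cases ha hab hz with ⟨h1, h2, -, h3⟩ | ⟨V, h1, h2, h3, -, h4, h5, h6⟩
  · simp only [h3]
    exact abs_duhUp_le (ha.trans_le hab) hu hH h1 (hg _ _ _ h1 h2) fun t ht => hGg _ _ (h2 t ht)
  · simp only [h6]
    refine (abs_add_le _ _).trans (add_le_add ?_ (abs_seg_le h3 (hg _ _ _ h3 h4)
      fun t ht => hGg _ _ (h4 t ht)))
    rw [abs_mul, abs_of_pos (exp_pos _)]
    exact mul_le_mul_of_nonneg_left (abs_duhUp_le (ha.trans_le hab) hu hH h2 (hg _ _ _ h2 h5)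
      fun t ht => hGg _ _ (h5 t ht)) (exp_pos _).le

/-- A constant source collects M (1 - exp(-ℓ)) over a path of length ℓ. Two legs joined by
reflection combine into one path, and ℓ ≤ 2b always. This is the origin of the contraction factor.
-/
theorem duh_const_le (ha : 0 < a) (hab : a ≤ b) (hz : InAnnulus a b u w) (hM : 0 ≤ M) :
    duh a b (fun _ => 0) (fun _ _ => M) u w ≤ M * (1 - exp (-(2 * b))) := by
  have hb : 0 < b := ha.trans_le hab
  have hw : -b ≤ w := by
    have : w ^ 2 ≤ b ^ 2 := by nlinarith [hz.2]
    exact (abs_le_of_sq_le_sq' this hb.le).1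
  have hW : √(b ^ 2 - u ^ 2) ≤ b := by
    rw [Real.sqrt_le_left hb.le]; nlinarith
  have key : ∀ c : ℝ, c ≤ 2 * b → M * (1 - exp (-c)) ≤ M * (1 - exp (-(2 * b))) := by
    intro c hc
    gcongr
  rcases duh_cases ha hab hz with ⟨h1, h2, -, h3⟩ | ⟨V, h1, h2, h3, -, h4, h5, h6⟩
  · rw [h3, duhUp, seg_const, mul_zero, zero_add]
    exact key _ (by linarith)
  · rw [h6, duhUp, seg_const, seg_const, mul_zero, zero_add]
    have : exp (-(-V - w)) * (M * (1 - exp (-(√(b ^ 2 - u ^ 2) - V)))) +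
        M * (1 - exp (-(-V - w))) = M * (1 - exp (-((-V - w) + (√(b ^ 2 - u ^ 2) - V)))) := by
      rw [neg_add, exp_add]; ring
    rw [this]
    exact key _ (by linarith)

theorem duh_inflow_le {H : ℝ} (ha : 0 < a) (hab : a ≤ b) (hz : InAnnulus a b u w)
    (hH : 0 ≤ H) (g : ℝ → ℝ → ℝ) :
    duh a b (fun _ => H) g u w ≤ H + duh a b (fun _ => 0) g u w := by
  have key : ∀ c : ℝ, 0 ≤ c → exp (-c) * H ≤ H := fun c hc =>
    mul_le_of_le_one_left hH (exp_le_one_iff.2 (by linarith))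
  rcases duh_cases ha hab hz with ⟨h1, h2, -, h3⟩ | ⟨V, h1, h2, h3, -, h4, h5, h6⟩
  · rw [h3, h3, duhUp, duhUp]
    linarith [key _ (sub_nonneg.2 h1)]
  · rw [h6, h6, duhUp, duhUp]
    have h7 := key _ (sub_nonneg.2 h2)
    have h8 := mul_le_mul_of_nonneg_left h7 (exp_pos (-(-V - w))).le
    have h9 := key _ (sub_nonneg.2 h3)
    nlinarith

/-! #### The Duhamel formula solves the transport equation -/

/-- The semigroup property of Duhamel's formula: stopping at an intermediate point of the same
segment changes nothing. -/
theorem duh_seg_add (ha : 0 < a) (hab : a ≤ b) {h : ℝ → ℝ} {G : ℝ → ℝ → ℝ}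
    (hG : SegIntegrable a b G) {u w₁ w₂ : ℝ} (hw : w₁ ≤ w₂)
    (hann : ∀ t ∈ Icc w₁ w₂, InAnnulus a b u t) :
    duh a b h G u w₁ = exp (-(w₂ - w₁)) * duh a b h G u w₂ + seg G u w₁ w₂ := by
  have hz1 := hann w₁ ⟨le_rfl, hw⟩
  have hz2 := hann w₂ ⟨hw, le_rfl⟩
  by_cases hc : u ^ 2 < a ^ 2 ∧ w₁ < 0
  · -- the whole segment lies below the inner disk
    have h2 : w₂ < 0 := by
      -- Otherwise the segment would pass through (u, 0), which lies in the open inner disk.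
      by_contra h
      have h0 := (hann 0 ⟨hc.2.le, not_lt.1 h⟩).1
      nlinarith [hc.1]
    rcases duh_cases ha hab hz1 with ⟨-, -, h3, -⟩ | ⟨V, g1, g2, g3, gV, g4, g5, g6⟩
    · rcases h3 with h3 | h3 <;> linarith [hc.1, hc.2]
    · have hV : V = √(a ^ 2 - u ^ 2) := by rw [← gV, Real.sqrt_sq g1.le]
      have hle : w₂ ≤ -V := by nlinarith [hz2.1]
      rw [g6, duh, if_pos ⟨hc.1, h2⟩, ← hV, ← seg_add_seg hw hle (hG _ _ _ g3 g4)]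
      rw [show -(-V - w₁) = -(w₂ - w₁) + -(-V - w₂) by ring, exp_add]
      ring
  · rcases duh_cases ha hab hz1 with ⟨h1, h2, h3, h4⟩ | ⟨V, g1, g2, g3, gV, g4, g5, g6⟩
    · have hc2 : ¬ (u ^ 2 < a ^ 2 ∧ w₂ < 0) := fun h => hc ⟨h.1, by linarith [h.2]⟩
      have hle : w₂ ≤ √(b ^ 2 - u ^ 2) := Real.le_sqrt_of_sq_le (by linarith [hz2.2])
      rw [h4, duh, if_neg hc2, duhUp, duhUp, ← seg_add_seg hw hle (hG _ _ _ h1 h2),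
        show -(√(b ^ 2 - u ^ 2) - w₁) = -(w₂ - w₁) + -(√(b ^ 2 - u ^ 2) - w₂) by ring, exp_add]
      ring
    · exact absurd ⟨by nlinarith, by linarith⟩ hc

theorem isTransport_duh (ha : 0 < a) (hab : a ≤ b) {h : ℝ → ℝ} {G : ℝ → ℝ → ℝ}
    (hG : SegIntegrable a b G) :
    IsTransport a b (duh a b h G) fun u w => G u w - duh a b h G u w := by
  intro u w₁ w₂ hw hann
  exact sub_eq_integral_of_eq_seg hw (hG _ _ _ hw hann) fun w hwm =>
    duh_seg_add ha hab hG hwm.2 fun t ht => hann t ⟨hwm.1.trans ht.1, ht.2⟩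

/-- A function that solves the transport equation and satisfies the boundary conditions is given by
the Duhamel formula. -/
theorem eq_duh_of_isTransport (ha : 0 < a) (hab : a ≤ b) {h : ℝ → ℝ} {F G : ℝ → ℝ → ℝ}
    (hF : SegIntegrable a b F) (hG : SegIntegrable a b G)
    (hT : IsTransport a b F fun u w => G u w - F u w)
    (hin : ∀ u, u ^ 2 < b ^ 2 → F u (√(b ^ 2 - u ^ 2)) = h (arccos (u / b)))
    (hspec : ∀ u w, u ^ 2 + w ^ 2 = a ^ 2 → F u w = F u (-w))
    (hz : InAnnulus a b u w) (hu : u ^ 2 < b ^ 2) : F u w = duh a b h G u w := by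
  have key : ∀ w₁ w₂, w₁ ≤ w₂ → (∀ t ∈ Icc w₁ w₂, InAnnulus a b u t) →
      F u w₁ = exp (-(w₂ - w₁)) * F u w₂ + seg G u w₁ w₂ := fun w₁ w₂ hw hann =>
    eq_exp_mul_add_seg hw (hF _ _ _ hw hann) (hG _ _ _ hw hann) fun w hwm =>
      hT u w w₂ hwm.2 fun t ht => hann t ⟨hwm.1.trans ht.1, ht.2⟩
  rcases duh_cases ha hab hz with ⟨h1, h2, -, h3⟩ | ⟨V, h1, h2, h3, hV, h4, h5, h6⟩
  · rw [h3, duhUp, ← hin u hu]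
    exact key _ _ h1 h2
  · rw [h6, duhUp, ← hin u hu, ← key _ _ h2 h5, hspec u V (by linarith)]
    exact key _ _ h3 h4

/-! #### Measurability -/

theorem measurable_intervalIntegral {α : Type*} [MeasurableSpace α] {Φ : α → ℝ → ℝ}
    (hΦ : Measurable (Function.uncurry Φ)) {lo hi : α → ℝ} (hlo : Measurable lo)
    (hhi : Measurable hi) : Measurable fun z => ∫ t in lo z..hi z, Φ z t := by
  have key : ∀ {lo hi : α → ℝ}, Measurable lo → Measurable hi →
      Measurable fun z => ∫ t in Ioc (lo z) (hi z), Φ z t := by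
    intro lo hi hlo hhi
    have hS : MeasurableSet {p : α × ℝ | lo p.1 < p.2 ∧ p.2 ≤ hi p.1} :=
      (measurableSet_lt (hlo.comp measurable_fst) measurable_snd).inter
        (measurableSet_le measurable_snd (hhi.comp measurable_fst))
    have h := (hΦ.indicator hS).stronglyMeasurable.integral_prod_right' (ν := volume)
    have h2 : (fun z => ∫ t in Ioc (lo z) (hi z), Φ z t) = fun z => ∫ t,
        {p : α × ℝ | lo p.1 < p.2 ∧ p.2 ≤ hi p.1}.indicator (Function.uncurry Φ) (z, t) := by
      ext z
      rw [← integral_indicator measurableSet_Ioc]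
      rfl
    rw [h2]
    exact h.measurable
  exact (key hlo hhi).sub (key hhi hlo)

theorem measurable_seg {G : ℝ → ℝ → ℝ} (hG : Measurable (Function.uncurry G))
    {α : Type*} [MeasurableSpace α] {x lo hi : α → ℝ} (hx : Measurable x) (hlo : Measurable lo)
    (hhi : Measurable hi) : Measurable fun z => seg G (x z) (lo z) (hi z) := by
  unfold seg
  refine measurable_intervalIntegral ?_ hlo hhi
  refine Measurable.mul ?_ (hG.comp ((hx.comp measurable_fst).prodMk measurable_snd))
  exact (measurable_snd.sub (hlo.comp measurable_fst)).neg.exp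

theorem measurable_duh (a b : ℝ) {h : ℝ → ℝ} (hh : Measurable h) {G : ℝ → ℝ → ℝ}
    (hG : Measurable (Function.uncurry G)) : Measurable (Function.uncurry (duh a b h G)) := by
  have hup : ∀ {x y : ℝ × ℝ → ℝ}, Measurable x → Measurable y →
      Measurable fun z => duhUp b h G (x z) (y z) := by
    intro x y hx hy
    unfold duhUp
    refine Measurable.add (Measurable.mul (by fun_prop) ?_) (measurable_seg hG hx hy (by fun_prop))
    exact hh.comp (measurable_arccos.comp (hx.div_const b))
  have hS : MeasurableSet {z : ℝ × ℝ | z.1 ^ 2 < a ^ 2 ∧ z.2 < 0} :=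
    (measurableSet_lt (by fun_prop : Measurable fun z : ℝ × ℝ => z.1 ^ 2) measurable_const).inter
      (measurableSet_lt measurable_snd measurable_const)
  refine Measurable.ite hS ?_ (hup measurable_fst measurable_snd)
  exact Measurable.add (Measurable.mul (by fun_prop) (hup measurable_fst (by fun_prop)))
    (measurable_seg hG measurable_fst measurable_snd (by fun_prop))

end

section

/-! ### Velocity averages -/

/-- Velocity averages do not see the grazing set, so bounds off that set suffice for them. -/
theorem ae_sin_ne_zero : ∀ᵐ φ : ℝ, sin φ ≠ 0 := by
  have h : {φ : ℝ | sin φ = 0} = range fun n : ℤ => (n : ℝ) * π := by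
    ext φ; simp [Real.sin_eq_zero_iff]
  have h2 : volume {φ : ℝ | sin φ = 0} = 0 := by
    rw [h]; exact (countable_range _).measure_zero _
  rw [ae_iff]
  simpa using h2

theorem measurable_avg {f : ℝ → ℝ → ℝ} (hf : Measurable (Function.uncurry f)) :
    Measurable (avg f) :=
  (measurable_intervalIntegral hf measurable_const measurable_const).const_mul _

theorem abs_avg_le {f : ℝ → ℝ → ℝ} {η M : ℝ} (h : ∀ φ, sin φ ≠ 0 → |f η φ| ≤ M) :
    |avg f η| ≤ M := by
  have h1 : ‖∫ φ in (-π)..π, f η φ‖ ≤ M * |π - -π| := by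
    refine intervalIntegral.norm_integral_le_of_norm_le_const_ae ?_
    filter_upwards [ae_sin_ne_zero] with φ hφ _ using h φ hφ
  rw [sub_neg_eq_add, ← two_mul, abs_of_pos two_pi_pos] at h1
  unfold avg
  rw [abs_mul, abs_of_pos (one_div_pos.2 two_pi_pos), ← Real.norm_eq_abs (∫ φ in (-π)..π, f η φ),
    one_div_mul_eq_div, div_le_iff₀ two_pi_pos]
  exact h1

theorem avg_sub {f g : ℝ → ℝ → ℝ} {η : ℝ} (hf : IntervalIntegrable (f η) volume (-π) π)
    (hg : IntervalIntegrable (g η) volume (-π) π) :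
    avg (fun η φ => f η φ - g η φ) η = avg f η - avg g η := by
  unfold avg
  rw [intervalIntegral.integral_sub hf hg]
  ring

/-! ### Uniqueness -/

variable {R ε L : ℝ} {h : ℝ → ℝ} {S : ℝ → ℝ → ℝ}

theorem inAnnulus_polar {ρ η : ℝ} (hL : 0 < ρ - L) (hη : η ∈ Icc 0 L) (φ : ℝ) :
    InAnnulus (ρ - L) ρ ((ρ - η) * cos φ) ((ρ - η) * sin φ) := by
  have h1 : ((ρ - η) * cos φ) ^ 2 + ((ρ - η) * sin φ) ^ 2 = (ρ - η) ^ 2 := by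
    linear_combination (ρ - η) ^ 2 * Real.sin_sq_add_cos_sq φ
  have h2 : 0 ≤ ρ - η := by linarith [hη.2]
  unfold InAnnulus
  rw [h1]
  constructor
  · have := hη.2
    gcongr
  · have := hη.1
    gcongr
    linarith

/-- Only the two points (±ρ, 0) of the annulus have |u| = ρ, and they correspond to the grazing set.
-/
theorem sq_lt_of_not_isGrazing {ρ η φ : ℝ} (hL : 0 < ρ - L) (hη : η ∈ Icc 0 L)
    (hg : ¬ IsGrazing η φ) : ((ρ - η) * cos φ) ^ 2 < ρ ^ 2 := by
  have h0 := Real.sin_sq_add_cos_sq φ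
  rcases hη.1.eq_or_lt with h | h
  · have hs : sin φ ≠ 0 := fun hs => hg ⟨h.symm, hs⟩
    have h1 : 0 < sin φ ^ 2 := by positivity
    have h2 : 0 < ρ ^ 2 := by
      have : 0 < ρ := by linarith [hη.2]
      positivity
    rw [← h]
    nlinarith
  · have h1 : (ρ - η) ^ 2 < ρ ^ 2 := by nlinarith [hη.2]
    have h2 : 0 ≤ (ρ - η) ^ 2 * sin φ ^ 2 := by positivity
    nlinarith

/-- The source of the transport equation if the velocity average is `q`. -/
def totalSource (ρ : ℝ) (q : ℝ → ℝ) (S : ℝ → ℝ → ℝ) : ℝ → ℝ → ℝ :=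
  cart ρ fun η φ => q η + S η φ

theorem measurable_totalSource (ρ : ℝ) {q : ℝ → ℝ} (hq : Measurable q)
    (hS : Measurable (Function.uncurry S)) :
    Measurable (Function.uncurry (totalSource ρ q S)) :=
  measurable_cart ρ ((hq.comp measurable_fst).add hS)

theorem abs_cart_le_of_inAnnulus {ρ M u w : ℝ} (hρ : 0 < ρ) {F : ℝ → ℝ → ℝ}
    (hM : ∀ η ∈ Icc 0 L, ∀ φ, |F η φ| ≤ M) (hz : InAnnulus (ρ - L) ρ u w) : |cart ρ F u w| ≤ M :=
  abs_cart_le hρ hM hz.1 hz.2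

theorem segIntegrable_cart {ρ : ℝ} (hρ : 0 < ρ) {F : ℝ → ℝ → ℝ}
    (hF : Measurable (Function.uncurry F)) (hM : ∃ M, ∀ η ∈ Icc 0 L, ∀ φ, |F η φ| ≤ M) :
    SegIntegrable (ρ - L) ρ (cart ρ F) := by
  obtain ⟨M, hM⟩ := hM
  exact segIntegrable_of_bdd (measurable_cart ρ hF) fun u w hz => abs_cart_le_of_inAnnulus hρ hM hz

theorem bounded_add {q : ℝ → ℝ} (hq : ∃ M, ∀ η ∈ Icc 0 L, |q η| ≤ M)
    (hS : ∃ M, ∀ η ∈ Icc 0 L, ∀ φ, |S η φ| ≤ M) :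
    ∃ M, ∀ η ∈ Icc 0 L, ∀ φ, |q η + S η φ| ≤ M := by
  obtain ⟨M, hM⟩ := hq
  obtain ⟨N, hN⟩ := hS
  exact ⟨M + N, fun η hη φ => (abs_add_le _ _).trans (add_le_add (hM η hη) (hN η hη φ))⟩

theorem segIntegrable_totalSource {ρ : ℝ} (hρ : 0 < ρ) {q : ℝ → ℝ} (hq : Measurable q)
    (hqM : ∃ M, ∀ η ∈ Icc 0 L, |q η| ≤ M) (hS : Measurable (Function.uncurry S))
    (hSM : ∃ M, ∀ η ∈ Icc 0 L, ∀ φ, |S η φ| ≤ M) :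
    SegIntegrable (ρ - L) ρ (totalSource ρ q S) :=
  segIntegrable_cart hρ (F := fun η φ => q η + S η φ) ((hq.comp measurable_fst).add hS)
    (bounded_add hqM hSM)

theorem IsSolution.avg_bounded {f : ℝ → ℝ → ℝ} (hf : IsSolution R ε L h S f) :
    ∃ M, ∀ η ∈ Icc 0 L, |avg f η| ≤ M := by
  obtain ⟨M, hM⟩ := hf.bounded
  exact ⟨M, fun η hη => abs_avg_le fun φ _ => hM η hη φ⟩

/-- Solutions are given by the Duhamel formula. -/
theorem IsSolution.eq_duh (hε : 0 < ε) (hL0 : 0 < L) (hL : 0 < R / ε - L) {f : ℝ → ℝ → ℝ}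
    (hS : Measurable (Function.uncurry S)) (hSp : ∀ η, Function.Periodic (S η) (2 * π))
    (hSM : ∃ M, ∀ η ∈ Icc 0 L, ∀ φ, |S η φ| ≤ M) (hf : IsSolution R ε L h S f)
    {η φ : ℝ} (hη : η ∈ Icc 0 L) (hg : ¬ IsGrazing η φ) :
    f η φ = duh (R / ε - L) (R / ε) h (totalSource (R / ε) (avg f) S)
      ((R / ε - η) * cos φ) ((R / ε - η) * sin φ) := by
  set ρ := R / ε with hρdef
  have hρ : 0 < ρ := by linarith
  have hrη : 0 < ρ - η := by linarith [hη.2]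
  rw [← cart_polar hrη (hf.periodic η) φ]
  refine eq_duh_of_isTransport hL (by linarith) (segIntegrable_cart hρ hf.measurable hf.bounded)
    (segIntegrable_totalSource hρ (measurable_avg hf.measurable) hf.avg_bounded hS hSM) ?_ ?_ ?_
    (inAnnulus_polar hL hη φ) (sq_lt_of_not_isGrazing hL hη hg)
  · have := hf.isTransport hε hL hρ hSp
    convert this using 1
    ext u w
    simp only [totalSource, cart]
    ring
  · intro u hu
    have hm := arccos_mem_inflow hρ hu
    rw [← hf.inflow_bc _ hm, ← cart_polar (ρ := ρ) (η := 0) (by simpa using hρ) (hf.periodic 0)]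
    have h1 := abs_lt_of_sq_lt_sq' hu hρ.le
    have h2 : u / ρ ≤ 1 := by rw [div_le_one hρ]; exact h1.2.le
    have h3 : -1 ≤ u / ρ := by rw [le_div_iff₀ hρ]; linarith [h1.1]
    rw [sub_zero, cos_arccos h3 h2, sin_arccos]
    congr 1
    · field_simp
    · rw [show ρ ^ 2 - u ^ 2 = ρ ^ 2 * (1 - (u / ρ) ^ 2) by field_simp,
        Real.sqrt_mul (sq_nonneg _), Real.sqrt_sq hρ.le]
  · intro u w huw
    have hp : 0 < u ^ 2 + w ^ 2 := by rw [huw]; positivity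
    unfold cart
    rw [neg_sq, huw, Real.sqrt_sq hL.le, sub_sub_cancel, hf.specular_bc]
    exact periodic_eq_of_cos_sin (hf.periodic L) (arg_conj_cos_sin hp).1 (arg_conj_cos_sin hp).2

/-- Two Duhamel formulas with the same in-flow data. -/
theorem abs_duh_sub_le {a b u w K : ℝ} (ha : 0 < a) (hab : a ≤ b) (hz : InAnnulus a b u w)
    (hu : u ^ 2 < b ^ 2) (hK : 0 ≤ K) {G G' : ℝ → ℝ → ℝ} (hG : SegIntegrable a b G)
    (hG' : SegIntegrable a b G') (h : ℝ → ℝ)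
    (hGG' : ∀ u w, InAnnulus a b u w → |G u w - G' u w| ≤ K) :
    |duh a b h G u w - duh a b h G' u w| ≤ K * (1 - exp (-(2 * b))) := by
  rw [← duh_sub ha hab hz hG hG' h h]
  refine (abs_duh_le (g := fun _ _ => K) ha hab hz hu (H := 0) (by simp) ?_ hGG').trans
    (duh_const_le ha hab hz hK)
  exact fun _ _ _ _ _ => intervalIntegrable_const

theorem contraction_lt {b : ℝ} : 1 - exp (-(2 * b)) < 1 := by
  linarith [exp_pos (-(2 * b))]

theorem contraction_nonneg {b : ℝ} (hb : 0 < b) : 0 ≤ 1 - exp (-(2 * b)) := by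
  have : exp (-(2 * b)) ≤ 1 := exp_le_one_iff.2 (by linarith)
  linarith

theorem not_isGrazing_of_sin {η φ : ℝ} (h : sin φ ≠ 0) : ¬ IsGrazing η φ := fun hg => h hg.2

/-- Solutions are unique off the grazing set. -/
theorem IsSolution.unique (hε : 0 < ε) (hL0 : 0 < L) (hL : 0 < R / ε - L) {f g : ℝ → ℝ → ℝ}
    (hS : Measurable (Function.uncurry S)) (hSp : ∀ η, Function.Periodic (S η) (2 * π))
    (hSM : ∃ M, ∀ η ∈ Icc 0 L, ∀ φ, |S η φ| ≤ M) (hf : IsSolution R ε L h S f)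
    (hg : IsSolution R ε L h S g) {η φ : ℝ} (hη : η ∈ Icc 0 L) (hgr : ¬ IsGrazing η φ) :
    g η φ = f η φ := by
  have hρ : 0 < R / ε := by linarith
  set c := 1 - exp (-(2 * (R / ε))) with hc
  have hc0 : 0 ≤ c := contraction_nonneg hρ
  obtain ⟨M, hM⟩ := hf.avg_bounded
  obtain ⟨N, hN⟩ := hg.avg_bounded
  have hL' : (0 : ℝ) ∈ Icc 0 L := ⟨le_rfl, hL0.le⟩
  have hM0 : 0 ≤ M := (abs_nonneg _).trans (hM 0 hL')
  have hN0 : 0 ≤ N := (abs_nonneg _).trans (hN 0 hL')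
  -- The two solutions share their in-flow data and `S`, so their difference is a Duhamel integral
  -- of the difference of the averages alone.
  have step : ∀ K, 0 ≤ K → (∀ η ∈ Icc 0 L, |avg g η - avg f η| ≤ K) →
      ∀ η ∈ Icc 0 L, ∀ φ, ¬ IsGrazing η φ → |g η φ - f η φ| ≤ K * c := by
    intro K hK h1 η hη φ hgr
    rw [hf.eq_duh hε hL0 hL hS hSp hSM hη hgr, hg.eq_duh hε hL0 hL hS hSp hSM hη hgr]
    refine abs_duh_sub_le hL (by linarith) (inAnnulus_polar hL hη φ)
      (sq_lt_of_not_isGrazing hL hη hgr) hK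
      (segIntegrable_totalSource hρ (measurable_avg hg.measurable) hg.avg_bounded hS hSM)
      (segIntegrable_totalSource hρ (measurable_avg hf.measurable) hf.avg_bounded hS hSM) h
      fun u w hz => ?_
    have := abs_cart_le_of_inAnnulus hρ (F := fun η _ => avg g η - avg f η)
      (fun η hη _ => h1 η hη) hz
    convert this using 2
    simp only [totalSource, cart]
    ring
  have hint : ∀ {f : ℝ → ℝ → ℝ}, IsSolution R ε L h S f → ∀ η ∈ Icc 0 L,
      IntervalIntegrable (f η) volume (-π) π := by
    intro f hf η hη
    obtain ⟨M, hM⟩ := hf.bounded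
    exact intervalIntegrable_of_bdd hf.measurable.of_uncurry_left (by linarith [pi_pos])
      fun φ _ => hM η hη φ
  have hn : ∀ n : ℕ, ∀ η ∈ Icc 0 L, |avg g η - avg f η| ≤ (N + M) * c ^ n := by
    intro n
    induction n with
    | zero =>
      intro η hη
      rw [pow_zero, mul_one]
      exact (abs_sub _ _).trans (add_le_add (hN η hη) (hM η hη))
    | succ n ih =>
      intro η hη
      rw [← avg_sub (hint hg η hη) (hint hf η hη), pow_succ, ← mul_assoc]
      exact abs_avg_le fun φ hφ => step _ (by positivity) ih η hη φ (not_isGrazing_of_sin hφ)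
  have hz : ∀ η ∈ Icc 0 L, |avg g η - avg f η| ≤ 0 := by
    intro η hη
    have hlim : Filter.Tendsto (fun n : ℕ => (N + M) * c ^ n) Filter.atTop (nhds ((N + M) * 0)) :=
      (tendsto_pow_atTop_nhds_zero_of_lt_one hc0 contraction_lt).const_mul _
    rw [mul_zero] at hlim
    exact ge_of_tendsto' hlim fun n => hn n η hη
  have := step 0 le_rfl hz η hη φ hgr
  rw [zero_mul, abs_nonpos_iff] at this
  linarith

/-! ### Existence -/

open Classical in
/-- The phase space function with velocity average replaced by `q` in the transport equation,
extended by zero to the grazing set. -/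
def transportSol (ρ L : ℝ) (h : ℝ → ℝ) (S : ℝ → ℝ → ℝ) (q : ℝ → ℝ) (η φ : ℝ) : ℝ :=
  if η ∈ Icc 0 L ∧ ¬ IsGrazing η φ then
    duh (ρ - L) ρ h (totalSource ρ q S) ((ρ - η) * cos φ) ((ρ - η) * sin φ)
  else 0

theorem transportSol_of_mem {ρ : ℝ} {q : ℝ → ℝ} {η φ : ℝ} (hη : η ∈ Icc 0 L)
    (hg : ¬ IsGrazing η φ) : transportSol ρ L h S q η φ =
      duh (ρ - L) ρ h (totalSource ρ q S) ((ρ - η) * cos φ) ((ρ - η) * sin φ) :=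
  if_pos ⟨hη, hg⟩

theorem measurable_transportSol (ρ : ℝ) (hh : Measurable h) (hS : Measurable (Function.uncurry S))
    {q : ℝ → ℝ} (hq : Measurable q) :
    Measurable (Function.uncurry (transportSol ρ L h S q)) := by
  have h1 : MeasurableSet {z : ℝ × ℝ | z.1 ∈ Icc 0 L ∧ ¬ IsGrazing z.1 z.2} := by
    have h2 : MeasurableSet ({z : ℝ × ℝ | z.1 = 0} ∩ {z : ℝ × ℝ | sin z.2 = 0}) :=
      (measurableSet_eq_fun measurable_fst measurable_const).inter
        (measurableSet_eq_fun (measurable_sin.comp measurable_snd) measurable_const)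
    exact (measurable_fst measurableSet_Icc).inter h2.compl
  refine Measurable.ite h1 ?_ measurable_const
  exact (measurable_duh (ρ - L) ρ hh (measurable_totalSource ρ hq hS)).comp
    (Measurable.prodMk (by fun_prop) (by fun_prop))

theorem periodic_transportSol (ρ : ℝ) (q : ℝ → ℝ) (η : ℝ) :
    Function.Periodic (transportSol ρ L h S q η) (2 * π) := by
  intro φ
  simp only [transportSol, IsGrazing, cos_add_two_pi, sin_add_two_pi]
  congr

theorem duh_le_add {a b u w H B : ℝ} (ha : 0 < a) (hab : a ≤ b) (hz : InAnnulus a b u w)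
    (hH : 0 ≤ H) (hB : 0 ≤ B) : duh a b (fun _ => H) (fun _ _ => B) u w ≤ H + B := by
  refine (duh_inflow_le ha hab hz hH _).trans ?_
  have h1 := duh_const_le ha hab hz hB
  have h2 : B * (1 - exp (-(2 * b))) ≤ B := mul_le_of_le_one_right hB contraction_lt.le
  linarith

theorem abs_transportSol_le {ρ H B : ℝ} (hL : 0 < ρ - L) (hL0 : 0 < L) (hH0 : 0 ≤ H)
    (hB0 : 0 ≤ B) (hH : ∀ φ ∈ inflow, |h φ| ≤ H) {q : ℝ → ℝ}
    (hB : ∀ η ∈ Icc 0 L, ∀ φ, |q η + S η φ| ≤ B) (η φ : ℝ) :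
    |transportSol ρ L h S q η φ| ≤ H + B := by
  by_cases hc : η ∈ Icc 0 L ∧ ¬ IsGrazing η φ
  · rw [transportSol_of_mem hc.1 hc.2]
    have hz := inAnnulus_polar hL hc.1 φ
    refine (abs_duh_le (g := fun _ _ => B) hL (by linarith) hz
      (sq_lt_of_not_isGrazing hL hc.1 hc.2) hH (fun _ _ _ _ _ => intervalIntegrable_const)
      fun u w hz => abs_cart_le_of_inAnnulus (by linarith) hB hz).trans
      (duh_le_add hL (by linarith) hz hH0 hB0)
  · rw [transportSol, if_neg hc, abs_zero]
    positivity

/-- The contraction estimate: the data cancel and only the source q - q' remains. -/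
theorem abs_transportSol_sub_le {ρ K : ℝ} (hL : 0 < ρ - L) (hL0 : 0 < L) (hK : 0 ≤ K)
    (hS : Measurable (Function.uncurry S)) (hSM : ∃ M, ∀ η ∈ Icc 0 L, ∀ φ, |S η φ| ≤ M)
    {q q' : ℝ → ℝ} (hq : Measurable q) (hqM : ∃ M, ∀ η ∈ Icc 0 L, |q η| ≤ M)
    (hq' : Measurable q') (hqM' : ∃ M, ∀ η ∈ Icc 0 L, |q' η| ≤ M)
    (hqq : ∀ η ∈ Icc 0 L, |q η - q' η| ≤ K) (η φ : ℝ) :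
    |transportSol ρ L h S q η φ - transportSol ρ L h S q' η φ| ≤ K * (1 - exp (-(2 * ρ))) := by
  have hρ : 0 < ρ := by linarith
  by_cases hc : η ∈ Icc 0 L ∧ ¬ IsGrazing η φ
  · rw [transportSol_of_mem hc.1 hc.2, transportSol_of_mem hc.1 hc.2]
    refine abs_duh_sub_le hL (by linarith) (inAnnulus_polar hL hc.1 φ)
      (sq_lt_of_not_isGrazing hL hc.1 hc.2) hK
      (segIntegrable_totalSource hρ hq hqM hS hSM)
      (segIntegrable_totalSource hρ hq' hqM' hS hSM) h fun u w hz => ?_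
    have := abs_cart_le_of_inAnnulus hρ (F := fun η _ => q η - q' η) (fun η hη _ => hqq η hη) hz
    convert this using 2
    simp only [totalSource, cart]
    ring
  · rw [transportSol, if_neg hc, transportSol, if_neg hc, sub_zero, abs_zero]
    exact mul_nonneg hK (contraction_nonneg hρ)

/-- The velocity average of the solution is a fixed point of a contraction. -/
theorem exists_avg_transportSol_eq {ρ : ℝ} (hL : 0 < ρ - L) (hL0 : 0 < L) (hh : Measurable h)
    (hhM : ∃ M, ∀ φ ∈ inflow, |h φ| ≤ M) (hS : Measurable (Function.uncurry S))
    (hSM : ∃ M, ∀ η ∈ Icc 0 L, ∀ φ, |S η φ| ≤ M) :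
    ∃ q : ℝ → ℝ, Measurable q ∧ (∃ M, ∀ η ∈ Icc 0 L, |q η| ≤ M) ∧
      ∀ η, avg (transportSol ρ L h S q) η = q η := by
  have hρ : 0 < ρ := by linarith
  obtain ⟨H, hH⟩ := hhM
  obtain ⟨B, hB⟩ := hSM
  have hH' : ∀ φ ∈ inflow, |h φ| ≤ |H| := fun φ hφ => (hH φ hφ).trans (le_abs_self H)
  have hB' : ∀ η ∈ Icc 0 L, ∀ φ, |S η φ| ≤ |B| := fun η hη φ => (hB η hη φ).trans (le_abs_self B)
  set c := 1 - exp (-(2 * ρ)) with hc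
  have hc0 : 0 ≤ c := contraction_nonneg hρ
  have hc1 : c < 1 := contraction_lt
  set T : (ℝ → ℝ) → ℝ → ℝ := fun q => avg (transportSol ρ L h S q) with hT
  have hTm : ∀ q, Measurable q → Measurable (T q) := fun q hq =>
    measurable_avg (measurable_transportSol ρ hh hS hq)
  have hTsol : ∀ q : ℝ → ℝ, (∃ M, ∀ η ∈ Icc 0 L, |q η| ≤ M) →
      ∃ M, ∀ η φ, |transportSol ρ L h S q η φ| ≤ M := by
    rintro q hq
    obtain ⟨N, hN⟩ := bounded_add hq ⟨B, hB⟩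
    exact ⟨|H| + |N|, fun η φ => abs_transportSol_le hL hL0 (abs_nonneg _) (abs_nonneg _) hH'
      (fun η hη φ => (hN η hη φ).trans (le_abs_self N)) η φ⟩
  have hTb : ∀ q : ℝ → ℝ, (∃ M, ∀ η ∈ Icc 0 L, |q η| ≤ M) → ∃ M, ∀ η ∈ Icc 0 L, |T q η| ≤ M := by
    intro q hq
    obtain ⟨N, hN⟩ := hTsol q hq
    exact ⟨N, fun η _ => abs_avg_le fun φ _ => hN η φ⟩
  have hTc : ∀ (q q' : ℝ → ℝ) (K : ℝ), 0 ≤ K → Measurable q → Measurable q' →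
      (∃ M, ∀ η ∈ Icc 0 L, |q η| ≤ M) → (∃ M, ∀ η ∈ Icc 0 L, |q' η| ≤ M) →
      (∀ η ∈ Icc 0 L, |q η - q' η| ≤ K) → ∀ η, |T q η - T q' η| ≤ K * c := by
    intro q q' K hK hq hq' hqM hqM' hqq η
    have hint : ∀ q : ℝ → ℝ, Measurable q → (∃ M, ∀ η ∈ Icc 0 L, |q η| ≤ M) →
        IntervalIntegrable (transportSol ρ L h S q η) volume (-π) π := by
      intro q hq hqM
      obtain ⟨N, hN⟩ := hTsol q hqM
      exact intervalIntegrable_of_bdd (measurable_transportSol ρ hh hS hq).of_uncurry_left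
        (by linarith [pi_pos]) fun φ _ => hN η φ
    simp only [hT]
    rw [← avg_sub (hint q hq hqM) (hint q' hq' hqM')]
    exact abs_avg_le fun φ _ =>
      abs_transportSol_sub_le hL hL0 hK hS ⟨B, hB⟩ hq hqM hq' hqM' hqq η φ
  -- Picard iteration with pointwise geometric bounds; a pointwise limit of measurable iterates is
  -- measurable, so no function space is needed.
  set x : ℕ → ℝ → ℝ := fun n => T^[n] (fun _ => 0) with hx
  have hxs : ∀ n, x (n + 1) = T (x n) := fun n => Function.iterate_succ_apply' T n _
  have hxm : ∀ n, Measurable (x n) := by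
    intro n
    induction n with
    | zero => exact measurable_const
    | succ n ih => rw [hxs]; exact hTm _ ih
  have hxb : ∀ n, ∃ M, ∀ η ∈ Icc 0 L, |x n η| ≤ M := by
    intro n
    induction n with
    | zero => exact ⟨0, fun η _ => by simp [hx]⟩
    | succ n ih => rw [hxs]; exact hTb _ ih
  set M := |H| + |B| with hM
  have hM0 : 0 ≤ M := by positivity
  have hdiff : ∀ n η, |x (n + 1) η - x n η| ≤ M * c ^ n := by
    intro n
    induction n with
    | zero =>
      intro η
      rw [hxs, pow_zero, mul_one]
      simp only [hx, Function.iterate_zero, id, sub_zero]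
      exact abs_avg_le fun φ _ => abs_transportSol_le hL hL0 (abs_nonneg _) (abs_nonneg _) hH'
        (fun η hη φ => by simpa using hB' η hη φ) η φ
    | succ n ih =>
      intro η
      have := hTc (x (n + 1)) (x n) (M * c ^ n) (by positivity) (hxm _) (hxm _) (hxb _) (hxb _)
        (fun η _ => ih η) η
      rw [← hxs, ← hxs] at this
      rwa [pow_succ, ← mul_assoc]
  have hdist : ∀ η n, dist (x n η) (x (n + 1) η) ≤ M * c ^ n := fun η n => by
    rw [dist_comm, Real.dist_eq]; exact hdiff n η
  have hlim : ∀ η, ∃ y, Filter.Tendsto (fun n => x n η) Filter.atTop (nhds y) := fun η =>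
    cauchySeq_tendsto_of_complete (cauchySeq_of_le_geometric c M hc1 (hdist η))
  choose q hq using hlim
  have hqx : ∀ n η, |x n η - q η| ≤ M * c ^ n / (1 - c) := fun n η => by
    rw [← Real.dist_eq]
    exact dist_le_of_le_geometric_of_tendsto c M hc1 (hdist η) (hq η) n
  have hqm : Measurable q :=
    measurable_of_tendsto_metrizable hxm (tendsto_pi_nhds.2 hq)
  have hqb : ∃ M, ∀ η ∈ Icc 0 L, |q η| ≤ M :=
    ⟨M * c ^ 0 / (1 - c), fun η _ => by simpa [hx] using hqx 0 η⟩
  refine ⟨q, hqm, hqb, fun η => ?_⟩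
  have hcz : Filter.Tendsto (fun n : ℕ => M * c ^ n / (1 - c) * c) Filter.atTop
      (nhds (M * 0 / (1 - c) * c)) :=
    (((tendsto_pow_atTop_nhds_zero_of_lt_one hc0 hc1).const_mul M).div_const _).mul_const c
  have h1 : Filter.Tendsto (fun n => x (n + 1) η) Filter.atTop (nhds (T q η)) := by
    rw [tendsto_iff_dist_tendsto_zero]
    refine squeeze_zero (fun _ => dist_nonneg) (fun n => ?_) (by simpa using hcz)
    rw [Real.dist_eq, hxs]
    have h1c : 0 < 1 - c := by linarith
    exact hTc _ _ _ (by positivity) (hxm n) hqm (hxb n) hqb (fun η _ => hqx n η) η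
  exact tendsto_nhds_unique h1 ((Filter.tendsto_add_atTop_iff_nat 1).2 (hq η))

theorem mem_Ioo_of_mem_inflow {φ : ℝ} (hφ : φ ∈ inflow) : φ ∈ Ioo 0 π := by
  refine ⟨?_, hφ.1.2⟩
  by_contra h
  have := sin_nonpos_of_nonpos_of_neg_pi_le (not_lt.1 h) hφ.1.1
  linarith [hφ.2]

/-- On the lower half of the inner circle the leg below the disk has length zero, so the value is
the one at the mirror point. -/
theorem transportSol_specular {ρ : ℝ} (hL : 0 < ρ - L) (hL0 : 0 < L) (q : ℝ → ℝ) (φ : ℝ) :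
    transportSol ρ L h S q L φ = transportSol ρ L h S q L (-φ) := by
  have hng : ∀ φ, ¬ IsGrazing L φ := fun φ hg => hL0.ne' hg.1
  have key : ∀ φ, 0 < sin φ → transportSol ρ L h S q L φ = transportSol ρ L h S q L (-φ) := by
    intro φ hs
    rw [transportSol_of_mem ⟨hL0.le, le_rfl⟩ (hng _), transportSol_of_mem ⟨hL0.le, le_rfl⟩ (hng _)]
    have hw : 0 < (ρ - L) * sin φ := mul_pos hL hs
    have hV : √((ρ - L) ^ 2 - ((ρ - L) * cos φ) ^ 2) = (ρ - L) * sin φ := by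
      rw [← Real.sqrt_sq hw.le]
      congr 1
      linear_combination -(ρ - L) ^ 2 * Real.sin_sq_add_cos_sq φ
    have hlt : ((ρ - L) * cos φ) ^ 2 < (ρ - L) ^ 2 := by
      have : ((ρ - L) * cos φ) ^ 2 + ((ρ - L) * sin φ) ^ 2 = (ρ - L) ^ 2 := by
        linear_combination (ρ - L) ^ 2 * Real.sin_sq_add_cos_sq φ
      nlinarith
    rw [cos_neg, sin_neg, mul_neg, duh, if_neg (fun hc => by linarith [hc.2]), duh,
      if_pos ⟨hlt, by linarith⟩, hV]
    simp [seg]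
  rcases lt_trichotomy (sin φ) 0 with hs | hs | hs
  · have := key (-φ) (by rw [sin_neg]; linarith)
    rw [neg_neg] at this
    exact this.symm
  · exact periodic_eq_of_cos_sin (periodic_transportSol ρ q L) (by rw [cos_neg])
      (by rw [sin_neg, hs, neg_zero])
  · exact key φ hs

theorem transportSol_inflow {ρ : ℝ} (hρ : 0 < ρ) (hL0 : 0 < L) (q : ℝ → ℝ) {φ : ℝ}
    (hφ : φ ∈ inflow) : transportSol ρ L h S q 0 φ = h φ := by
  have hm := mem_Ioo_of_mem_inflow hφ
  rw [transportSol_of_mem ⟨le_rfl, hL0.le⟩ (not_isGrazing_of_sin hφ.2.ne'), sub_zero]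
  have hw : 0 < ρ * sin φ := mul_pos hρ hφ.2
  have hV : √(ρ ^ 2 - (ρ * cos φ) ^ 2) = ρ * sin φ := by
    rw [← Real.sqrt_sq hw.le]
    congr 1
    linear_combination -ρ ^ 2 * Real.sin_sq_add_cos_sq φ
  rw [duh, if_neg (fun hc => by linarith [hc.2]), duhUp, hV, mul_div_cancel_left₀ _ hρ.ne',
    arccos_cos hm.1.le hm.2.le]
  simp [seg]

theorem isSolution_transportSol (hε : 0 < ε) (hL0 : 0 < L) (hL : 0 < R / ε - L)
    (hh : Measurable h) (hhM : ∃ M, ∀ φ ∈ inflow, |h φ| ≤ M)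
    (hS : Measurable (Function.uncurry S)) (hSp : ∀ η, Function.Periodic (S η) (2 * π))
    (hSM : ∃ M, ∀ η ∈ Icc 0 L, ∀ φ, |S η φ| ≤ M) {q : ℝ → ℝ} (hq : Measurable q)
    (hqM : ∃ M, ∀ η ∈ Icc 0 L, |q η| ≤ M)
    (hfix : ∀ η, avg (transportSol (R / ε) L h S q) η = q η) :
    IsSolution R ε L h S (transportSol (R / ε) L h S q) := by
  set ρ := R / ε with hρdef
  have hρ : 0 < ρ := by linarith
  refine ⟨measurable_transportSol ρ hh hS hq, periodic_transportSol ρ q, ?_, ?_,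
    fun φ hφ => transportSol_inflow hρ hL0 q hφ, transportSol_specular hL hL0 q⟩
  · obtain ⟨H, hH⟩ := hhM
    obtain ⟨B, hB⟩ := bounded_add hqM hSM
    exact ⟨|H| + |B|, fun η _ φ => abs_transportSol_le hL hL0 (abs_nonneg _) (abs_nonneg _)
      (fun φ hφ => (hH φ hφ).trans (le_abs_self H))
      (fun η hη φ => (hB η hη φ).trans (le_abs_self B)) η φ⟩
  · intro a b x p hab hc
    have hpol := fun s (hs : s ∈ Icc a b) => hc.polar hε hL (s := s) hs
    rw [← hρdef] at hpol
    set u := (ρ - x a) * cos (p a) with hu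
    set w₂ := (ρ - x a) * sin (p a) with hw₂
    have hseg : ∀ t ∈ Icc (w₂ - (b - a)) w₂, InAnnulus (ρ - L) ρ u t := by
      intro t ht
      have hs : a + (w₂ - t) ∈ Icc a b := ⟨by linarith [ht.2], by linarith [ht.1]⟩
      have h1 := inAnnulus_polar hL (hc _ hs).1 (p (a + (w₂ - t)))
      rw [(hpol _ hs).1, (hpol _ hs).2] at h1
      convert h1 using 1
      ring
    -- A one-point arc may sit on the grazing set, but then both sides vanish.
    rcases hab.eq_or_lt with rfl | hab'
    · simp
    -- A nondegenerate arc contains two different values of w with u² + w² ≤ ρ², so u² = ρ² is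
    -- impossible and the arc avoids the grazing set.
    have hu2 : u ^ 2 < ρ ^ 2 := by
      have h1 := (hseg w₂ ⟨by linarith, le_rfl⟩).2
      have h2 := (hseg (w₂ - (b - a)) ⟨le_rfl, by linarith⟩).2
      by_contra hcon
      have h3 : w₂ ^ 2 ≤ 0 := by linarith
      have h4 : (w₂ - (b - a)) ^ 2 ≤ 0 := by linarith
      have h5 : w₂ = 0 := by nlinarith
      rw [h5] at h4
      nlinarith
    have hng : ∀ s ∈ Icc a b, ¬ IsGrazing (x s) (p s) := by
      rintro s hs ⟨h1, h2⟩
      have h3 := (hpol s hs).1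
      rw [h1, sub_zero] at h3
      rw [← h3] at hu2
      have := Real.sin_sq_add_cos_sq (p s)
      rw [h2] at this
      nlinarith
    have hval : ∀ s ∈ Icc a b, transportSol ρ L h S q (x s) (p s) =
        duh (ρ - L) ρ h (totalSource ρ q S) u (w₂ - (s - a)) := by
      intro s hs
      rw [transportSol_of_mem (hc s hs).1 (hng s hs), (hpol s hs).1, (hpol s hs).2]
    have hsrc : ∀ s ∈ Icc a b, q (x s) + S (x s) (p s) = totalSource ρ q S u (w₂ - (s - a)) := by
      intro s hs
      have hper : Function.Periodic (fun φ => q (x s) + S (x s) φ) (2 * π) := fun φ => by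
        simp only [hSp (x s) φ]
      have := cart_polar (ρ := ρ) (η := x s) (by linarith [(hc s hs).1.2])
        (G := fun η φ => q η + S η φ) hper (p s)
      rw [(hpol s hs).1, (hpol s hs).2] at this
      exact this.symm
    have hT := isTransport_duh hL (by linarith : ρ - L ≤ ρ) (h := h)
      (segIntegrable_totalSource hρ hq hqM hS hSM) u (w₂ - (b - a)) w₂ (by linarith) hseg
    rw [hval b ⟨hab, le_rfl⟩, hval a ⟨le_rfl, hab⟩, sub_self, sub_zero, hT]
    have hsub := intervalIntegral.integral_comp_sub_left (a := a) (b := b)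
      (fun t => totalSource ρ q S u t - duh (ρ - L) ρ h (totalSource ρ q S) u t) (w₂ + a)
    rw [show w₂ + a - b = w₂ - (b - a) by ring, show w₂ + a - a = w₂ by ring] at hsub
    rw [← hsub]
    refine intervalIntegral.integral_congr fun s hs => ?_
    rw [uIcc_of_le hab] at hs
    rw [hfix, hval s hs, show w₂ + a - s = w₂ - (s - a) by ring, ← hsrc s hs]
    ring

/-- Existence of a solution that vanishes on the grazing set. -/
theorem exists_isSolution (hε : 0 < ε) (hL0 : 0 < L) (hL : 0 < R / ε - L)
    (hh : Measurable h) (hhM : ∃ M, ∀ φ ∈ inflow, |h φ| ≤ M)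
    (hS : Measurable (Function.uncurry S)) (hSp : ∀ η, Function.Periodic (S η) (2 * π))
    (hSM : ∃ M, ∀ η ∈ Icc 0 L, ∀ φ, |S η φ| ≤ M) :
    ∃ f, IsSolution R ε L h S f ∧ ∀ η φ, IsGrazing η φ → f η φ = 0 := by
  obtain ⟨q, hq, hqM, hfix⟩ := exists_avg_transportSol_eq (ρ := R / ε) hL hL0 hh hhM hS hSM
  exact ⟨_, isSolution_transportSol hε hL0 hL hh hhM hS hSp hSM hq hqM hfix,
    fun η φ hg => if_neg fun hc => hc.2 hg⟩

end

section

/-! ### The supremum estimate -/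

/-- The Cauchy–Schwarz inequality. -/
theorem sq_integral_mul_le {α : Type*} [MeasurableSpace α] {μ : Measure α} {f g : α → ℝ}
    (hf : Integrable (fun x => f x ^ 2) μ) (hfg : Integrable (fun x => f x * g x) μ)
    (hg : Integrable (fun x => g x ^ 2) μ) :
    (∫ x, f x * g x ∂μ) ^ 2 ≤ (∫ x, f x ^ 2 ∂μ) * ∫ x, g x ^ 2 ∂μ := by
  -- The quadratic t ↦ ∫ (f + t g)² is nonnegative, so its discriminant is not positive.
  have h : ∀ t : ℝ, 0 ≤ (∫ x, g x ^ 2 ∂μ) * (t * t) + (2 * ∫ x, f x * g x ∂μ) * t +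
      ∫ x, f x ^ 2 ∂μ := by
    intro t
    have h1 : ∫ x, (f x + t * g x) ^ 2 ∂μ = (∫ x, g x ^ 2 ∂μ) * (t * t) +
        (2 * ∫ x, f x * g x ∂μ) * t + ∫ x, f x ^ 2 ∂μ := by
      have h2 : ∀ x, (f x + t * g x) ^ 2 = (t * t) * g x ^ 2 + (2 * t) * (f x * g x) + f x ^ 2 :=
        fun x => by ring
      simp_rw [h2]
      have h3 := hg.const_mul (t * t)
      have h4 := hfg.const_mul (2 * t)
      have h5 : Integrable (fun x => t * t * g x ^ 2 + 2 * t * (f x * g x)) μ := h3.add h4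
      rw [integral_add h5 hf, integral_add h3 h4, integral_const_mul, integral_const_mul]
      ring
    rw [← h1]
    exact integral_nonneg fun x => sq_nonneg _
  have := discrim_le_zero h
  unfold discrim at this
  linarith

theorem sq_intervalIntegral_mul_le {f g : ℝ → ℝ} {a b M N : ℝ} (hab : a ≤ b)
    (hf : Measurable f) (hg : Measurable g) (hM : ∀ x ∈ Icc a b, |f x| ≤ M)
    (hN : ∀ x ∈ Icc a b, |g x| ≤ N) :
    (∫ x in a..b, f x * g x) ^ 2 ≤ (∫ x in a..b, f x ^ 2) * ∫ x in a..b, g x ^ 2 := by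
  have key : ∀ {f g : ℝ → ℝ} {M N : ℝ}, Measurable f → Measurable g →
      (∀ x ∈ Icc a b, |f x| ≤ M) → (∀ x ∈ Icc a b, |g x| ≤ N) →
      IntegrableOn (fun x => f x * g x) (Ioc a b) := by
    intro f g M N hf hg hM hN
    refine integrableOn_of_bdd (M := M * N) (hf.mul hg) measurableSet_Ioc (by simp) fun x hx => ?_
    have hx' := Ioc_subset_Icc_self hx
    rw [abs_mul]
    exact mul_le_mul (hM x hx') (hN x hx') (abs_nonneg _) ((abs_nonneg _).trans (hM x hx'))
  simp only [intervalIntegral.integral_of_le hab]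
  refine sq_integral_mul_le ?_ (key hf hg hM hN) ?_
  · simp only [sq]
    exact key hf hf hM hM
  · simp only [sq]
    exact key hg hg hN hN

/-! ### Radial sources on transversal segments. -/

theorem hasDerivAt_radius {ρ u t : ℝ} (h : 0 < u ^ 2 + t ^ 2) :
    HasDerivAt (fun t => ρ - √(u ^ 2 + t ^ 2)) (-(t / √(u ^ 2 + t ^ 2))) t := by
  have h1 : HasDerivAt (fun t => u ^ 2 + t ^ 2) (2 * t) t := by
    have := ((hasDerivAt_id t).pow 2).const_add (u ^ 2)
    simpa using this
  refine ((h1.sqrt h.ne').const_sub ρ).congr_deriv ?_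
  have := (Real.sqrt_pos.2 h).ne'
  field_simp

/-- The integral of a function of the radius along a transversal segment. -/
theorem integral_radius_le {ρ L u w₁ w₂ δ M : ℝ} (hL : 0 < ρ - L) (hL0 : 0 < L) (hδ : 0 < δ)
    (hw : w₁ ≤ w₂) (hsgn : 0 ≤ w₁ ∨ w₂ ≤ 0) (hann : ∀ t ∈ Icc w₁ w₂, InAnnulus (ρ - L) ρ u t)
    (htr : ∀ t ∈ Icc w₁ w₂, δ * √(u ^ 2 + t ^ 2) ≤ |t|) {k : ℝ → ℝ} (hk : Measurable k)
    (hk0 : ∀ η, 0 ≤ k η) (hkM : ∀ η ∈ Icc 0 L, k η ≤ M) :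
    ∫ t in w₁..w₂, k (ρ - √(u ^ 2 + t ^ 2)) ≤ δ⁻¹ * ∫ η in (0 : ℝ)..L, k η := by
  have hpos : ∀ t ∈ Icc w₁ w₂, 0 < u ^ 2 + t ^ 2 := fun t ht =>
    lt_of_lt_of_le (by positivity) (hann t ht).1
  have hmem : ∀ t ∈ Icc w₁ w₂, ρ - √(u ^ 2 + t ^ 2) ∈ Icc 0 L := fun t ht => by
    refine ⟨?_, ?_⟩
    · rw [sub_nonneg]; exact (Real.sqrt_le_left (by linarith)).2 (hann t ht).2
    · have := Real.le_sqrt_of_sq_le (hann t ht).1; linarith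
  -- The radius determines t up to sign, and `hsgn` fixes the sign.
  have hinj : InjOn (fun t => ρ - √(u ^ 2 + t ^ 2)) (Icc w₁ w₂) := by
    intro s hs t ht hst
    have h1 : √(u ^ 2 + s ^ 2) = √(u ^ 2 + t ^ 2) := by
      simp only at hst; linarith
    have h2 := (Real.sqrt_inj (hpos s hs).le (hpos t ht).le).1 h1
    have h3 : s ^ 2 = t ^ 2 := by linarith
    rcases sq_eq_sq_iff_eq_or_eq_neg.1 h3 with h | h
    · exact h
    · rcases hsgn with h0 | h0
      · linarith [hs.1, ht.1]
      · linarith [hs.2, ht.2]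
  have hkb : ∀ η ∈ Icc 0 L, |k η| ≤ M := fun η hη => by
    rw [abs_of_nonneg (hk0 η)]; exact hkM η hη
  have himg : (fun t => ρ - √(u ^ 2 + t ^ 2)) '' Icc w₁ w₂ ⊆ Icc 0 L := by
    rintro _ ⟨t, ht, rfl⟩
    exact hmem t ht
  have hcv := integral_image_eq_integral_abs_deriv_smul measurableSet_Icc
    (fun t ht => (hasDerivAt_radius (ρ := ρ) (hpos t ht)).hasDerivWithinAt) hinj k
  have hle : ∫ η in (fun t => ρ - √(u ^ 2 + t ^ 2)) '' Icc w₁ w₂, k η ≤ ∫ η in Icc 0 L, k η :=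
    setIntegral_mono_set (integrableOn_of_bdd hk measurableSet_Icc (by simp) hkb)
      (ae_of_all _ hk0) himg.eventuallyLE
  rw [hcv] at hle
  have hm : Measurable fun t => k (ρ - √(u ^ 2 + t ^ 2)) := hk.comp (by fun_prop)
  -- The Jacobian |t| / √(u² + t²) of the radius is at least δ by transversality.
  have h1 : δ * ∫ t in Icc w₁ w₂, k (ρ - √(u ^ 2 + t ^ 2)) ≤
      ∫ t in Icc w₁ w₂, |-(t / √(u ^ 2 + t ^ 2))| • k (ρ - √(u ^ 2 + t ^ 2)) := by
    rw [← integral_const_mul]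
    refine setIntegral_mono_on ?_ ?_ measurableSet_Icc fun t ht => ?_
    · exact (integrableOn_of_bdd hm measurableSet_Icc (by simp)
        fun t ht => hkb _ (hmem t ht)).const_mul δ
    · refine integrableOn_of_bdd (M := 1 * M) (Measurable.mul (by fun_prop) hm) measurableSet_Icc
        (by simp) fun t ht => ?_
      rw [smul_eq_mul, abs_mul, abs_abs, abs_neg, abs_div, abs_of_nonneg (Real.sqrt_nonneg _)]
      refine mul_le_mul ?_ (hkb _ (hmem t ht)) (abs_nonneg _) zero_le_one
      rw [div_le_one (Real.sqrt_pos.2 (hpos t ht))]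
      exact Real.abs_le_sqrt (by nlinarith)
    · rw [smul_eq_mul]
      refine mul_le_mul_of_nonneg_right ?_ (hk0 _)
      rw [abs_neg, abs_div, abs_of_nonneg (Real.sqrt_nonneg _),
        le_div_iff₀ (Real.sqrt_pos.2 (hpos t ht))]
      exact htr t ht
  rw [intervalIntegral.integral_of_le hw, intervalIntegral.integral_of_le hL0.le,
    ← integral_Icc_eq_integral_Ioc, ← integral_Icc_eq_integral_Ioc, ← div_eq_inv_mul,
    le_div_iff₀ hδ, mul_comm]
  exact h1.trans hle

/-- A function of the radius in Cartesian coordinates. -/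
def radial (ρ : ℝ) (k : ℝ → ℝ) (u w : ℝ) : ℝ := k (ρ - √(u ^ 2 + w ^ 2))

/-- The contribution of a radial source on a transversal segment is controlled in `L²`. -/
theorem seg_radial_le {ρ L u w₁ w₂ δ M : ℝ} (hL : 0 < ρ - L) (hL0 : 0 < L) (hδ : 0 < δ)
    (hw : w₁ ≤ w₂) (hsgn : 0 ≤ w₁ ∨ w₂ ≤ 0) (hann : ∀ t ∈ Icc w₁ w₂, InAnnulus (ρ - L) ρ u t)
    (htr : ∀ t ∈ Icc w₁ w₂, δ * √(u ^ 2 + t ^ 2) ≤ |t|) {k : ℝ → ℝ} (hk : Measurable k)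
    (hkM : ∀ η ∈ Icc 0 L, |k η| ≤ M) :
    seg (radial ρ k) u w₁ w₂ ≤ √(δ⁻¹ * ∫ η in (0 : ℝ)..L, k η ^ 2) := by
  have hmem : ∀ t ∈ Icc w₁ w₂, ρ - √(u ^ 2 + t ^ 2) ∈ Icc 0 L := fun t ht => by
    refine ⟨?_, ?_⟩
    · rw [sub_nonneg]; exact (Real.sqrt_le_left (by linarith)).2 (hann t ht).2
    · have := Real.le_sqrt_of_sq_le (hann t ht).1; linarith
  have hexp : ∀ t ∈ Icc w₁ w₂, exp (-(t - w₁)) ≤ 1 := fun t ht =>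
    exp_le_one_iff.2 (by linarith [ht.1])
  have hcs := sq_intervalIntegral_mul_le (f := fun t => exp (-(t - w₁)))
    (g := fun t => k (ρ - √(u ^ 2 + t ^ 2))) (M := 1) (N := M) hw (by fun_prop)
    (hk.comp (by fun_prop)) (fun t ht => by rw [abs_of_pos (exp_pos _)]; exact hexp t ht)
    (fun t ht => hkM _ (hmem t ht))
  have h1 := integral_radius_le hL hL0 hδ hw hsgn hann htr (hk.pow_const 2)
    (fun η => sq_nonneg (k η)) (M := M ^ 2) fun η hη => by
      rw [← sq_abs]
      exact pow_le_pow_left₀ (abs_nonneg _) (hkM η hη) 2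
  -- The damping makes the Cauchy–Schwarz factor bounded independently of the length of the segment.
  have h2 : ∫ t in w₁..w₂, exp (-(t - w₁)) ^ 2 ≤ 1 := by
    have h3 : ∫ t in w₁..w₂, exp (-(t - w₁)) ^ 2 ≤ ∫ t in w₁..w₂, exp (-(t - w₁)) := by
      refine intervalIntegral.integral_mono_on hw
        ((by fun_prop : Continuous fun t => exp (-(t - w₁)) ^ 2).intervalIntegrable _ _)
        ((by fun_prop : Continuous fun t => exp (-(t - w₁))).intervalIntegrable _ _) fun t ht => ?_
      rw [sq]
      exact mul_le_of_le_one_left (exp_pos _).le (hexp t ht)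
    rw [integral_exp_seg] at h3
    linarith [exp_pos (-(w₂ - w₁))]
  have h4 : 0 ≤ ∫ t in w₁..w₂, k (ρ - √(u ^ 2 + t ^ 2)) ^ 2 :=
    intervalIntegral.integral_nonneg hw fun t _ => sq_nonneg _
  apply Real.le_sqrt_of_sq_le
  calc seg (radial ρ k) u w₁ w₂ ^ 2 ≤ _ := hcs
    _ ≤ 1 * ∫ t in w₁..w₂, k (ρ - √(u ^ 2 + t ^ 2)) ^ 2 := by gcongr
    _ ≤ _ := by rw [one_mul]; exact h1

theorem seg_le_of_abs_le {G : ℝ → ℝ → ℝ} {u w w₂ M : ℝ} (hw : w ≤ w₂) (hM : 0 ≤ M)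
    (h : ∀ t ∈ Icc w w₂, |G u t| ≤ M) : seg G u w w₂ ≤ M := by
  have h1 := abs_seg_le (g := fun _ _ => M) hw intervalIntegrable_const h
  rw [seg_const] at h1
  have h2 := exp_pos (-(w₂ - w))
  nlinarith [le_abs_self (seg G u w w₂)]

/-- On a vertical line the ratio t / √(u² + t²) grows with t ≥ 0, so transversality persists upward.
-/
theorem mul_sqrt_le_of_le {u t s c : ℝ} (hc0 : 0 ≤ c) (hc1 : c ≤ 1) (hs : 0 ≤ s) (hst : s ≤ t)
    (h : c * √(u ^ 2 + s ^ 2) ≤ s) : c * √(u ^ 2 + t ^ 2) ≤ t := by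
  have h1 : (c * √(u ^ 2 + s ^ 2)) ^ 2 ≤ s ^ 2 := by gcongr
  rw [mul_pow, Real.sq_sqrt (by positivity)] at h1
  refine (abs_le_of_sq_le_sq' ?_ (hs.trans hst)).2
  rw [mul_pow, Real.sq_sqrt (by positivity)]
  have h2 : c ^ 2 ≤ 1 := by nlinarith
  have h3 : s ^ 2 ≤ t ^ 2 := by gcongr
  nlinarith

/-- The contribution of a radial source to the Duhamel formula in a transversal direction. -/
theorem duh_radial_le {ρ L u w δ M T : ℝ} (hL : 0 < ρ - L) (hL0 : 0 < L) (hδ : 0 < δ)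
    (hδ1 : δ ≤ 1) (hT : 0 ≤ T) (hTL : 2 * T ≤ δ * (ρ - L)) (hz : InAnnulus (ρ - L) ρ u w)
    (htr : δ * √(u ^ 2 + w ^ 2) ≤ |w|) {k : ℝ → ℝ} (hk : Measurable k)
    (hkM : ∀ η ∈ Icc 0 L, |k η| ≤ M) :
    duh (ρ - L) ρ (fun _ => 0) (radial ρ k) u w ≤
      2 * √((δ / 2)⁻¹ * ∫ η in (0 : ℝ)..L, k η ^ 2) + 2 * exp (-T) * M := by
  set N := √((δ / 2)⁻¹ * ∫ η in (0 : ℝ)..L, k η ^ 2) with hN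
  have hN0 : 0 ≤ N := Real.sqrt_nonneg _
  have hM0 : 0 ≤ M := (abs_nonneg _).trans (hkM 0 ⟨le_rfl, hL0.le⟩)
  have hρ : 0 < ρ := by linarith
  have hδ2 : 0 < δ / 2 := by linarith
  have hrad : ∀ u t, InAnnulus (ρ - L) ρ u t → |radial ρ k u t| ≤ M := fun u t ht =>
    abs_cart_le_of_inAnnulus hρ (F := fun η _ => k η) (fun η hη _ => hkM η hη) ht
  have hsi : SegIntegrable (ρ - L) ρ (radial ρ k) :=
    segIntegrable_cart hρ (F := fun η _ => k η) (hk.comp measurable_fst)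
      ⟨M, fun η hη _ => hkM η hη⟩
  have hr : ρ - L ≤ √(u ^ 2 + w ^ 2) := Real.le_sqrt_of_sq_le hz.1
  have hwT : 2 * T ≤ |w| := hTL.trans ((mul_le_mul_of_nonneg_left hr hδ.le).trans htr)
  -- Since |w| ≥ 2T, moving by at most T towards the axis w = 0 at least keeps transversality with δ
  -- / 2 in place of δ.
  have hhalf : δ / 2 * √(u ^ 2 + w ^ 2) ≤ |w| / 2 := by linarith
  have hE := fun (w₁ w₂ : ℝ) => seg_radial_le (u := u) (w₁ := w₁) (w₂ := w₂) hL hL0 hδ2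
    (hk := hk) (hkM := hkM)
  have hmono : ∀ t, w ≤ t → t ≤ 0 → √(u ^ 2 + t ^ 2) ≤ √(u ^ 2 + w ^ 2) := fun t h1 h2 =>
    Real.sqrt_le_sqrt (by nlinarith)
  have hup : ∀ s t, 0 ≤ s → s ≤ t → δ / 2 * √(u ^ 2 + s ^ 2) ≤ s →
      δ / 2 * √(u ^ 2 + t ^ 2) ≤ |t| := fun s t hs hst h => by
    rw [abs_of_nonneg (hs.trans hst)]
    exact mul_sqrt_le_of_le hδ2.le (by linarith) hs hst h
  -- on a downward segment of length at least `T`, split off the initial part of length `T`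
  have hlow : ∀ w₂, w < 0 → w + T ≤ w₂ → (∀ t ∈ Icc w w₂, InAnnulus (ρ - L) ρ u t) →
      seg (radial ρ k) u w w₂ ≤ N + exp (-T) * M := by
    intro w₂ hw0 hTw hann
    rw [abs_of_neg hw0] at hwT hhalf
    rw [← seg_add_seg (by linarith : w ≤ w + T) hTw (hsi _ _ _ (by linarith) hann),
      add_sub_cancel_left]
    refine add_le_add (hE w (w + T) (by linarith) (Or.inr (by linarith))
      (fun t ht => hann t ⟨ht.1, by linarith [ht.2]⟩) fun t ht => ?_) ?_
    · rw [abs_of_nonpos (by linarith [ht.2])]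
      have := mul_le_mul_of_nonneg_left (hmono t ht.1 (by linarith [ht.2])) hδ2.le
      linarith [ht.2]
    · exact mul_le_mul_of_nonneg_left (seg_le_of_abs_le hTw hM0
        fun t ht => hrad _ _ (hann t ⟨by linarith [ht.1], ht.2⟩)) (exp_pos _).le
  have he := exp_pos (-T)
  have hzero : ∀ w, duhUp ρ (fun _ => 0) (radial ρ k) u w =
      seg (radial ρ k) u w (√(ρ ^ 2 - u ^ 2)) := fun w => by simp [duhUp]
  rcases duh_cases hL (by linarith) hz with ⟨h1, h2, h3, h4⟩ | ⟨V, h1, h2, h3, hV, h4, h5, h6⟩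
  · rw [h4, hzero]
    rcases le_or_gt 0 w with hw0 | hw0
    · have h7 : δ / 2 * √(u ^ 2 + w ^ 2) ≤ w := by
        rw [abs_of_nonneg hw0] at hhalf; linarith
      have := hE w _ h1 (Or.inl hw0) h2 fun t ht => hup w t hw0 ht.1 h7
      nlinarith
    · have hWT : w + T ≤ √(ρ ^ 2 - u ^ 2) := by
        rw [abs_of_neg hw0] at hwT
        linarith [Real.sqrt_nonneg (ρ ^ 2 - u ^ 2)]
      have := hlow _ hw0 hWT h2
      nlinarith
  · rw [h6, hzero]
    have hw0 : w < 0 := by linarith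
    -- If the inner circle is reached within length T, then V ≥ |w| / 2 and both legs are
    -- transversal. Otherwise the second leg carries a factor at most exp(-T).
    rcases le_or_gt (-V - w) T with hl | hl
    · rw [abs_of_neg hw0] at hwT hhalf
      have hV2 : δ / 2 * √(u ^ 2 + w ^ 2) ≤ V := by linarith
      have hVV : δ / 2 * √(u ^ 2 + V ^ 2) ≤ V := by
        have := mul_le_mul_of_nonneg_left (hmono (-V) h3 (by linarith)) hδ2.le
        rw [neg_sq] at this
        linarith
      have e1 := hE w (-V) h3 (Or.inr (by linarith)) h4 fun t ht => by
        rw [abs_of_nonpos (by linarith [ht.2])]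
        have := mul_le_mul_of_nonneg_left (hmono t ht.1 (by linarith [ht.2])) hδ2.le
        linarith [ht.2]
      have e2 := hE V _ h2 (Or.inl h1.le) h5 fun t ht => hup V t h1.le ht.1 hVV
      have e3 : exp (-(-V - w)) ≤ 1 := exp_le_one_iff.2 (by linarith)
      have e4 := (mul_le_mul_of_nonneg_left e2 (exp_pos (-(-V - w))).le).trans
        (mul_le_of_le_one_left hN0 e3)
      nlinarith
    · have e1 := hlow (-V) hw0 (by linarith) h4
      have e2 := seg_le_of_abs_le h2 hM0 fun t ht => hrad _ _ (h5 t ht)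
      have e3 : exp (-(-V - w)) ≤ exp (-T) := exp_le_exp.2 (by linarith)
      have e4 := (mul_le_mul_of_nonneg_left e2 (exp_pos (-(-V - w))).le).trans
        (mul_le_mul_of_nonneg_right e3 hM0)
      nlinarith

/-- Almost grazing directions have small measure. -/
theorem exists_measure_abs_sin_lt_le : ∃ δ > (0 : ℝ), δ ≤ 1 ∧
    volume.real (Ioc (-π) π ∩ {φ | |sin φ| < δ}) ≤ π / 2 := by
  set s : ℕ → Set ℝ := fun n => Ioc (-π) π ∩ {φ | |sin φ| < 1 / ((n : ℝ) + 1)} with hs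
  have hsm : ∀ n, MeasurableSet (s n) := fun n =>
    measurableSet_Ioc.inter (measurableSet_lt (by fun_prop : Measurable fun φ : ℝ => |sin φ|)
      measurable_const)
  have hanti : Antitone s := by
    intro m n hmn φ hφ
    have h1 : |sin φ| < 1 / ((n : ℝ) + 1) := hφ.2
    refine ⟨hφ.1, lt_of_lt_of_le h1 ?_⟩
    exact one_div_le_one_div_of_le (by positivity) (by gcongr)
  have hfin : ∀ n, volume (s n) ≠ ⊤ := fun n =>
    ne_top_of_le_ne_top (by simp) (measure_mono (inter_subset_left : s n ⊆ Ioc (-π) π))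
  -- The sets decrease to the null set sin φ = 0, so continuity from above provides δ.
  have hlim := tendsto_measure_iInter_atTop (μ := volume) (fun n => (hsm n).nullMeasurableSet)
    hanti ⟨0, hfin 0⟩
  have hnull : volume (⋂ n, s n) = 0 := by
    refine measure_mono_null ?_ (ae_iff.1 ae_sin_ne_zero)
    intro φ hφ
    simp only [mem_iInter] at hφ
    simp only [ne_eq, not_not, mem_ofPred_eq]
    by_contra h
    obtain ⟨n, hn⟩ := exists_nat_one_div_lt (abs_pos.2 h)
    exact absurd (hφ n).2 (not_lt.2 hn.le)
  rw [hnull] at hlim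
  have hev := hlim.eventually (gt_mem_nhds (show (0 : ENNReal) < ENNReal.ofReal (π / 2) by
    simp [pi_pos]))
  obtain ⟨n, hn⟩ := hev.exists
  refine ⟨1 / ((n : ℝ) + 1), by positivity, ?_, ?_⟩
  · rw [div_le_one (by positivity)]
    linarith [(Nat.cast_nonneg n : (0 : ℝ) ≤ n)]
  · exact ENNReal.toReal_le_of_le_ofReal (by positivity) hn.le

/-! ### From the L² norm to pointwise bounds. -/

variable {R ε L : ℝ} {h : ℝ → ℝ} {S : ℝ → ℝ → ℝ}

theorem IsSolution.intervalIntegrable {f : ℝ → ℝ → ℝ} (hf : IsSolution R ε L h S f) {η : ℝ}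
    (hη : η ∈ Icc 0 L) : IntervalIntegrable (f η) volume (-π) π := by
  obtain ⟨M, hM⟩ := hf.bounded
  exact intervalIntegrable_of_bdd hf.measurable.of_uncurry_left (by linarith [pi_pos])
    fun φ _ => hM η hη φ

theorem avg_const (c η : ℝ) : avg (fun _ _ => c) η = c := by
  unfold avg
  rw [intervalIntegral.integral_const, smul_eq_mul]
  field_simp [pi_ne_zero]
  ring

/-- The collision term f̄ - f annihilates constants, so the supremum bounds may be applied to f -
f_L. -/
theorem IsSolution.sub_const {f : ℝ → ℝ → ℝ} (hf : IsSolution R ε L h S f) (c : ℝ) :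
    IsSolution R ε L (fun φ => h φ - c) S (fun η φ => f η φ - c) := by
  refine ⟨hf.measurable.sub_const c, fun η φ => by simp only [hf.periodic η φ], ?_, ?_,
    fun φ hφ => by simp only [hf.inflow_bc φ hφ], fun φ => by simp only [hf.specular_bc φ]⟩
  · obtain ⟨M, hM⟩ := hf.bounded
    exact ⟨M + |c|, fun η hη φ => (abs_sub _ _).trans (add_le_add_left (hM η hη φ) _)⟩
  · intro a b x p hab hc
    rw [sub_sub_sub_cancel_right, hf.transport a b x p hab hc]
    refine intervalIntegral.integral_congr fun s hs => ?_
    rw [uIcc_of_le hab] at hs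
    have := avg_sub (g := fun _ _ => c) (hf.intervalIntegrable (hc s hs).1)
      intervalIntegrable_const
    rw [avg_const] at this
    simp only [this]
    ring

/-- A solution is bounded by the data and a Duhamel integral of its velocity average. -/
theorem IsSolution.abs_le (hε : 0 < ε) (hL0 : 0 < L) (hL : 0 < R / ε - L) {f : ℝ → ℝ → ℝ}
    (hS : Measurable (Function.uncurry S)) (hSp : ∀ η, Function.Periodic (S η) (2 * π))
    {H B : ℝ} (hH : ∀ φ ∈ inflow, |h φ| ≤ H) (hB : ∀ η ∈ Icc 0 L, ∀ φ, |S η φ| ≤ B)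
    (hf : IsSolution R ε L h S f) {η φ : ℝ} (hη : η ∈ Icc 0 L) (hg : ¬ IsGrazing η φ) :
    |f η φ| ≤ H + B + duh (R / ε - L) (R / ε) (fun _ => 0)
      (radial (R / ε) fun η => |avg f η|) ((R / ε - η) * cos φ) ((R / ε - η) * sin φ) := by
  set ρ := R / ε with hρdef
  have hρ : 0 < ρ := by linarith
  have hab : ρ - L ≤ ρ := by linarith
  have hH0 : 0 ≤ H := (abs_nonneg _).trans (hH (π / 2) ⟨⟨by linarith [pi_pos], by linarith [pi_pos]⟩,
    by simp⟩)
  have hB0 : 0 ≤ B := (abs_nonneg _).trans (hB 0 ⟨le_rfl, hL0.le⟩ 0)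
  have hz := inAnnulus_polar hL hη φ
  obtain ⟨M, hM⟩ := hf.avg_bounded
  have hsi : SegIntegrable (ρ - L) ρ (radial ρ fun η => |avg f η|) :=
    segIntegrable_cart hρ (F := fun η _ => |avg f η|)
      ((measurable_avg hf.measurable).comp measurable_fst).abs
      ⟨M, fun η hη _ => by rw [abs_abs]; exact hM η hη⟩
  have hsB : SegIntegrable (ρ - L) ρ (fun _ _ => B) := fun _ _ _ _ _ => intervalIntegrable_const
  have hsum : SegIntegrable (ρ - L) ρ (fun u w => B + radial ρ (fun η => |avg f η|) u w) :=
    fun u w₁ w₂ hw hann => (hsB u w₁ w₂ hw hann).add (hsi u w₁ w₂ hw hann)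
  rw [hf.eq_duh hε hL0 hL hS hSp ⟨B, hB⟩ hη hg]
  refine (abs_duh_le hL hab hz (sq_lt_of_not_isGrazing hL hη hg) hH hsum fun u w hz => ?_).trans
    ((duh_inflow_le hL hab hz hH0 _).trans ?_)
  · have h1 : |cart ρ S u w| ≤ B := abs_cart_le_of_inAnnulus hρ hB hz
    have h2 : totalSource ρ (avg f) S u w = avg f (ρ - √(u ^ 2 + w ^ 2)) + cart ρ S u w := rfl
    rw [h2, add_comm]
    exact (abs_add_le _ _).trans (add_le_add_left h1 _)
  · have h1 := duh_sub hL hab hz hsum hsi (fun _ => 0) (fun _ => 0)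
    simp only [sub_zero, add_sub_cancel_right] at h1
    have h2 := duh_le_add hL hab hz le_rfl hB0
    linarith

/-- The velocity average is bounded by the data and its `L²` norm. -/
theorem exists_abs_avg_le : ∃ δ > (0 : ℝ), ∀ R ε L : ℝ, 0 < ε → 0 < L → 6 ≤ δ * (R / ε - L) →
    ∀ (h : ℝ → ℝ) (S f : ℝ → ℝ → ℝ), Measurable (Function.uncurry S) →
      (∀ η, Function.Periodic (S η) (2 * π)) → IsSolution R ε L h S f →
      ∀ H B : ℝ, (∀ φ ∈ inflow, |h φ| ≤ H) → (∀ η ∈ Icc 0 L, ∀ φ, |S η φ| ≤ B) →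
      ∀ η ∈ Icc 0 L, |avg f η| ≤
        2 * (H + B + 2 * √((δ / 2)⁻¹ * ∫ η in (0 : ℝ)..L, avg f η ^ 2)) := by
  obtain ⟨δ, hδ, hδ1, hmeas⟩ := exists_measure_abs_sin_lt_le
  refine ⟨δ, hδ, ?_⟩
  intro R ε L hε hL0 h6 h S f hS hSp hf H B hH hB
  have hL : 0 < R / ε - L := by
    by_contra hc
    nlinarith
  set ρ := R / ε with hρdef
  have hρ : 0 < ρ := by linarith
  have hab : ρ - L ≤ ρ := by linarith
  set N := √((δ / 2)⁻¹ * ∫ η in (0 : ℝ)..L, avg f η ^ 2) with hN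
  set X := {y | ∃ η ∈ Icc 0 L, y = |avg f η|} with hX
  obtain ⟨M₀, hM₀⟩ := hf.avg_bounded
  have hXb : BddAbove X := ⟨M₀, by rintro _ ⟨η, hη, rfl⟩; exact hM₀ η hη⟩
  set M := sSup X with hM
  have hMle : ∀ η ∈ Icc 0 L, |avg f η| ≤ M := fun η hη => le_csSup hXb ⟨η, hη, rfl⟩
  have hM0 : 0 ≤ M := (abs_nonneg _).trans (hMle 0 ⟨le_rfl, hL0.le⟩)
  have hk : Measurable fun η => |avg f η| := (measurable_avg hf.measurable).abs
  -- The cut-off length is T = 3, which is why 2T = 6 appears in the hypothesis on δ (R / ε - L).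
  have hsmall : 2 * exp (-3) ≤ 1 / 4 := by
    have h1 : (8 : ℝ) ≤ exp 3 := by
      have h2 : (2 : ℝ) ≤ exp 1 := by linarith [add_one_le_exp (1 : ℝ)]
      have h3 : exp 3 = exp 1 ^ 3 := by rw [← exp_nat_mul]; norm_num
      rw [h3]
      calc (8 : ℝ) = 2 ^ 3 := by norm_num
        _ ≤ exp 1 ^ 3 := by gcongr
    rw [exp_neg]
    have := inv_anti₀ (by norm_num) h1
    linarith
  set A := {φ : ℝ | |sin φ| < δ} with hA
  have hAm : MeasurableSet A :=
    measurableSet_lt (by fun_prop : Measurable fun φ : ℝ => |sin φ|) measurable_const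
  -- pointwise bounds
  have hpt : ∀ η ∈ Icc 0 L, ∀ φ, sin φ ≠ 0 →
      |f η φ| ≤ (H + B + 2 * N + M / 4) + A.indicator (fun _ => M) φ := by
    intro η hη φ hφ
    have hz := inAnnulus_polar hL hη φ
    have hrη : 0 < ρ - η := by linarith [hη.2]
    refine (hf.abs_le hε hL0 hL hS hSp hH hB hη (not_isGrazing_of_sin hφ)).trans ?_
    by_cases hφA : φ ∈ A
    · rw [indicator_of_mem hφA]
      have h1 := abs_duh_le (h := fun _ => 0) (H := 0) (g := fun _ _ => M) hL hab hz
        (sq_lt_of_not_isGrazing hL hη (not_isGrazing_of_sin hφ)) (by simp)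
        (fun _ _ _ _ _ => intervalIntegrable_const)
        (G := radial ρ fun η => |avg f η|) fun u w hz =>
          abs_cart_le_of_inAnnulus hρ (F := fun η _ => |avg f η|)
            (fun η hη _ => by rw [abs_abs]; exact hMle η hη) hz
      have h2 := (le_abs_self _).trans (h1.trans (duh_le_add hL hab hz le_rfl hM0))
      have hN0 : 0 ≤ N := Real.sqrt_nonneg _
      linarith
    · rw [indicator_of_notMem hφA]
      have h1 := duh_radial_le (T := 3) (M := M) hL hL0 hδ hδ1 (by norm_num) (by linarith) hz ?_ hk
        fun η hη => by rw [abs_abs]; exact hMle η hη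
      · simp only [sq_abs] at h1
        have := mul_le_mul_of_nonneg_right hsmall hM0
        linarith
      · rw [sqrt_polar hrη.le, abs_mul, abs_of_pos hrη, mul_comm]
        exact mul_le_mul_of_nonneg_left (not_lt.1 hφA) hrη.le
  have havg : ∀ η ∈ Icc 0 L, |avg f η| ≤ H + B + 2 * N + M / 2 := by
    intro η hη
    have hpi : -π ≤ π := by linarith [pi_pos]
    have hi : IntervalIntegrable (fun φ => A.indicator (fun _ => M) φ) volume (-π) π :=
      intervalIntegrable_of_bdd (M := M) (measurable_const.indicator hAm) hpi fun φ _ => by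
        by_cases hφ : φ ∈ A
        · rw [indicator_of_mem hφ, abs_of_nonneg hM0]
        · rw [indicator_of_notMem hφ, abs_zero]; exact hM0
    have h1 : ‖∫ φ in (-π)..π, f η φ‖ ≤
        ∫ φ in (-π)..π, ((H + B + 2 * N + M / 4) + A.indicator (fun _ => M) φ) := by
      refine intervalIntegral.norm_integral_le_of_norm_le hpi ?_
        (intervalIntegrable_const.add hi)
      filter_upwards [ae_sin_ne_zero] with φ hφ _ using hpt η hη φ hφ
    -- The almost grazing directions have at most a quarter of the total measure 2π. They contribute
    -- M / 4 to the average, in addition to the M / 4 from the transversal directions.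
    have h2 : ∫ φ in (-π)..π, A.indicator (fun _ => M) φ ≤ π / 2 * M := by
      rw [intervalIntegral.integral_of_le hpi, setIntegral_indicator hAm, setIntegral_const,
        smul_eq_mul]
      exact mul_le_mul_of_nonneg_right hmeas hM0
    rw [intervalIntegral.integral_add intervalIntegrable_const hi,
      intervalIntegral.integral_const, smul_eq_mul] at h1
    unfold avg
    rw [abs_mul, abs_of_pos (one_div_pos.2 two_pi_pos), ← Real.norm_eq_abs (∫ φ in (-π)..π, f η φ),
      one_div_mul_eq_div, div_le_iff₀ two_pi_pos]
    linarith
  -- M is finite because solutions are bounded, so M / 2 can be absorbed on the left.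
  have hMM : M ≤ H + B + 2 * N + M / 2 := by
    refine csSup_le ⟨_, 0, ⟨le_rfl, hL0.le⟩, rfl⟩ ?_
    rintro _ ⟨η, hη, rfl⟩
    exact havg η hη
  intro η hη
  linarith [hMle η hη]

theorem sq_avg_le {f : ℝ → ℝ → ℝ} {η M : ℝ} (hf : Measurable (f η)) (hM : ∀ φ, |f η φ| ≤ M) :
    2 * π * avg f η ^ 2 ≤ ∫ φ in (-π)..π, |f η φ| ^ 2 := by
  have h := sq_intervalIntegral_mul_le (f := fun _ => 1) (g := f η) (a := -π) (b := π) (M := 1)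
    (N := M) (by linarith [pi_pos]) measurable_const hf (by simp) fun φ _ => hM φ
  simp only [one_mul, one_pow, intervalIntegral.integral_const, smul_eq_mul, mul_one,
    sub_neg_eq_add] at h
  simp only [sq_abs]
  unfold avg
  rw [mul_pow, ← mul_assoc]
  have hpi := pi_pos
  rw [show 2 * π * (1 / (2 * π)) ^ 2 = 1 / (2 * π) by field_simp, one_div_mul_eq_div,
    div_le_iff₀ two_pi_pos]
  linarith

/-- The supremum of a solution minus a constant is controlled by the data and the `L²` norm. -/
theorem exists_abs_sub_le : ∃ δ > (0 : ℝ), ∃ C ≥ (1 : ℝ), ∀ R ε L : ℝ, 0 < ε → 0 < L →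
    6 ≤ δ * (R / ε - L) → ∀ (h : ℝ → ℝ) (S f : ℝ → ℝ → ℝ), Measurable (Function.uncurry S) →
      (∀ η, Function.Periodic (S η) (2 * π)) → IsSolution R ε L h S f →
      ∀ H B fL : ℝ, (∀ φ ∈ inflow, |h φ| ≤ H) → (∀ η ∈ Icc 0 L, ∀ φ, |S η φ| ≤ B) →
      ∀ η ∈ Icc 0 L, ∀ φ, ¬ IsGrazing η φ →
        |f η φ - fL| ≤ C * (|fL| + H + B + normL2 L (fun η φ => f η φ - fL)) := by
  obtain ⟨δ, hδ, hmain⟩ := exists_abs_avg_le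
  -- The 3 is one copy of the data from `IsSolution.abs_le` plus the two copies in the bound of the
  -- average.
  refine ⟨δ, hδ, 3 + 4 * √((δ / 2)⁻¹), by linarith [Real.sqrt_nonneg ((δ / 2)⁻¹)], ?_⟩
  intro R ε L hε hL0 h6 h S f hS hSp hf H B fL hH hB η hη φ hg
  have hL : 0 < R / ε - L := by
    by_contra hc
    nlinarith
  have hρ : 0 < R / ε := by linarith
  have hH0 : 0 ≤ H := (abs_nonneg _).trans (hH (π / 2) ⟨⟨by linarith [pi_pos], by linarith [pi_pos]⟩,
    by simp⟩)
  have hB0 : 0 ≤ B := (abs_nonneg _).trans (hB 0 ⟨le_rfl, hL0.le⟩ 0)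
  have hv := hf.sub_const fL
  set v : ℝ → ℝ → ℝ := fun η φ => f η φ - fL with hvdef
  have hH' : ∀ φ ∈ inflow, |h φ - fL| ≤ H + |fL| := fun φ hφ =>
    (abs_sub _ _).trans (add_le_add_left (hH φ hφ) _)
  have h1 := hmain R ε L hε hL0 h6 _ S v hS hSp hv (H + |fL|) B hH' hB
  obtain ⟨M, hM⟩ := hv.bounded
  have hN : ∫ η in (0 : ℝ)..L, avg v η ^ 2 ≤ normL2 L v ^ 2 := by
    have hpi := pi_gt_three
    have hm2 : Measurable fun η => ∫ φ in (-π)..π, |v η φ| ^ 2 :=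
      measurable_intervalIntegral (Φ := fun η φ => |v η φ| ^ 2) (hv.measurable.abs.pow_const 2)
        measurable_const measurable_const
    rw [normL2, Real.sq_sqrt (intervalIntegral.integral_nonneg hL0.le fun η _ =>
      intervalIntegral.integral_nonneg (by linarith) fun φ _ => by positivity)]
    refine intervalIntegral.integral_mono_on hL0.le ?_ ?_ fun η hη => ?_
    · refine intervalIntegrable_of_bdd (M := M ^ 2) ((measurable_avg hv.measurable).pow_const 2)
        hL0.le fun η hη => ?_
      rw [abs_pow]
      exact pow_le_pow_left₀ (abs_nonneg _) (abs_avg_le fun φ _ => hM η hη φ) 2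
    · refine intervalIntegrable_of_bdd (M := M ^ 2 * |π - -π|) hm2 hL0.le fun η hη => ?_
      rw [← Real.norm_eq_abs]
      refine intervalIntegral.norm_integral_le_of_norm_le_const fun φ _ => ?_
      rw [norm_pow, Real.norm_eq_abs, abs_abs]
      exact pow_le_pow_left₀ (abs_nonneg _) (hM η hη φ) 2
    · have := sq_avg_le hv.measurable.of_uncurry_left (hM η hη)
      nlinarith [sq_nonneg (avg v η)]
  have hnn : 0 ≤ normL2 L v := Real.sqrt_nonneg _
  have hsq : √((δ / 2)⁻¹ * ∫ η in (0 : ℝ)..L, avg v η ^ 2) ≤ √((δ / 2)⁻¹) * normL2 L v := by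
    rw [Real.sqrt_mul (by positivity)]
    refine mul_le_mul_of_nonneg_left ?_ (Real.sqrt_nonneg _)
    exact (Real.sqrt_le_left hnn).2 hN
  have hz := inAnnulus_polar hL hη φ
  set K := 2 * (H + |fL| + B + 2 * (√((δ / 2)⁻¹) * normL2 L v)) with hK
  have hK0 : 0 ≤ K := by positivity
  have hKle : ∀ η ∈ Icc 0 L, |avg v η| ≤ K := fun η hη => (h1 η hη).trans (by linarith)
  have h2 := hv.abs_le hε hL0 hL hS hSp hH' hB hη hg
  have h3 := abs_duh_le (h := fun _ => 0) (H := 0) (g := fun _ _ => K) hL (by linarith) hz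
    (sq_lt_of_not_isGrazing hL hη hg) (by simp) (fun _ _ _ _ _ => intervalIntegrable_const)
    (G := radial (R / ε) fun η => |avg v η|) fun u w hz =>
      abs_cart_le_of_inAnnulus hρ (F := fun η _ => |avg v η|)
        (fun η hη _ => by rw [abs_abs]; exact hKle η hη) hz
  have h4 := (le_abs_self _).trans (h3.trans (duh_le_add hL (by linarith) hz le_rfl hK0))
  have h5 : |v η φ| ≤ 3 * (H + |fL| + B) + 4 * √((δ / 2)⁻¹) * normL2 L v := by linarith
  refine h5.trans ?_
  have h6 : 0 ≤ √((δ / 2)⁻¹) * (|fL| + H + B) := by positivity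
  nlinarith [abs_nonneg fL]

end

section

/-! ### Bounded measurable functions -/

/-- Measurable functions that are bounded in the layer. -/
def IsBdd (L : ℝ) (g : ℝ → ℝ → ℝ) : Prop :=
  Measurable (Function.uncurry g) ∧ ∃ M, ∀ η ∈ Icc 0 L, ∀ φ, |g η φ| ≤ M

namespace IsBdd

variable {L : ℝ} {f g : ℝ → ℝ → ℝ} {k : ℝ → ℝ}

theorem add (hf : IsBdd L f) (hg : IsBdd L g) : IsBdd L fun η φ => f η φ + g η φ := by
  obtain ⟨hf, M, hM⟩ := hf
  obtain ⟨hg, N, hN⟩ := hg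
  exact ⟨Measurable.add hf hg, M + N, fun η hη φ =>
    (abs_add_le _ _).trans (add_le_add (hM η hη φ) (hN η hη φ))⟩

theorem sub (hf : IsBdd L f) (hg : IsBdd L g) : IsBdd L fun η φ => f η φ - g η φ := by
  obtain ⟨hf, M, hM⟩ := hf
  obtain ⟨hg, N, hN⟩ := hg
  exact ⟨Measurable.sub hf hg, M + N, fun η hη φ =>
    (abs_sub _ _).trans (add_le_add (hM η hη φ) (hN η hη φ))⟩

theorem mul (hf : IsBdd L f) (hg : IsBdd L g) : IsBdd L fun η φ => f η φ * g η φ := by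
  obtain ⟨hf, M, hM⟩ := hf
  obtain ⟨hg, N, hN⟩ := hg
  refine ⟨Measurable.mul hf hg, M * N, fun η hη φ => ?_⟩
  rw [abs_mul]
  exact mul_le_mul (hM η hη φ) (hN η hη φ) (abs_nonneg _) ((abs_nonneg _).trans (hM η hη φ))

theorem neg (hf : IsBdd L f) : IsBdd L fun η φ => -f η φ := by
  obtain ⟨hf, M, hM⟩ := hf
  exact ⟨Measurable.neg hf, M, fun η hη φ => by rw [abs_neg]; exact hM η hη φ⟩

theorem abs (hf : IsBdd L f) : IsBdd L fun η φ => |f η φ| := by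
  obtain ⟨hf, M, hM⟩ := hf
  exact ⟨Measurable.abs hf, M, fun η hη φ => by rw [abs_abs]; exact hM η hη φ⟩

theorem sq (hf : IsBdd L f) : IsBdd L fun η φ => f η φ ^ 2 := by
  simpa only [_root_.sq] using hf.mul hf

theorem const (L c : ℝ) : IsBdd L fun _ _ => c := ⟨measurable_const, |c|, fun _ _ _ => le_rfl⟩

theorem const_mul (c : ℝ) (hf : IsBdd L f) : IsBdd L fun η φ => c * f η φ := (const L c).mul hf

theorem of_angle (L : ℝ) {w : ℝ → ℝ} (hw : Measurable w) (h : ∀ φ, |w φ| ≤ 1) :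
    IsBdd L fun _ φ => w φ :=
  ⟨hw.comp measurable_snd, 1, fun _ _ φ => h φ⟩

theorem of_monotone_bound {k : ℝ → ℝ} {M : ℝ} (hk : Measurable k)
    (h : ∀ η ∈ Icc 0 L, |k η| ≤ M) : IsBdd L fun η _ => k η :=
  ⟨hk.comp measurable_fst, M, fun η hη _ => h η hη⟩

theorem measurable_fst (hk : IsBdd L fun η _ => k η) : Measurable k :=
  (hk.1.comp (measurable_id.prodMk measurable_const : Measurable fun x : ℝ => (x, (0 : ℝ))))

theorem intervalIntegrable_angle (hf : IsBdd L f) {η : ℝ} (hη : η ∈ Icc 0 L) :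
    IntervalIntegrable (f η) volume (-π) π := by
  obtain ⟨hf, M, hM⟩ := hf
  exact intervalIntegrable_of_bdd hf.of_uncurry_left (by linarith [pi_pos]) fun φ _ => hM η hη φ

theorem intervalIntegrable (hk : IsBdd L fun η _ => k η) {a b : ℝ} (ha : 0 ≤ a) (hab : a ≤ b)
    (hb : b ≤ L) : IntervalIntegrable k volume a b := by
  obtain ⟨M, hM⟩ := hk.2
  exact intervalIntegrable_of_bdd hk.measurable_fst hab
    fun y hy => hM y ⟨ha.trans hy.1, hy.2.trans hb⟩ 0

theorem ang (hf : IsBdd L f) : IsBdd L fun η _ => ∫ φ in (-π)..π, f η φ := by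
  obtain ⟨hf, M, hM⟩ := hf
  refine of_monotone_bound (M := M * |π - -π|)
    (measurable_intervalIntegral hf measurable_const measurable_const) fun η hη => ?_
  rw [← Real.norm_eq_abs]
  exact intervalIntegral.norm_integral_le_of_norm_le_const fun φ _ => hM η hη φ

theorem avg (hf : IsBdd L f) : IsBdd L fun η _ => avg f η := hf.ang.const_mul _

theorem tail (hk : IsBdd L fun η _ => k η) : IsBdd L fun η _ => ∫ y in η..L, k y := by
  obtain ⟨M, hM⟩ := hk.2
  refine of_monotone_bound (M := M * L) (measurable_intervalIntegral
    (Φ := fun _ y => k y) (hk.measurable_fst.comp measurable_snd) measurable_id measurable_const)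
    fun η hη => ?_
  have hM0 : 0 ≤ M := (abs_nonneg _).trans (hM η hη 0)
  have h1 : ‖∫ y in η..L, k y‖ ≤ M * |L - η| := by
    refine intervalIntegral.norm_integral_le_of_norm_le_const fun y hy => ?_
    rw [uIoc_of_le hη.2] at hy
    exact hM y ⟨hη.1.trans hy.1.le, hy.2⟩ 0
  rw [abs_of_nonneg (sub_nonneg.2 hη.2)] at h1
  exact h1.trans (mul_le_mul_of_nonneg_left (by linarith [hη.1]) hM0)

theorem radius {ρ : ℝ} (hL : 0 < ρ - L) : IsBdd L fun η _ => ρ - η :=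
  of_monotone_bound (M := ρ) (by fun_prop) fun η hη => by
    rw [abs_of_nonneg (by linarith [hη.2])]; linarith [hη.1]

theorem inv_radius {ρ : ℝ} (hL : 0 < ρ - L) : IsBdd L fun η _ => (ρ - η)⁻¹ :=
  of_monotone_bound (M := (ρ - L)⁻¹) (by fun_prop) fun η hη => by
    rw [abs_of_nonneg (inv_nonneg.2 (by linarith [hη.2]))]
    exact inv_anti₀ hL (by linarith [hη.2])

end IsBdd

/-! ### Moments of the transport equation -/

/-- The angular integral `∫_{-π}^{π} w(φ) f(η, φ) dφ`. -/
def moment (w : ℝ → ℝ) (f : ℝ → ℝ → ℝ) (η : ℝ) : ℝ := ∫ φ in (-π)..π, w φ * f η φ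

/-- The squared norm of the deviation from the velocity average. -/
def deviation (f : ℝ → ℝ → ℝ) (η : ℝ) : ℝ := ∫ φ in (-π)..π, (f η φ - avg f η) ^ 2

/-- Supplies the energy density f² and the momentum density f sin φ / (ρ - η) to the divergence
theorem. -/
theorem IsTransport.mul {a b : ℝ} {F D G E : ℝ → ℝ → ℝ} (hF : IsTransport a b F D)
    (hG : IsTransport a b G E) (hD : SegIntegrable a b D) (hE : SegIntegrable a b E) :
    IsTransport a b (fun u w => F u w * G u w) fun u w => D u w * G u w + F u w * E u w := by
  intro u w₁ w₂ hw hann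
  have hsub : ∀ x ∈ Icc w₁ w₂, ∀ t ∈ Icc x w₂, a ^ 2 ≤ u ^ 2 + t ^ 2 ∧ u ^ 2 + t ^ 2 ≤ b ^ 2 :=
    fun x hx t ht => hann t ⟨hx.1.trans ht.1, ht.2⟩
  exact mul_sub_mul_eq_integral_of_primitive hw (hD u w₁ w₂ hw hann) (hE u w₁ w₂ hw hann)
    (fun x hx => by linarith [hF u x w₂ hx.2 (hsub x hx)])
    (fun x hx => by linarith [hG u x w₂ hx.2 (hsub x hx)])

theorem cart_sin_div (ρ u w : ℝ) :
    cart ρ (fun η φ => sin φ * (ρ - η)⁻¹) u w = w / (u ^ 2 + w ^ 2) := by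
  simp only [cart]
  rw [sin_arg_mk, sub_sub_cancel, ← div_eq_mul_inv, div_div, Real.mul_self_sqrt (by positivity)]

theorem cart_cos_div {ρ u w : ℝ} (h : 0 < u ^ 2 + w ^ 2) :
    cart ρ (fun η φ => -(cos (2 * φ) * ((ρ - η)⁻¹ * (ρ - η)⁻¹))) u w =
      -((u ^ 2 - w ^ 2) / (u ^ 2 + w ^ 2) ^ 2) := by
  simp only [cart]
  rw [cos_two_mul, cos_arg_mk h, sub_sub_cancel, ← mul_inv, Real.mul_self_sqrt h.le, div_pow,
    Real.sq_sqrt h.le]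
  field_simp
  ring

/-- The weight w / |z|² turns the flux r ∫ sin φ (·) into the plain momentum ∫ sin²φ f. Its
derivative is proportional to cos 2φ, which has mean zero, so the curvature acts only on f - f̄. -/
theorem isTransport_sin_div {a ρ : ℝ} (ha : 0 < a) :
    IsTransport a ρ (cart ρ fun η φ => sin φ * (ρ - η)⁻¹)
      (cart ρ fun η φ => -(cos (2 * φ) * ((ρ - η)⁻¹ * (ρ - η)⁻¹))) := by
  intro u w₁ w₂ hw hann
  have hpos : ∀ t ∈ Icc w₁ w₂, 0 < u ^ 2 + t ^ 2 := fun t ht =>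
    lt_of_lt_of_le (by positivity) (hann t ht).1
  rw [cart_sin_div, cart_sin_div]
  have hd : ∀ t ∈ uIcc w₁ w₂, HasDerivAt (fun t => -(t / (u ^ 2 + t ^ 2)))
      (-((u ^ 2 - t ^ 2) / (u ^ 2 + t ^ 2) ^ 2)) t := by
    intro t ht
    rw [uIcc_of_le hw] at ht
    have h1 : HasDerivAt (fun t => u ^ 2 + t ^ 2) (2 * t) t := by
      simpa using ((hasDerivAt_id t).pow 2).const_add (u ^ 2)
    refine ((hasDerivAt_id t).div h1 (hpos t ht).ne').neg.congr_deriv ?_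
    simp only [id]
    ring
  have hc : ContinuousOn (fun t => -((u ^ 2 - t ^ 2) / (u ^ 2 + t ^ 2) ^ 2)) (uIcc w₁ w₂) := by
    rw [uIcc_of_le hw]
    exact (ContinuousOn.div (by fun_prop) (by fun_prop)
      fun t ht => (pow_pos (hpos t ht) 2).ne').neg
  rw [intervalIntegral.integral_congr (g := fun t => -((u ^ 2 - t ^ 2) / (u ^ 2 + t ^ 2) ^ 2)),
    intervalIntegral.integral_eq_sub_of_hasDerivAt hd hc.intervalIntegrable]
  · ring
  · intro t ht
    rw [uIcc_of_le hw] at ht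
    exact cart_cos_div (hpos t ht)

theorem IsBdd.segIntegrable {ρ L : ℝ} (hρ : 0 < ρ) {F : ℝ → ℝ → ℝ} (hF : IsBdd L F) :
    SegIntegrable (ρ - L) ρ (cart ρ F) := segIntegrable_cart hρ hF.1 hF.2

/-! ### Balances of mass, energy and momentum. -/

theorem IsBdd.flux {ρ L η : ℝ} (hL : 0 < ρ - L) (hη : η ∈ Icc 0 L) {F D : ℝ → ℝ → ℝ}
    (hF : IsBdd L F) (hFp : ∀ η, Function.Periodic (F η) (2 * π)) (hD : IsBdd L D)
    (hT : IsTransport (ρ - L) ρ (cart ρ F) (cart ρ D)) :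
    (ρ - η) * moment sin F η - (ρ - L) * moment sin F L =
      -∫ y in η..L, (ρ - y) * ∫ φ in (-π)..π, D y φ := by
  obtain ⟨hF, M, hM⟩ := hF
  obtain ⟨hD, N, hN⟩ := hD
  exact flux_sub_flux (M := max M N) hL hη hF hFp
    (fun η hη φ => (hM η hη φ).trans (le_max_left _ _)) hD
    (fun η hη φ => (hN η hη φ).trans (le_max_right _ _)) hT

/-- Specular reflection kills the mass and energy fluxes at η = L. -/
theorem moment_sin_eq_zero_of_even {F : ℝ → ℝ → ℝ} {η : ℝ} (h : ∀ φ, F η φ = F η (-φ)) :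
    moment sin F η = 0 := by
  have h1 := intervalIntegral.integral_comp_neg (a := -π) (b := π) fun φ => sin φ * F η φ
  rw [neg_neg] at h1
  have h2 : ∫ φ in (-π)..π, sin (-φ) * F η (-φ) = -moment sin F η := by
    rw [moment, ← intervalIntegral.integral_neg]
    refine intervalIntegral.integral_congr fun φ _ => ?_
    simp only [sin_neg, ← h φ]
    ring
  rw [h2] at h1
  unfold moment at h1 ⊢
  linarith

theorem integral_eq_avg (f : ℝ → ℝ → ℝ) (η : ℝ) : ∫ φ in (-π)..π, f η φ = 2 * π * avg f η := by
  unfold avg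
  field_simp [pi_ne_zero]

variable {R ε L : ℝ} {h : ℝ → ℝ} {S f : ℝ → ℝ → ℝ}

theorem IsSolution.isBdd (hf : IsSolution R ε L h S f) : IsBdd L f := ⟨hf.measurable, hf.bounded⟩

theorem IsSolution.isBdd_collision (hf : IsSolution R ε L h S f) (hS : IsBdd L S) :
    IsBdd L fun η φ => avg f η - f η φ + S η φ := (hf.isBdd.avg.sub hf.isBdd).add hS

/-- Conservation of mass. -/
theorem IsSolution.flux_mass (hε : 0 < ε) (hL0 : 0 < L) (hL : 0 < R / ε - L) (hS : IsBdd L S)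
    (hSp : ∀ η, Function.Periodic (S η) (2 * π)) (hf : IsSolution R ε L h S f) {η : ℝ}
    (hη : η ∈ Icc 0 L) :
    (R / ε - η) * moment sin f η = -∫ y in η..L, (R / ε - y) * (2 * π * srcQ S y) := by
  have h1 := hf.isBdd.flux hL hη hf.periodic (hf.isBdd_collision hS)
    (hf.isTransport hε hL (by linarith) hSp)
  rw [moment_sin_eq_zero_of_even hf.specular_bc, mul_zero, sub_zero] at h1
  rw [h1, neg_inj]
  refine intervalIntegral.integral_congr fun y hy => ?_
  rw [uIcc_of_le hη.2] at hy
  have hy' : y ∈ Icc 0 L := ⟨hη.1.trans hy.1, hy.2⟩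
  have hi := hf.isBdd.intervalIntegrable_angle hy'
  rw [intervalIntegral.integral_add (intervalIntegrable_const.sub hi)
    (hS.intervalIntegrable_angle hy'), intervalIntegral.integral_sub intervalIntegrable_const hi,
    intervalIntegral.integral_const, integral_eq_avg, integral_eq_avg, smul_eq_mul, srcQ]
  ring

theorem integral_sub_avg {η : ℝ} (hi : IntervalIntegrable (f η) volume (-π) π) :
    ∫ φ in (-π)..π, (f η φ - avg f η) = 0 := by
  rw [intervalIntegral.integral_sub hi intervalIntegrable_const,
    intervalIntegral.integral_const, integral_eq_avg, smul_eq_mul]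
  ring

/-- Conservation of energy. -/
theorem IsSolution.flux_energy (hε : 0 < ε) (hL0 : 0 < L) (hL : 0 < R / ε - L) (hS : IsBdd L S)
    (hSp : ∀ η, Function.Periodic (S η) (2 * π)) (hf : IsSolution R ε L h S f) :
    R / ε * moment sin (fun η φ => f η φ * f η φ) 0 =
      ∫ y in (0 : ℝ)..L, (R / ε - y) * (2 * deviation f y -
        2 * (∫ φ in (-π)..π, (f y φ - avg f y) * S y φ) - 4 * π * (avg f y * srcQ S y)) := by
  have hρ : 0 < R / ε := by linarith
  have hD := hf.isBdd_collision hS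
  have hT := hf.isTransport hε hL hρ hSp
  have hT2 := hT.mul hT (hD.segIntegrable hρ) (hD.segIntegrable hρ)
  have h1 := (hf.isBdd.mul hf.isBdd).flux hL ⟨le_rfl, hL0.le⟩
    (fun η φ => by simp only [hf.periodic η φ]) ((hD.mul hf.isBdd).add (hf.isBdd.mul hD)) hT2
  have h2 : moment sin (fun η φ => f η φ * f η φ) L = 0 :=
    moment_sin_eq_zero_of_even fun φ => by rw [← hf.specular_bc φ]
  rw [h2, mul_zero, sub_zero, sub_zero] at h1
  rw [h1, ← intervalIntegral.integral_neg]
  refine intervalIntegral.integral_congr fun y hy => ?_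
  rw [uIcc_of_le hL0.le] at hy
  have hi := hf.isBdd.intervalIntegrable_angle hy
  have hq : IsBdd L fun η φ => f η φ - avg f η := hf.isBdd.sub hf.isBdd.avg
  have i1 := hq.sq.intervalIntegrable_angle hy
  have i2 := (hq.mul hS).intervalIntegrable_angle hy
  have i3 := hq.intervalIntegrable_angle hy
  have i4 := hS.intervalIntegrable_angle hy
  -- Written around the average: the term linear in f - f̄ integrates to zero, and f̄ survives only
  -- against the mean of the source.
  have hpt : ∀ φ, (avg f y - f y φ + S y φ) * f y φ + f y φ * (avg f y - f y φ + S y φ) =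
      (-2) * (f y φ - avg f y) ^ 2 + 2 * ((f y φ - avg f y) * S y φ) +
        ((-2 * avg f y) * (f y φ - avg f y) + (2 * avg f y) * S y φ) := fun φ => by ring
  simp only [hpt]
  rw [intervalIntegral.integral_add ((i1.const_mul _).add (i2.const_mul _))
    ((i3.const_mul _).add (i4.const_mul _)),
    intervalIntegral.integral_add (i1.const_mul _) (i2.const_mul _),
    intervalIntegral.integral_add (i3.const_mul _) (i4.const_mul _)]
  simp only [intervalIntegral.integral_const_mul]
  rw [integral_sub_avg hi, integral_eq_avg S]
  unfold deviation srcQ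
  ring

theorem abs_cos_two_mul_le (φ : ℝ) : |cos (2 * φ)| ≤ 1 := abs_cos_le_one _

theorem abs_sin_sq_le (φ : ℝ) : |sin φ ^ 2| ≤ 1 := by
  rw [abs_pow]; exact pow_le_one₀ (abs_nonneg _) (abs_sin_le_one φ)

theorem IsBdd.moment {w : ℝ → ℝ} (hf : IsBdd L f) (hw : Measurable w) (h : ∀ φ, |w φ| ≤ 1) :
    IsBdd L fun η _ => moment w f η := ((IsBdd.of_angle L hw h).mul hf).ang

/-- Conservation of momentum. -/
theorem IsSolution.flux_momentum (hε : 0 < ε) (hL : 0 < R / ε - L) (hS : IsBdd L S)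
    (hSp : ∀ η, Function.Periodic (S η) (2 * π)) (hf : IsSolution R ε L h S f) {η : ℝ}
    (hη : η ∈ Icc 0 L) :
    moment (fun φ => sin φ ^ 2) f η - moment (fun φ => sin φ ^ 2) f L =
      -∫ y in η..L, (moment sin S y - moment sin f y -
        (R / ε - y)⁻¹ * moment (fun φ => cos (2 * φ)) f y) := by
  set ρ := R / ε with hρdef
  have hρ : 0 < ρ := by linarith [hη.1, hη.2]
  have hD := hf.isBdd_collision hS
  have hT := hf.isTransport hε hL hρ hSp
  have hs : IsBdd L fun η φ => sin φ * (ρ - η)⁻¹ :=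
    (IsBdd.of_angle L measurable_sin abs_sin_le_one).mul (IsBdd.inv_radius hL)
  have hc : IsBdd L fun η φ => -(cos (2 * φ) * ((ρ - η)⁻¹ * (ρ - η)⁻¹)) :=
    ((IsBdd.of_angle L (by fun_prop) abs_cos_two_mul_le).mul
      ((IsBdd.inv_radius hL).mul (IsBdd.inv_radius hL))).neg
  have hT2 := hT.mul (isTransport_sin_div hL) (hD.segIntegrable hρ) (hc.segIntegrable hρ)
  have h1 := (hf.isBdd.mul hs).flux hL hη
    (fun η φ => by simp only [hf.periodic η φ, sin_add_two_pi])
    ((hD.mul hs).add (hf.isBdd.mul hc)) hT2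
  -- The radius in the flux cancels the inverse radius in the weight.
  have hm : ∀ y ∈ Icc 0 L, (ρ - y) * moment sin (fun η φ => f η φ * (sin φ * (ρ - η)⁻¹)) y =
      moment (fun φ => sin φ ^ 2) f y := by
    intro y hy
    have hr : ρ - y ≠ 0 := by have := hy.2; intro h; linarith
    unfold moment
    rw [← intervalIntegral.integral_const_mul]
    refine intervalIntegral.integral_congr fun φ _ => ?_
    simp only
    field_simp
  rw [hm η hη, hm L ⟨hη.1.trans hη.2, le_rfl⟩] at h1
  rw [h1, neg_inj]
  refine intervalIntegral.integral_congr fun y hy => ?_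
  rw [uIcc_of_le hη.2] at hy
  have hy' : y ∈ Icc 0 L := ⟨hη.1.trans hy.1, hy.2⟩
  have hr : ρ - y ≠ 0 := by have := hy.2; intro h; linarith
  have bs := IsBdd.of_angle L measurable_sin abs_sin_le_one
  have i1 := (bs.mul hS).intervalIntegrable_angle hy'
  have i2 := (bs.mul hf.isBdd).intervalIntegrable_angle hy'
  have i3 := ((IsBdd.of_angle L (by fun_prop) abs_cos_two_mul_le).mul
    hf.isBdd).intervalIntegrable_angle hy'
  have i4 := bs.intervalIntegrable_angle hy'
  have hpt : ∀ φ, (avg f y - f y φ + S y φ) * (sin φ * (ρ - y)⁻¹) +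
      f y φ * -(cos (2 * φ) * ((ρ - y)⁻¹ * (ρ - y)⁻¹)) =
      ((ρ - y)⁻¹ * (sin φ * S y φ) + (-(ρ - y)⁻¹) * (sin φ * f y φ)) +
        ((-((ρ - y)⁻¹ * (ρ - y)⁻¹)) * (cos (2 * φ) * f y φ) +
          (avg f y * (ρ - y)⁻¹) * sin φ) := fun φ => by ring
  simp only [hpt]
  rw [intervalIntegral.integral_add ((i1.const_mul _).add (i2.const_mul _))
    ((i3.const_mul _).add (i4.const_mul _)),
    intervalIntegral.integral_add (i1.const_mul _) (i2.const_mul _),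
    intervalIntegral.integral_add (i3.const_mul _) (i4.const_mul _)]
  simp only [intervalIntegral.integral_const_mul]
  rw [integral_sin, cos_neg, sub_self]
  unfold moment
  field_simp
  ring

/-! ### Bounds of the moments -/

theorem integral_sin_sq_pi : ∫ φ in (-π)..π, sin φ ^ 2 = π := by
  rw [integral_sin_sq]
  simp

/-- By this vanishing mean, the cos 2φ moment of f equals that of f - f̄. -/
theorem integral_cos_two_mul_pi : ∫ φ in (-π)..π, cos (2 * φ) = 0 := by
  rw [intervalIntegral.integral_comp_mul_left (f := cos) two_ne_zero, integral_cos]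
  simp [sin_two_mul]

theorem moment_sub_avg {w : ℝ → ℝ} (hf : IsBdd L f) (hw : Measurable w) (hw1 : ∀ φ, |w φ| ≤ 1)
    {η : ℝ} (hη : η ∈ Icc 0 L) : moment w (fun η φ => f η φ - avg f η) η =
      moment w f η - avg f η * ∫ φ in (-π)..π, w φ := by
  have bw := IsBdd.of_angle L hw hw1
  unfold moment
  simp only [mul_sub]
  rw [intervalIntegral.integral_sub ((bw.mul hf).intervalIntegrable_angle hη)
    ((bw.intervalIntegrable_angle hη).mul_const _), intervalIntegral.integral_mul_const]
  ring

theorem sq_moment_le {w : ℝ → ℝ} {g : ℝ → ℝ → ℝ} (hg : IsBdd L g) (hw : Measurable w)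
    (hw1 : ∀ φ, |w φ| ≤ 1) {η : ℝ} (hη : η ∈ Icc 0 L) :
    moment w g η ^ 2 ≤ 2 * π * ∫ φ in (-π)..π, g η φ ^ 2 := by
  have hpi : -π ≤ π := by linarith [pi_pos]
  obtain ⟨M, hM⟩ := hg.2
  have h := sq_intervalIntegral_mul_le (f := w) (g := g η) (M := 1) (N := M) hpi hw
    hg.1.of_uncurry_left (fun φ _ => hw1 φ) fun φ _ => hM η hη φ
  have h1 : ∫ φ in (-π)..π, w φ ^ 2 ≤ 2 * π := by
    have h2 := intervalIntegral.integral_mono_on hpi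
      ((IsBdd.of_angle L hw hw1).sq.intervalIntegrable_angle hη)
      (intervalIntegrable_const (c := (1 : ℝ))) fun φ _ => by
        rw [← sq_abs]; exact pow_le_one₀ (abs_nonneg _) (hw1 φ)
    rw [intervalIntegral.integral_const, smul_eq_mul] at h2
    linarith
  exact h.trans (mul_le_mul_of_nonneg_right h1
    (intervalIntegral.integral_nonneg hpi fun φ _ => sq_nonneg _))

/-- The mean of the source drops out because sin has mean zero. -/
theorem sinPair_srcR (hS : IsBdd L S) {η : ℝ} (hη : η ∈ Icc 0 L) :
    sinPair (srcR S) η = moment sin S η := by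
  have := moment_sub_avg hS measurable_sin abs_sin_le_one hη
  rw [integral_sin, cos_neg, sub_self, mul_zero, sub_zero] at this
  exact this

end

section

/-! ### The energy estimate -/

variable {R ε L : ℝ} {h : ℝ → ℝ} {S f : ℝ → ℝ → ℝ}

/-- Integration by parts of mass against momentum. -/
theorem IsSolution.integral_srcQ_mul_momentum (hε : 0 < ε) (hL0 : 0 < L) (hL : 0 < R / ε - L)
    (hS : IsBdd L S) (hSp : ∀ η, Function.Periodic (S η) (2 * π)) (hf : IsSolution R ε L h S f) :
    ∫ y in (0 : ℝ)..L, (2 * π * ((R / ε - y) * srcQ S y * moment (fun φ => sin φ ^ 2) f y) +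
      (R / ε - y) * moment sin f y * (moment sin S y - moment sin f y -
        (R / ε - y)⁻¹ * moment (fun φ => cos (2 * φ)) f y)) =
      -(R / ε * moment sin f 0 * moment (fun φ => sin φ ^ 2) f 0) := by
  set ρ := R / ε with hρ
  have hr : IsBdd L fun η _ => ρ - η := IsBdd.radius hL
  have hQ : IsBdd L fun η _ => srcQ S η := hS.avg
  have hU : IsBdd L fun y _ => -((ρ - y) * (2 * π * srcQ S y)) := (hr.mul (hQ.const_mul _)).neg
  have hm : IsBdd L fun η _ => moment sin f η := hf.isBdd.moment measurable_sin abs_sin_le_one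
  have hσ : IsBdd L fun η _ => moment sin S η := hS.moment measurable_sin abs_sin_le_one
  have hc : IsBdd L fun η _ => moment (fun φ => cos (2 * φ)) f η :=
    hf.isBdd.moment (by fun_prop) abs_cos_two_mul_le
  have hV : IsBdd L fun y _ => -(moment sin S y - moment sin f y -
      (ρ - y)⁻¹ * moment (fun φ => cos (2 * φ)) f y) :=
    ((hσ.sub hm).sub ((IsBdd.inv_radius hL).mul hc)).neg
  have hL1 : L ∈ Icc 0 L := ⟨hL0.le, le_rfl⟩
  -- Product rule for the mass flux and the momentum. The boundary term at L vanishes with the mass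
  -- flux.
  have h1 := mul_sub_mul_eq_integral_of_primitive (u := fun y => (ρ - y) * moment sin f y)
    (v := fun y => moment (fun φ => sin φ ^ 2) f y) hL0.le
    (hU.intervalIntegrable le_rfl hL0.le le_rfl) (hV.intervalIntegrable le_rfl hL0.le le_rfl)
    (fun x hx => by
      rw [hf.flux_mass hε hL0 hL hS hSp hx, hf.flux_mass hε hL0 hL hS hSp hL1,
        intervalIntegral.integral_same, intervalIntegral.integral_neg]
      ring)
    (fun x hx => by
      have := hf.flux_momentum hε hL hS hSp hx
      rw [intervalIntegral.integral_neg, ← this]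
      ring)
  have h2 : (ρ - L) * moment sin f L = 0 := by
    rw [hf.flux_mass hε hL0 hL hS hSp hL1, intervalIntegral.integral_same, neg_zero]
  rw [h2, zero_mul, sub_zero, sub_zero] at h1
  rw [h1, ← intervalIntegral.integral_neg]
  refine intervalIntegral.integral_congr fun y _ => ?_
  ring

theorem measurableSet_inflow : MeasurableSet inflow := by
  have : inflow = Ico (-π) π ∩ sin ⁻¹' Ioi 0 := by
    ext φ; simp [inflow]
  rw [this]
  exact measurableSet_Ico.inter (measurable_sin measurableSet_Ioi)

theorem sq_inflowNormL2 (h : ℝ → ℝ) :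
    inflowNormL2 h ^ 2 = ∫ φ in inflow, |h φ| ^ 2 * sin φ := by
  rw [inflowNormL2, Real.sq_sqrt]
  exact setIntegral_nonneg measurableSet_inflow fun φ hφ => mul_nonneg (by positivity) hφ.2.le

/-- The energy flux at `η = 0` is the difference of the inflow and the outflow. -/
theorem IsSolution.energy_flux_zero (hL0 : 0 < L) (hf : IsSolution R ε L h S f) :
    moment sin (fun η φ => f η φ * f η φ) 0 =
      2 * inflowNormL2 h ^ 2 - ∫ φ in (-π)..π, |sin φ| * f 0 φ ^ 2 := by
  have h0 : (0 : ℝ) ∈ Icc 0 L := ⟨le_rfl, hL0.le⟩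
  have hpi : -π ≤ π := by linarith [pi_pos]
  have i1 := ((IsBdd.of_angle L measurable_sin abs_sin_le_one).mul
    (hf.isBdd.mul hf.isBdd)).intervalIntegrable_angle h0
  have i2 := ((IsBdd.of_angle L measurable_sin abs_sin_le_one).abs.mul
    hf.isBdd.sq).intervalIntegrable_angle h0
  -- The positive part of sin is (sin + |sin|) / 2.
  have hin : ∫ φ in inflow, |h φ| ^ 2 * sin φ =
      ∫ φ in (-π)..π, (1 / 2) * (sin φ * (f 0 φ * f 0 φ) + |sin φ| * f 0 φ ^ 2) := by
    have hsub : inflow = Ico (-π) π ∩ inflow := by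
      rw [inter_eq_right.2]
      exact fun φ hφ => hφ.1
    rw [intervalIntegral.integral_of_le hpi, integral_Ioc_eq_integral_Ioo,
      ← integral_Ico_eq_integral_Ioo, hsub, ← setIntegral_indicator measurableSet_inflow]
    refine setIntegral_congr_fun measurableSet_Ico fun φ hφ => ?_
    by_cases hs : 0 < sin φ
    · have hφi : φ ∈ inflow := ⟨hφ, hs⟩
      rw [indicator_of_mem hφi, abs_of_pos hs, hf.inflow_bc φ hφi, sq_abs]
      ring
    · have hφi : φ ∉ inflow := fun hc => hs hc.2
      rw [indicator_of_notMem hφi, abs_of_nonpos (not_lt.1 hs)]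
      ring
  rw [sq_inflowNormL2, hin, intervalIntegral.integral_const_mul,
    intervalIntegral.integral_add i1 i2]
  unfold moment
  ring

theorem deviation_nonneg (f : ℝ → ℝ → ℝ) (η : ℝ) : 0 ≤ deviation f η :=
  intervalIntegral.integral_nonneg (by linarith [pi_pos]) fun _ _ => sq_nonneg _

/-- Here t = 1/π, P is the deviation, e and c are moments of f - f̄, and s = ∫ S². Completing
squares lets the terms with X, e and c each cost P / 4. The terms in m² sum to 11 t m², and 11 / π ≤
4. -/
theorem energy_density_bound {r P X Q e m σ c s t : ℝ} (hr : 1 ≤ r) (ht0 : 0 < t)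
    (ht : t * π = 1) (hX : 2 * X ≤ P / 4 + 4 * s) (he : e ^ 2 ≤ 2 * π * P)
    (hc : c ^ 2 ≤ 2 * π * P) (hσ : σ ^ 2 ≤ 2 * π * s) (hQ : 2 * π * Q ^ 2 ≤ s) :
    5 / 4 * P - 22 * s - 4 * m ^ 2 ≤
      2 * P - 2 * X + 4 * Q * e + 2 * t * (m * (σ - m - r⁻¹ * c)) := by
  have k1 : t * (e + 16 * π * Q) ^ 2 = t * e ^ 2 + 32 * e * Q + 256 * π * Q ^ 2 := by
    linear_combination (32 * e * Q + 256 * π * Q ^ 2) * ht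
  have k1' : 0 ≤ t * (e + 16 * π * Q) ^ 2 := by positivity
  have te : t * e ^ 2 ≤ 2 * P := by
    calc t * e ^ 2 ≤ t * (2 * π * P) := by gcongr
      _ = 2 * P := by linear_combination 2 * P * ht
  have tc : t * c ^ 2 ≤ 2 * P := by
    calc t * c ^ 2 ≤ t * (2 * π * P) := by gcongr
      _ = 2 * P := by linear_combination 2 * P * ht
  have tσ : t * σ ^ 2 ≤ 2 * s := by
    calc t * σ ^ 2 ≤ t * (2 * π * s) := by gcongr
      _ = 2 * s := by linear_combination 2 * s * ht
  have hr' : r⁻¹ ^ 2 ≤ 1 := pow_le_one₀ (by positivity) (inv_le_one_of_one_le₀ hr)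
  have k2 : t * (r⁻¹ * c) ^ 2 ≤ 2 * P := by
    have : (r⁻¹ * c) ^ 2 ≤ c ^ 2 := by
      rw [mul_pow]; exact mul_le_of_le_one_left (sq_nonneg c) hr'
    exact (mul_le_mul_of_nonneg_left this ht0.le).trans tc
  have k3 : 0 ≤ t * (m + σ) ^ 2 := by positivity
  have k4 : 0 ≤ t * (r⁻¹ * c - 8 * m) ^ 2 := by positivity
  have ht4 : 11 * t ≤ 4 := by nlinarith [pi_gt_three]
  have k5 : 11 * t * m ^ 2 ≤ 4 * m ^ 2 := mul_le_mul_of_nonneg_right ht4 (sq_nonneg m)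
  nlinarith

/-- Cauchy–Schwarz with sin⁴ ≤ |sin|. It lets the boundary term at η = 0 be absorbed by the boundary
energy. -/
theorem IsSolution.sq_momentum_zero_le (hL0 : 0 < L) (hf : IsSolution R ε L h S f) :
    moment (fun φ => sin φ ^ 2) f 0 ^ 2 ≤ 2 * π * ∫ φ in (-π)..π, |sin φ| * f 0 φ ^ 2 := by
  have hpi : -π ≤ π := by linarith [pi_pos]
  have h0 : (0 : ℝ) ∈ Icc 0 L := ⟨le_rfl, hL0.le⟩
  have hg : IsBdd L fun η φ => sin φ ^ 2 * f η φ :=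
    (IsBdd.of_angle L (by fun_prop) abs_sin_sq_le).mul hf.isBdd
  have h1 := sq_moment_le (w := fun _ => 1) hg measurable_const (by simp) h0
  have h2 : moment (fun _ => 1) (fun η φ => sin φ ^ 2 * f η φ) 0 =
      moment (fun φ => sin φ ^ 2) f 0 := by
    simp only [moment, one_mul]
  rw [h2] at h1
  refine h1.trans (mul_le_mul_of_nonneg_left ?_ (by positivity))
  refine intervalIntegral.integral_mono_on hpi (hg.sq.intervalIntegrable_angle h0)
    (((IsBdd.of_angle L measurable_sin abs_sin_le_one).abs.mul
      hf.isBdd.sq).intervalIntegrable_angle h0) fun φ _ => ?_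
  rw [mul_pow]
  refine mul_le_mul_of_nonneg_right ?_ (sq_nonneg _)
  have h3 := abs_sin_le_one φ
  have h4 := abs_nonneg (sin φ)
  rw [← sq_abs (sin φ)]
  have h5 : |sin φ| ^ 2 ≤ 1 := pow_le_one₀ h4 h3
  nlinarith

/-- The energy estimate. -/
theorem IsSolution.energy_le (hε : 0 < ε) (hL1 : 1 ≤ L) (hL2 : 2 * L ≤ R / ε) (hS : IsBdd L S)
    (hSp : ∀ η, Function.Periodic (S η) (2 * π)) (hf : IsSolution R ε L h S f) :
    (∫ φ in (-π)..π, |sin φ| * f 0 φ ^ 2) + ∫ y in (0 : ℝ)..L, deviation f y ≤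
      4 * inflowNormL2 h ^ 2 + 44 * (∫ y in (0 : ℝ)..L, ∫ φ in (-π)..π, S y φ ^ 2) +
        8 * (∫ y in (0 : ℝ)..L, moment sin f y ^ 2) + 4 * moment sin f 0 ^ 2 := by
  have hL0 : 0 < L := by linarith
  have hL : 0 < R / ε - L := by linarith
  set ρ := R / ε with hρdef
  have hρ : 0 < ρ := by linarith
  have h0 : (0 : ℝ) ∈ Icc 0 L := ⟨le_rfl, hL0.le⟩
  have hpi : -π ≤ π := by linarith [pi_pos]
  set t := π⁻¹ with ht
  have ht0 : 0 < t := inv_pos.2 pi_pos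
  have htπ : t * π = 1 := inv_mul_cancel₀ pi_ne_zero
  set W := ∫ φ in (-π)..π, |sin φ| * f 0 φ ^ 2 with hW
  set m := moment sin f with hm
  set β := moment (fun φ => sin φ ^ 2) f with hβ
  set c := moment (fun φ => cos (2 * φ)) f with hc
  set σ := moment sin S with hσ
  set s := fun y => ∫ φ in (-π)..π, S y φ ^ 2 with hs
  have hs2 : Measurable fun φ : ℝ => sin φ ^ 2 := by fun_prop
  have hc2 : Measurable fun φ : ℝ => cos (2 * φ) := by fun_prop
  have bq : IsBdd L fun η φ => f η φ - avg f η := hf.isBdd.sub hf.isBdd.avg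
  have bm : IsBdd L fun η _ => m η := hf.isBdd.moment measurable_sin abs_sin_le_one
  have bσ : IsBdd L fun η _ => σ η := hS.moment measurable_sin abs_sin_le_one
  have bc : IsBdd L fun η _ => c η := hf.isBdd.moment hc2 abs_cos_two_mul_le
  have bβ : IsBdd L fun η _ => β η := hf.isBdd.moment hs2 abs_sin_sq_le
  have bQ : IsBdd L fun η _ => srcQ S η := hS.avg
  have br : IsBdd L fun η _ => ρ - η := IsBdd.radius hL
  have bi : IsBdd L fun η _ => (ρ - η)⁻¹ := IsBdd.inv_radius hL
  have bP : IsBdd L fun η _ => deviation f η := bq.sq.ang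
  have bs : IsBdd L fun η _ => s η := hS.sq.ang
  have bX : IsBdd L fun η _ => ∫ φ in (-π)..π, (f η φ - avg f η) * S η φ := (bq.mul hS).ang
  set X := fun y => ∫ φ in (-π)..π, (f y φ - avg f y) * S y φ with hXdef
  have hE := hf.flux_energy hε hL0 hL hS hSp
  rw [hf.energy_flux_zero hL0] at hE
  have hI := hf.integral_srcQ_mul_momentum hε hL0 hL hS hSp
  -- add the two identities
  have hsum : ρ * (2 * inflowNormL2 h ^ 2 - W) - 2 * t * (ρ * m 0 * β 0) =
      ∫ y in (0 : ℝ)..L, ((ρ - y) * (2 * deviation f y - 2 * X y -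
        4 * π * (avg f y * srcQ S y)) + 2 * t * (2 * π * ((ρ - y) * srcQ S y * β y) +
          (ρ - y) * m y * (σ y - m y - (ρ - y)⁻¹ * c y))) := by
    have b1 : IsBdd L fun y _ => (ρ - y) * (2 * deviation f y - 2 * X y -
        4 * π * (avg f y * srcQ S y)) :=
      br.mul (((bP.const_mul 2).sub (bX.const_mul 2)).sub ((hf.isBdd.avg.mul bQ).const_mul (4 * π)))
    have b2 : IsBdd L fun y _ => 2 * π * ((ρ - y) * srcQ S y * β y) +
          (ρ - y) * m y * (σ y - m y - (ρ - y)⁻¹ * c y) :=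
      (((br.mul bQ).mul bβ).const_mul (2 * π)).add ((br.mul bm).mul ((bσ.sub bm).sub (bi.mul bc)))
    rw [intervalIntegral.integral_add (b1.intervalIntegrable le_rfl hL0.le le_rfl)
      ((b2.intervalIntegrable le_rfl hL0.le le_rfl).const_mul _),
      intervalIntegral.integral_const_mul, hI, ← hE]
    ring
  -- the integrand is bounded below
  have hlow : ∫ y in (0 : ℝ)..L, ρ * (5 / 8 * deviation f y - 22 * s y - 4 * m y ^ 2) ≤
      ρ * (2 * inflowNormL2 h ^ 2 - W) - 2 * t * (ρ * m 0 * β 0) := by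
    rw [hsum]
    have b1 : IsBdd L fun y _ => ρ * (5 / 8 * deviation f y - 22 * s y - 4 * m y ^ 2) :=
      (((bP.const_mul _).sub (bs.const_mul _)).sub (bm.sq.const_mul _)).const_mul _
    have b2 : IsBdd L fun y _ => (ρ - y) * (2 * deviation f y - 2 * X y -
        4 * π * (avg f y * srcQ S y)) + 2 * t * (2 * π * ((ρ - y) * srcQ S y * β y) +
          (ρ - y) * m y * (σ y - m y - (ρ - y)⁻¹ * c y)) :=
      (br.mul (((bP.const_mul 2).sub (bX.const_mul 2)).sub
        ((hf.isBdd.avg.mul bQ).const_mul (4 * π)))).add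
        (((((br.mul bQ).mul bβ).const_mul (2 * π)).add
          ((br.mul bm).mul ((bσ.sub bm).sub (bi.mul bc)))).const_mul (2 * t))
    refine intervalIntegral.integral_mono_on hL0.le (b1.intervalIntegrable le_rfl hL0.le le_rfl)
      (b2.intervalIntegrable le_rfl hL0.le le_rfl) fun y hy => ?_
    have hr1 : 1 ≤ ρ - y := by linarith [hy.2]
    have hr2 : ρ / 2 ≤ ρ - y := by linarith [hy.2]
    have hr3 : ρ - y ≤ ρ := by linarith [hy.1]
    have hP0 := deviation_nonneg f y
    have hs0 : 0 ≤ s y := intervalIntegral.integral_nonneg hpi fun _ _ => sq_nonneg _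
    have hX : 2 * X y ≤ deviation f y / 4 + 4 * s y := by
      have i1 := bq.sq.intervalIntegrable_angle hy
      have i2 := hS.sq.intervalIntegrable_angle hy
      have i3 := (bq.mul hS).intervalIntegrable_angle hy
      have h1 := intervalIntegral.integral_mono_on hpi (i3.const_mul 2)
        ((i1.const_mul (1 / 4)).add (i2.const_mul 4)) fun φ _ => by
          show 2 * ((f y φ - avg f y) * S y φ) ≤ 1 / 4 * (f y φ - avg f y) ^ 2 + 4 * S y φ ^ 2
          nlinarith [sq_nonneg (f y φ - avg f y - 4 * S y φ)]
      rw [intervalIntegral.integral_add (i1.const_mul _) (i2.const_mul _),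
        intervalIntegral.integral_const_mul, intervalIntegral.integral_const_mul,
        intervalIntegral.integral_const_mul] at h1
      simp only [hXdef, hs]
      unfold deviation
      linarith
    have he := sq_moment_le bq hs2 abs_sin_sq_le hy
    have hcc := sq_moment_le bq hc2 abs_cos_two_mul_le hy
    rw [moment_sub_avg hf.isBdd hc2 abs_cos_two_mul_le hy, integral_cos_two_mul_pi, mul_zero,
      sub_zero] at hcc
    have hee := moment_sub_avg hf.isBdd hs2 abs_sin_sq_le hy
    rw [integral_sin_sq_pi] at hee
    have hσσ := sq_moment_le hS measurable_sin abs_sin_le_one hy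
    have hQ : 2 * π * srcQ S y ^ 2 ≤ s y := by
      obtain ⟨M, hM⟩ := hS.2
      have := sq_avg_le hS.1.of_uncurry_left (hM y hy)
      simp only [sq_abs] at this
      exact this
    have key := energy_density_bound (m := m y) hr1 ht0 htπ hX he hcc hσσ hQ
    -- The factor 2t is chosen so that 4 S_Q β - 4π f̄ S_Q = 4 S_Q (β - π f̄): the uncontrolled
    -- average cancels and a moment of f - f̄ is left.
    have e1 : (ρ - y) * (2 * deviation f y - 2 * X y - 4 * π * (avg f y * srcQ S y)) +
        2 * t * (2 * π * ((ρ - y) * srcQ S y * β y) +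
          (ρ - y) * m y * (σ y - m y - (ρ - y)⁻¹ * c y)) =
        (ρ - y) * (2 * deviation f y - 2 * X y +
          4 * srcQ S y * moment (fun φ => sin φ ^ 2) (fun η φ => f η φ - avg f η) y +
          2 * t * (m y * (σ y - m y - (ρ - y)⁻¹ * c y))) := by
      rw [hee]
      linear_combination (4 * (ρ - y) * srcQ S y * β y) * htπ
    rw [e1]
    refine le_trans ?_ (mul_le_mul_of_nonneg_left key (by linarith))
    have k1 := mul_le_mul_of_nonneg_right hr2 hP0
    have k2 := mul_le_mul_of_nonneg_right hr3 hs0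
    have k3 := mul_le_mul_of_nonneg_right hr3 (sq_nonneg (m y))
    linarith
  have hsplit : ∫ y in (0 : ℝ)..L, ρ * (5 / 8 * deviation f y - 22 * s y - 4 * m y ^ 2) =
      ρ * (5 / 8 * (∫ y in (0 : ℝ)..L, deviation f y) - 22 * (∫ y in (0 : ℝ)..L, s y) -
        4 * ∫ y in (0 : ℝ)..L, m y ^ 2) := by
    have i1 := bP.intervalIntegrable le_rfl hL0.le le_rfl
    have i2 := bs.intervalIntegrable le_rfl hL0.le le_rfl
    have i3 := bm.sq.intervalIntegrable le_rfl hL0.le le_rfl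
    rw [intervalIntegral.integral_const_mul, intervalIntegral.integral_sub
      ((i1.const_mul _).sub (i2.const_mul _)) (i3.const_mul _),
      intervalIntegral.integral_sub (i1.const_mul _) (i2.const_mul _)]
    simp only [intervalIntegral.integral_const_mul]
  rw [hsplit] at hlow
  have hdiv : 5 / 8 * (∫ y in (0 : ℝ)..L, deviation f y) - 22 * (∫ y in (0 : ℝ)..L, s y) -
      4 * (∫ y in (0 : ℝ)..L, m y ^ 2) ≤ 2 * inflowNormL2 h ^ 2 - W - 2 * t * (m 0 * β 0) := by
    refine le_of_mul_le_mul_left ?_ hρ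
    linarith
  have hβ0 : β 0 ^ 2 ≤ 2 * π * W := hf.sq_momentum_zero_le hL0
  have hβt : t * β 0 ^ 2 ≤ 2 * W := by
    calc t * β 0 ^ 2 ≤ t * (2 * π * W) := by gcongr
      _ = 2 * W := by linear_combination 2 * W * htπ
  have k4 : 0 ≤ t * (β 0 + 4 * m 0) ^ 2 := by positivity
  -- Together with `k4`, half of W absorbs the boundary product m(0) β(0); doubling what remains
  -- gives the stated constants.
  have ht4 : 2 * t ≤ 1 := by nlinarith [pi_gt_three]
  have k5 : 2 * t * m 0 ^ 2 ≤ 1 * m 0 ^ 2 := mul_le_mul_of_nonneg_right ht4 (sq_nonneg _)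
  have hPint : 0 ≤ ∫ y in (0 : ℝ)..L, deviation f y :=
    intervalIntegral.integral_nonneg hL0.le fun y _ => deviation_nonneg f y
  have k6 : 0 ≤ t * β 0 ^ 2 + 8 * t * (m 0 * β 0) + 16 * t * m 0 ^ 2 := by linarith
  change W + _ ≤ 4 * _ + 44 * (∫ y in (0 : ℝ)..L, s y) + _ + _
  linarith

end

section

/-! ### The `L²` estimate -/

variable {R ε L : ℝ} {h : ℝ → ℝ} {S f : ℝ → ℝ → ℝ}

theorem normL2_nonneg (L : ℝ) (g : ℝ → ℝ → ℝ) : 0 ≤ normL2 L g := Real.sqrt_nonneg _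

theorem inflowNormL2_nonneg (h : ℝ → ℝ) : 0 ≤ inflowNormL2 h := Real.sqrt_nonneg _

theorem funR₂_nonneg (L : ℝ) (S : ℝ → ℝ → ℝ) : 0 ≤ funR₂ L S := Real.sqrt_nonneg _

theorem funR₁_nonneg (L : ℝ) (S : ℝ → ℝ → ℝ) : 0 ≤ funR₁ L S := abs_nonneg _

theorem funQ₁_nonneg (L : ℝ) (S : ℝ → ℝ → ℝ) : 0 ≤ funQ₁ L S := abs_nonneg _

theorem funQ₂_nonneg (L : ℝ) (S : ℝ → ℝ → ℝ) : 0 ≤ funQ₂ L S := Real.sqrt_nonneg _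

theorem funQ₃_nonneg (L : ℝ) (S : ℝ → ℝ → ℝ) : 0 ≤ funQ₃ L S := Real.sqrt_nonneg _

/-! ### Tails of the mean source. -/

/-- The tail `∫_η^L |S_Q|`. -/
def tailQ (L : ℝ) (S : ℝ → ℝ → ℝ) (η : ℝ) : ℝ := ∫ y in η..L, |srcQ S y|

theorem IsBdd.tailQ (hS : IsBdd L S) : IsBdd L fun η _ => tailQ L S η := hS.avg.abs.tail

theorem tailQ_nonneg {η : ℝ} (hη : η ≤ L) : 0 ≤ tailQ L S η :=
  intervalIntegral.integral_nonneg hη fun _ _ => abs_nonneg _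

theorem tailQ_anti (hS : IsBdd L S) {x y : ℝ} (hx : 0 ≤ x) (hxy : x ≤ y) (hy : y ≤ L) :
    tailQ L S x = (∫ z in x..y, |srcQ S z|) + tailQ L S y :=
  (intervalIntegral.integral_add_adjacent_intervals
    (hS.avg.abs.intervalIntegrable hx hxy hy)
    (hS.avg.abs.intervalIntegrable (hx.trans hxy) hy le_rfl)).symm

/-- The radius decreases in η, so ρ - y ≤ ρ - η under the integral of the mass balance and the
factor ρ - η cancels. -/
theorem IsSolution.abs_mass_le (hε : 0 < ε) (hL0 : 0 < L) (hL : 0 < R / ε - L) (hS : IsBdd L S)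
    (hSp : ∀ η, Function.Periodic (S η) (2 * π)) (hf : IsSolution R ε L h S f) {η : ℝ}
    (hη : η ∈ Icc 0 L) : |moment sin f η| ≤ 2 * π * tailQ L S η := by
  have hr : 0 < R / ε - η := by linarith [hη.2]
  have h1 : |(R / ε - η) * moment sin f η| ≤ (R / ε - η) * (2 * π * tailQ L S η) := by
    rw [hf.flux_mass hε hL0 hL hS hSp hη, abs_neg, ← Real.norm_eq_abs, tailQ,
      ← intervalIntegral.integral_const_mul, ← intervalIntegral.integral_const_mul]
    refine intervalIntegral.norm_integral_le_of_norm_le hη.2 (ae_of_all _ fun y hy => ?_)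
      (((hS.avg.abs.intervalIntegrable hη.1 hη.2 le_rfl).const_mul _).const_mul _)
    have h2 : 0 ≤ R / ε - y := by linarith [hy.2]
    rw [Real.norm_eq_abs, abs_mul, abs_mul, abs_of_nonneg h2, abs_of_pos two_pi_pos]
    have := hy.1
    gcongr
  rw [abs_mul, abs_of_pos hr] at h1
  exact le_of_mul_le_mul_left h1 hr

theorem four_pi_sq_le : (2 * π) ^ 2 ≤ 40 := by
  have h1 := pi_lt_d2
  have h2 := pi_pos
  nlinarith

theorem sq_le_of_abs_le_two_pi {x y : ℝ} (h : |x| ≤ 2 * π * y) : x ^ 2 ≤ 40 * y ^ 2 := by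
  have h1 : |x| ^ 2 ≤ (2 * π * y) ^ 2 := pow_le_pow_left₀ (abs_nonneg _) h 2
  rw [sq_abs, mul_pow] at h1
  exact h1.trans (mul_le_mul_of_nonneg_right four_pi_sq_le (sq_nonneg y))

theorem sq_normL2 (hL0 : 0 < L) (g : ℝ → ℝ → ℝ) :
    normL2 L g ^ 2 = ∫ η in (0 : ℝ)..L, ∫ φ in (-π)..π, |g η φ| ^ 2 := by
  rw [normL2, Real.sq_sqrt]
  exact intervalIntegral.integral_nonneg hL0.le fun η _ =>
    intervalIntegral.integral_nonneg (by linarith [pi_pos]) fun φ _ => by positivity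

theorem sq_normL2' (hL0 : 0 < L) (g : ℝ → ℝ → ℝ) :
    normL2 L g ^ 2 = ∫ η in (0 : ℝ)..L, ∫ φ in (-π)..π, g η φ ^ 2 := by
  rw [sq_normL2 hL0]
  simp only [sq_abs]

theorem sq_funR₂ (hL0 : 0 < L) :
    funR₂ L S ^ 2 = ∫ η in (0 : ℝ)..L, (∫ y in η..L, sinPair (srcR S) y) ^ 2 := by
  rw [funR₂, Real.sq_sqrt]
  exact intervalIntegral.integral_nonneg hL0.le fun _ _ => sq_nonneg _

theorem sq_funQ₂ (hL0 : 0 < L) : funQ₂ L S ^ 2 = ∫ η in (0 : ℝ)..L, tailQ L S η ^ 2 := by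
  rw [funQ₂, Real.sq_sqrt]
  · rfl
  · exact intervalIntegral.integral_nonneg hL0.le fun _ _ => sq_nonneg _

theorem sq_funQ₃ (hL0 : 0 < L) :
    funQ₃ L S ^ 2 = ∫ η in (0 : ℝ)..L, (∫ y in η..L, tailQ L S y) ^ 2 := by
  rw [funQ₃, Real.sq_sqrt]
  · rfl
  · exact intervalIntegral.integral_nonneg hL0.le fun _ _ => sq_nonneg _

theorem funQ₁_eq (hL0 : 0 < L) : funQ₁ L S = ∫ η in (0 : ℝ)..L, tailQ L S η :=
  abs_of_nonneg (intervalIntegral.integral_nonneg hL0.le fun _ hη => tailQ_nonneg hη.2)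

/-- The total mass of `|S_Q|` is controlled by the `L²` norm near the boundary. -/
theorem tailQ_zero_le (hL1 : 1 ≤ L) (hS : IsBdd L S) :
    tailQ L S 0 ≤ normL2 L S + tailQ L S 1 := by
  have hL0 : 0 < L := by linarith
  rw [tailQ_anti hS le_rfl zero_le_one hL1]
  refine add_le_add_left ?_ _
  refine (abs_le_of_sq_le_sq' ?_ (normL2_nonneg L S)).2
  have bQ : IsBdd L fun η _ => srcQ S η := hS.avg
  obtain ⟨M, hM⟩ := bQ.2
  have h1 := sq_intervalIntegral_mul_le (f := fun _ => 1) (g := fun z => |srcQ S z|) (M := 1)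
    (N := M) zero_le_one measurable_const bQ.abs.measurable_fst (by simp)
    fun z hz => by rw [abs_abs]; exact hM z ⟨hz.1, hz.2.trans hL1⟩ 0
  simp only [one_mul, one_pow, intervalIntegral.integral_const, sub_zero, smul_eq_mul, mul_one,
    sq_abs] at h1
  refine h1.trans ?_
  rw [sq_normL2' hL0]
  have i1 := bQ.sq
  have i2 : IsBdd L fun η _ => ∫ φ in (-π)..π, S η φ ^ 2 := hS.sq.ang
  have hpt : ∀ y ∈ Icc 0 L, srcQ S y ^ 2 ≤ ∫ φ in (-π)..π, S y φ ^ 2 := by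
    intro y hy
    obtain ⟨N, hN⟩ := hS.2
    have h2 := sq_avg_le hS.1.of_uncurry_left (hN y hy)
    simp only [sq_abs] at h2
    refine le_trans ?_ h2
    have : 1 ≤ 2 * π := by linarith [pi_gt_three]
    exact le_mul_of_one_le_left (sq_nonneg _) this
  have h3 := intervalIntegral.integral_add_adjacent_intervals
    (i2.intervalIntegrable le_rfl zero_le_one hL1) (i2.intervalIntegrable zero_le_one hL1 le_rfl)
  have h4 : 0 ≤ ∫ y in (1 : ℝ)..L, ∫ φ in (-π)..π, S y φ ^ 2 :=
    intervalIntegral.integral_nonneg hL1 fun _ _ =>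
      intervalIntegral.integral_nonneg (by linarith [pi_pos]) fun _ _ => sq_nonneg _
  have h5 := intervalIntegral.integral_mono_on zero_le_one
    (i1.intervalIntegrable le_rfl zero_le_one hL1) (i2.intervalIntegrable le_rfl zero_le_one hL1)
    fun y hy => hpt y ⟨hy.1, hy.2.trans hL1⟩
  linarith

theorem const_le_integral_of_le {k : ℝ → ℝ} {c : ℝ} (hL1 : 1 ≤ L) (hk : IsBdd L fun η _ => k η)
    (h1 : ∀ y ∈ Icc 0 1, c ≤ k y) (h0 : ∀ y ∈ Icc 0 L, 0 ≤ k y) :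
    c ≤ ∫ y in (0 : ℝ)..L, k y := by
  have h2 := intervalIntegral.integral_add_adjacent_intervals
    (hk.intervalIntegrable le_rfl zero_le_one hL1) (hk.intervalIntegrable zero_le_one hL1 le_rfl)
  have h3 : 0 ≤ ∫ y in (1 : ℝ)..L, k y :=
    intervalIntegral.integral_nonneg hL1 fun y hy => h0 y ⟨zero_le_one.trans hy.1, hy.2⟩
  have h4 := intervalIntegral.integral_mono_on zero_le_one
    (intervalIntegrable_const (c := c)) (hk.intervalIntegrable le_rfl zero_le_one hL1) h1
  rw [intervalIntegral.integral_const, sub_zero, one_smul] at h4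
  linarith

theorem tailQ_one_le (hL1 : 1 ≤ L) (hS : IsBdd L S) {y : ℝ} (hy : y ∈ Icc 0 1) :
    tailQ L S 1 ≤ tailQ L S y := by
  rw [tailQ_anti hS hy.1 hy.2 hL1]
  have : 0 ≤ ∫ z in y..1, |srcQ S z| :=
    intervalIntegral.integral_nonneg hy.2 fun _ _ => abs_nonneg _
  linarith

/-- The tail is nonincreasing, so its value at 1 is at most its integral over [0, 1]. With
`tailQ_zero_le` this bounds the tail at 0, hence the mass flux at the boundary. -/
theorem tailQ_one_le_funQ₁ (hL1 : 1 ≤ L) (hS : IsBdd L S) : tailQ L S 1 ≤ funQ₁ L S := by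
  rw [funQ₁_eq (by linarith)]
  exact const_le_integral_of_le hL1 hS.tailQ (fun y hy => tailQ_one_le hL1 hS hy)
    fun y hy => tailQ_nonneg hy.2

theorem tailQ_one_le_funQ₂ (hL1 : 1 ≤ L) (hS : IsBdd L S) : tailQ L S 1 ≤ funQ₂ L S := by
  refine (abs_le_of_sq_le_sq' ?_ (funQ₂_nonneg L S)).2
  rw [sq_funQ₂ (by linarith)]
  exact const_le_integral_of_le hL1 hS.tailQ.sq
    (fun y hy => pow_le_pow_left₀ (tailQ_nonneg hL1) (tailQ_one_le hL1 hS hy) 2)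
    fun y hy => sq_nonneg _

/-- The estimate of f_L may not contain `funQ₂`; monotonicity of the tail removes it from the energy
bound. -/
theorem sq_funQ₂_le (hL1 : 1 ≤ L) (hS : IsBdd L S) :
    funQ₂ L S ^ 2 ≤ tailQ L S 0 * funQ₁ L S := by
  have hL0 : 0 < L := by linarith
  rw [sq_funQ₂ hL0, funQ₁_eq hL0, ← intervalIntegral.integral_const_mul]
  refine intervalIntegral.integral_mono_on hL0.le (hS.tailQ.sq.intervalIntegrable le_rfl hL0.le
    le_rfl) ((hS.tailQ.intervalIntegrable le_rfl hL0.le le_rfl).const_mul _) fun y hy => ?_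
  rw [sq]
  refine mul_le_mul_of_nonneg_right ?_ (tailQ_nonneg hy.2)
  rw [tailQ_anti hS le_rfl hy.1 hy.2]
  have : 0 ≤ ∫ z in (0 : ℝ)..y, |srcQ S z| :=
    intervalIntegral.integral_nonneg hy.1 fun _ _ => abs_nonneg _
  linarith

/-- The energy estimate in terms of the source. -/
theorem IsSolution.energy_le' (hε : 0 < ε) (hL1 : 1 ≤ L) (hL2 : 2 * L ≤ R / ε) (hS : IsBdd L S)
    (hSp : ∀ η, Function.Periodic (S η) (2 * π)) (hf : IsSolution R ε L h S f) :
    (∫ φ in (-π)..π, |sin φ| * f 0 φ ^ 2) + ∫ y in (0 : ℝ)..L, deviation f y ≤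
      4 * inflowNormL2 h ^ 2 + 44 * normL2 L S ^ 2 + 320 * funQ₂ L S ^ 2 +
        160 * tailQ L S 0 ^ 2 := by
  have hL0 : 0 < L := by linarith
  have hL : 0 < R / ε - L := by linarith
  have h1 := hf.energy_le hε hL1 hL2 hS hSp
  rw [← sq_normL2' hL0] at h1
  have hpt : ∀ y ∈ Icc 0 L, moment sin f y ^ 2 ≤ 40 * tailQ L S y ^ 2 := fun y hy =>
    sq_le_of_abs_le_two_pi (hf.abs_mass_le hε hL0 hL hS hSp hy)
  have bm : IsBdd L fun η _ => moment sin f η := hf.isBdd.moment measurable_sin abs_sin_le_one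
  have h2 := intervalIntegral.integral_mono_on hL0.le
    (bm.sq.intervalIntegrable le_rfl hL0.le le_rfl)
    ((hS.tailQ.sq.intervalIntegrable le_rfl hL0.le le_rfl).const_mul 40) hpt
  rw [intervalIntegral.integral_const_mul, ← sq_funQ₂ hL0] at h2
  have h3 := hpt 0 ⟨le_rfl, hL0.le⟩
  linarith

/-- The contribution of the geometric correction to the momentum. -/
theorem IsSolution.sq_integral_correction_le (hL1 : 1 ≤ L) (hL2 : 2 * L ≤ R / ε)
    (hf : IsSolution R ε L h S f) {η : ℝ} (hη : η ∈ Icc 0 L) :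
    (∫ y in η..L, (R / ε - y)⁻¹ * moment (fun φ => cos (2 * φ)) f y) ^ 2 ≤
      7 * L⁻¹ * ∫ y in (0 : ℝ)..L, deviation f y := by
  have hL0 : 0 < L := by linarith
  have hL : 0 < R / ε - L := by linarith
  have hc2 : Measurable fun φ : ℝ => cos (2 * φ) := by fun_prop
  have bc : IsBdd L fun η _ => moment (fun φ => cos (2 * φ)) f η :=
    hf.isBdd.moment hc2 abs_cos_two_mul_le
  have bq : IsBdd L fun η φ => f η φ - avg f η := hf.isBdd.sub hf.isBdd.avg
  have bP : IsBdd L fun η _ => deviation f η := bq.sq.ang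
  have bi : IsBdd L fun η _ => (R / ε - η)⁻¹ := IsBdd.inv_radius hL
  obtain ⟨M, hM⟩ := bi.2
  obtain ⟨N, hN⟩ := bc.2
  have hsub : ∀ y ∈ Icc η L, y ∈ Icc 0 L := fun y hy => ⟨hη.1.trans hy.1, hy.2⟩
  have h1 := sq_intervalIntegral_mul_le (M := M) (N := N) hη.2 bi.measurable_fst bc.measurable_fst
    (fun y hy => hM y (hsub y hy) 0) fun y hy => hN y (hsub y hy) 0
  -- From 2L ≤ R / ε the radius is at least L on an interval of length at most L. This is where the
  -- layer must be short compared with R / ε.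
  have h2 : ∫ y in η..L, (R / ε - y)⁻¹ ^ 2 ≤ L⁻¹ := by
    have h3 := intervalIntegral.integral_mono_on hη.2
      (bi.sq.intervalIntegrable hη.1 hη.2 le_rfl) (intervalIntegrable_const (c := L⁻¹ ^ 2))
      fun y hy => by
        have h4 : L ≤ R / ε - y := by linarith [hy.2]
        have h5 := inv_anti₀ hL0 h4
        have h6 : 0 ≤ (R / ε - y)⁻¹ := inv_nonneg.2 (by linarith)
        exact pow_le_pow_left₀ h6 h5 2
    rw [intervalIntegral.integral_const, smul_eq_mul] at h3
    refine h3.trans ?_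
    calc (L - η) * L⁻¹ ^ 2 ≤ L * L⁻¹ ^ 2 := by
          have := hη.1
          gcongr
          linarith
      _ = L⁻¹ := by field_simp
  have h3 : ∫ y in η..L, moment (fun φ => cos (2 * φ)) f y ^ 2 ≤
      7 * ∫ y in (0 : ℝ)..L, deviation f y := by
    have h4 := intervalIntegral.integral_mono_on hη.2
      (bc.sq.intervalIntegrable hη.1 hη.2 le_rfl)
      ((bP.intervalIntegrable hη.1 hη.2 le_rfl).const_mul 7) fun y hy => by
        have hcc := sq_moment_le bq hc2 abs_cos_two_mul_le (hsub y hy)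
        rw [moment_sub_avg hf.isBdd hc2 abs_cos_two_mul_le (hsub y hy), integral_cos_two_mul_pi,
          mul_zero, sub_zero] at hcc
        refine hcc.trans (mul_le_mul_of_nonneg_right ?_ (deviation_nonneg f y))
        linarith [pi_lt_d2]
    rw [intervalIntegral.integral_const_mul] at h4
    have h5 := intervalIntegral.integral_add_adjacent_intervals
      (bP.intervalIntegrable le_rfl hη.1 hη.2) (bP.intervalIntegrable hη.1 hη.2 le_rfl)
    have h6 : 0 ≤ ∫ y in (0 : ℝ)..η, deviation f y :=
      intervalIntegral.integral_nonneg hη.1 fun y _ => deviation_nonneg f y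
    linarith
  have h7 : 0 ≤ ∫ y in η..L, moment (fun φ => cos (2 * φ)) f y ^ 2 :=
    intervalIntegral.integral_nonneg hη.2 fun _ _ => sq_nonneg _
  calc _ ≤ _ := h1
    _ ≤ L⁻¹ * (7 * ∫ y in (0 : ℝ)..L, deviation f y) := by gcongr
    _ = _ := by ring

/-- The increments of the momentum. -/
theorem IsSolution.momentum_sub (hε : 0 < ε) (hL : 0 < R / ε - L) (hS : IsBdd L S)
    (hSp : ∀ η, Function.Periodic (S η) (2 * π)) (hf : IsSolution R ε L h S f) {η : ℝ}
    (hη : η ∈ Icc 0 L) :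
    moment (fun φ => sin φ ^ 2) f η - moment (fun φ => sin φ ^ 2) f L =
      -(∫ y in η..L, sinPair (srcR S) y) + (∫ y in η..L, moment sin f y) +
        ∫ y in η..L, (R / ε - y)⁻¹ * moment (fun φ => cos (2 * φ)) f y := by
  have i1 := (hS.moment measurable_sin abs_sin_le_one).intervalIntegrable hη.1 hη.2 le_rfl
  have i2 := (hf.isBdd.moment measurable_sin abs_sin_le_one).intervalIntegrable hη.1 hη.2 le_rfl
  have bc : IsBdd L fun y _ => (R / ε - y)⁻¹ * moment (fun φ => cos (2 * φ)) f y :=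
    (IsBdd.inv_radius hL).mul (hf.isBdd.moment (by fun_prop) abs_cos_two_mul_le)
  have i3 := bc.intervalIntegrable hη.1 hη.2 le_rfl
  rw [hf.flux_momentum hε hL hS hSp hη, intervalIntegral.integral_sub (i1.sub i2) i3,
    intervalIntegral.integral_sub i1 i2]
  have h1 : ∫ y in η..L, sinPair (srcR S) y = ∫ y in η..L, moment sin S y := by
    refine intervalIntegral.integral_congr fun y hy => ?_
    rw [uIcc_of_le hη.2] at hy
    exact sinPair_srcR hS ⟨hη.1.trans hy.1, hy.2⟩
  rw [h1]
  ring

theorem IsSolution.abs_integral_mass_le (hε : 0 < ε) (hL0 : 0 < L) (hL : 0 < R / ε - L)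
    (hS : IsBdd L S) (hSp : ∀ η, Function.Periodic (S η) (2 * π)) (hf : IsSolution R ε L h S f)
    {η : ℝ} (hη : η ∈ Icc 0 L) :
    |∫ y in η..L, moment sin f y| ≤ 2 * π * ∫ y in η..L, tailQ L S y := by
  rw [← intervalIntegral.integral_const_mul, ← Real.norm_eq_abs]
  exact intervalIntegral.norm_integral_le_of_norm_le hη.2 (ae_of_all _ fun y hy =>
    hf.abs_mass_le hε hL0 hL hS hSp ⟨hη.1.trans hy.1.le, hy.2⟩)
    ((hS.tailQ.intervalIntegrable hη.1 hη.2 le_rfl).const_mul _)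

/-- The constant to which solutions are compared. -/
def farField (L : ℝ) (f : ℝ → ℝ → ℝ) : ℝ := moment (fun φ => sin φ ^ 2) f L / π

/-- The momentum at L is the momentum at 0, bounded by the boundary energy, minus the increment
given by `IsSolution.momentum_sub`. -/
theorem IsSolution.abs_farField_le (hε : 0 < ε) (hL1 : 1 ≤ L) (hL2 : 2 * L ≤ R / ε)
    (hS : IsBdd L S) (hSp : ∀ η, Function.Periodic (S η) (2 * π))
    (hf : IsSolution R ε L h S f) :
    |farField L f| ≤ 200 * (inflowNormL2 h + normL2 L S) + 200 * funR₁ L S + 200 * funQ₁ L S := by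
  have hL0 : 0 < L := by linarith
  have hL : 0 < R / ε - L := by linarith
  have h0 : (0 : ℝ) ∈ Icc 0 L := ⟨le_rfl, hL0.le⟩
  have hpi := pi_gt_three
  have hpi2 := pi_lt_d2
  have hJ := hf.energy_le' hε hL1 hL2 hS hSp
  have hW0 : 0 ≤ ∫ φ in (-π)..π, |sin φ| * f 0 φ ^ 2 :=
    intervalIntegral.integral_nonneg (by linarith) fun φ _ => by positivity
  have hP0 : 0 ≤ ∫ y in (0 : ℝ)..L, deviation f y :=
    intervalIntegral.integral_nonneg hL0.le fun y _ => deviation_nonneg f y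
  have ha1 := inflowNormL2_nonneg h
  have ha2 := normL2_nonneg L S
  have hq0 : 0 ≤ funQ₁ L S := abs_nonneg _
  have hA0 : 0 ≤ tailQ L S 0 := tailQ_nonneg hL0.le
  have hA : tailQ L S 0 ≤ normL2 L S + funQ₁ L S :=
    (tailQ_zero_le hL1 hS).trans (by linarith [tailQ_one_le_funQ₁ hL1 hS])
  have hY := sq_funQ₂_le hL1 hS
  set a₁ := inflowNormL2 h
  set a₂ := normL2 L S
  set q₁ := funQ₁ L S
  set W := ∫ φ in (-π)..π, |sin φ| * f 0 φ ^ 2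
  set P := ∫ y in (0 : ℝ)..L, deviation f y
  have hY2 : funQ₂ L S ^ 2 ≤ (a₂ + q₁) ^ 2 := by nlinarith
  have hZ2 : tailQ L S 0 ^ 2 ≤ (a₂ + q₁) ^ 2 := pow_le_pow_left₀ hA0 hA 2
  -- The coefficients come from the energy bound: 4 = 2², 44 ≤ 7² and 320 + 160 ≤ 22².
  have hg : W + P ≤ (2 * a₁ + 7 * a₂ + 22 * (a₂ + q₁)) ^ 2 := by
    have e1 := mul_nonneg ha1 ha2
    have e2 := mul_nonneg ha1 (add_nonneg ha2 hq0)
    have e3 := mul_nonneg ha2 (add_nonneg ha2 hq0)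
    have e4 := sq_nonneg (a₂ + q₁)
    nlinarith
  set g := 2 * a₁ + 7 * a₂ + 22 * (a₂ + q₁) with hgdef
  have hg0 : 0 ≤ g := by positivity
  have hβ : |moment (fun φ => sin φ ^ 2) f 0| ≤ 3 * g := by
    refine abs_le_of_sq_le_sq ?_ (by positivity)
    have := hf.sq_momentum_zero_le hL0
    nlinarith
  have hC : |∫ y in (0 : ℝ)..L, (R / ε - y)⁻¹ * moment (fun φ => cos (2 * φ)) f y| ≤ 3 * g := by
    refine abs_le_of_sq_le_sq ?_ (by positivity)
    have h1 := hf.sq_integral_correction_le hL1 hL2 h0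
    have h2 : 7 * L⁻¹ * P ≤ 7 * P := by
      have h3 : L⁻¹ ≤ 1 := inv_le_one_of_one_le₀ hL1
      nlinarith
    nlinarith
  have hM := hf.abs_integral_mass_le hε hL0 hL hS hSp h0
  rw [← funQ₁_eq hL0] at hM
  have hM' : |∫ y in (0 : ℝ)..L, moment sin f y| ≤ 7 * q₁ :=
    hM.trans (mul_le_mul_of_nonneg_right (by linarith) hq0)
  have hsub := hf.momentum_sub hε hL hS hSp h0
  have hR : |∫ y in (0 : ℝ)..L, sinPair (srcR S) y| = funR₁ L S := rfl
  have hR0 : 0 ≤ funR₁ L S := abs_nonneg _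
  have hβL : |moment (fun φ => sin φ ^ 2) f L| ≤ 6 * g + funR₁ L S + 7 * q₁ := by
    rw [_root_.abs_le] at hβ hC hM' ⊢
    have h1 := _root_.abs_le.1 hR.le
    constructor <;> linarith [h1.1, h1.2, hβ.1, hβ.2, hC.1, hC.2, hM'.1, hM'.2]
  have hfar : |farField L f| ≤ |moment (fun φ => sin φ ^ 2) f L| := by
    rw [farField, abs_div, abs_of_pos pi_pos]
    exact div_le_self (abs_nonneg _) (by linarith)
  linarith

/-- For each η, f - f_L splits orthogonally into f - f̄, bounded by the energy, and f̄ - f_L, read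
off from the increment of the momentum. -/
theorem IsSolution.normL2_sub_farField_le (hε : 0 < ε) (hL1 : 1 ≤ L) (hL2 : 2 * L ≤ R / ε)
    (hS : IsBdd L S) (hSp : ∀ η, Function.Periodic (S η) (2 * π))
    (hf : IsSolution R ε L h S f) :
    normL2 L (fun η φ => f η φ - farField L f) ≤
      200 * (inflowNormL2 h + normL2 L S) + 200 * funR₂ L S + 200 * funQ₂ L S +
        200 * funQ₃ L S := by
  have hL0 : 0 < L := by linarith
  have hL : 0 < R / ε - L := by linarith
  have hpi := pi_gt_three
  have hpi2 := pi_lt_d2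
  have hs2 : Measurable fun φ : ℝ => sin φ ^ 2 := by fun_prop
  have hJ := hf.energy_le' hε hL1 hL2 hS hSp
  have hW0 : 0 ≤ ∫ φ in (-π)..π, |sin φ| * f 0 φ ^ 2 :=
    intervalIntegral.integral_nonneg (by linarith) fun φ _ => by positivity
  have bq : IsBdd L fun η φ => f η φ - avg f η := hf.isBdd.sub hf.isBdd.avg
  have bP : IsBdd L fun η _ => deviation f η := bq.sq.ang
  have hP0 : 0 ≤ ∫ y in (0 : ℝ)..L, deviation f y :=
    intervalIntegral.integral_nonneg hL0.le fun y _ => deviation_nonneg f y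
  set fL := farField L f with hfL
  set P := ∫ y in (0 : ℝ)..L, deviation f y with hP
  -- the pointwise estimate
  have hpt : ∀ η ∈ Icc 0 L, ∫ φ in (-π)..π, (f η φ - fL) ^ 2 ≤
      9 * deviation f η + 6 * (∫ y in η..L, moment sin S y) ^ 2 +
        240 * (∫ y in η..L, tailQ L S y) ^ 2 + 42 * L⁻¹ * P := by
    intro η hη
    have i1 := bq.sq.intervalIntegrable_angle hη
    have i2 := bq.intervalIntegrable_angle hη
    have e1 : ∫ φ in (-π)..π, (f η φ - fL) ^ 2 = deviation f η + 2 * π * (avg f η - fL) ^ 2 := by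
      have : ∀ φ, (f η φ - fL) ^ 2 = (f η φ - avg f η) ^ 2 +
          (2 * (avg f η - fL) * (f η φ - avg f η) + (avg f η - fL) ^ 2) := fun φ => by ring
      simp only [this]
      rw [intervalIntegral.integral_add i1 ((i2.const_mul _).add intervalIntegrable_const),
        intervalIntegral.integral_add (i2.const_mul _) intervalIntegrable_const,
        intervalIntegral.integral_const_mul, integral_sub_avg (hf.isBdd.intervalIntegrable_angle hη),
        intervalIntegral.integral_const, smul_eq_mul]
      unfold deviation
      ring
    have hee := moment_sub_avg hf.isBdd hs2 abs_sin_sq_le hη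
    rw [integral_sin_sq_pi] at hee
    have he := sq_moment_le bq hs2 abs_sin_sq_le hη
    change _ ≤ 2 * π * deviation f η at he
    set e := moment (fun φ => sin φ ^ 2) (fun η φ => f η φ - avg f η) η
    have hsub := hf.momentum_sub hε hL hS hSp hη
    have hσ : ∫ y in η..L, sinPair (srcR S) y = ∫ y in η..L, moment sin S y := by
      refine intervalIntegral.integral_congr fun y hy => ?_
      rw [uIcc_of_le hη.2] at hy
      exact sinPair_srcR hS ⟨hη.1.trans hy.1, hy.2⟩
    rw [hσ] at hsub
    have hM := sq_le_of_abs_le_two_pi (hf.abs_integral_mass_le hε hL0 hL hS hSp hη)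
    have hC := hf.sq_integral_correction_le hL1 hL2 hη
    rw [← hP] at hC
    set Sg := ∫ y in η..L, moment sin S y
    set M := ∫ y in η..L, moment sin f y
    set C := ∫ y in η..L, (R / ε - y)⁻¹ * moment (fun φ => cos (2 * φ)) f y
    set T := ∫ y in η..L, tailQ L S y
    -- The momentum is π f̄ + e, and the normalization by π in `farField` makes its value at L equal
    -- to π f_L.
    have hq : π * (avg f η - fL) = -Sg + M + C - e := by
      rw [hfL, farField, mul_sub, mul_div_cancel₀ _ pi_ne_zero]
      linarith
    have hq2 : π ^ 2 * (avg f η - fL) ^ 2 ≤ 6 * (Sg ^ 2 + M ^ 2 + C ^ 2) + 2 * e ^ 2 := by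
      rw [← mul_pow, hq]
      nlinarith [sq_nonneg (-Sg + M + C + e), sq_nonneg (Sg + M), sq_nonneg (Sg + C),
        sq_nonneg (M - C)]
    have hq3 : π * (2 * π * (avg f η - fL) ^ 2) ≤
        π * (8 * deviation f η + 6 * (Sg ^ 2 + M ^ 2 + C ^ 2)) := by
      have h1 : 0 ≤ Sg ^ 2 + M ^ 2 + C ^ 2 := by positivity
      have h2 : 3 * (Sg ^ 2 + M ^ 2 + C ^ 2) ≤ π * (Sg ^ 2 + M ^ 2 + C ^ 2) :=
        mul_le_mul_of_nonneg_right hpi.le h1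
      linarith
    have hq4 := le_of_mul_le_mul_left hq3 pi_pos
    rw [e1]
    linarith
  have bf : IsBdd L fun η φ => (f η φ - fL) ^ 2 := (hf.isBdd.sub (IsBdd.const L fL)).sq
  have bSg : IsBdd L fun η _ => (∫ y in η..L, moment sin S y) ^ 2 :=
    (hS.moment measurable_sin abs_sin_le_one).tail.sq
  have bT : IsBdd L fun η _ => (∫ y in η..L, tailQ L S y) ^ 2 := hS.tailQ.tail.sq
  have j1 := (bP.intervalIntegrable le_rfl hL0.le le_rfl).const_mul 9
  have j2 := (bSg.intervalIntegrable le_rfl hL0.le le_rfl).const_mul 6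
  have j3 := (bT.intervalIntegrable le_rfl hL0.le le_rfl).const_mul 240
  have hint := intervalIntegral.integral_mono_on hL0.le
    (bf.ang.intervalIntegrable le_rfl hL0.le le_rfl)
    (((j1.add j2).add j3).add (intervalIntegrable_const (c := 42 * L⁻¹ * P))) hpt
  rw [intervalIntegral.integral_add ((j1.add j2).add j3) intervalIntegrable_const,
    intervalIntegral.integral_add (j1.add j2) j3, intervalIntegral.integral_add j1 j2] at hint
  simp only [intervalIntegral.integral_const_mul, intervalIntegral.integral_const,
    smul_eq_mul, sub_zero] at hint
  have hSg : ∫ η in (0 : ℝ)..L, (∫ y in η..L, moment sin S y) ^ 2 = funR₂ L S ^ 2 := by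
    rw [sq_funR₂ hL0]
    refine intervalIntegral.integral_congr fun η hη => ?_
    rw [uIcc_of_le hL0.le] at hη
    congr 1
    refine intervalIntegral.integral_congr fun y hy => ?_
    rw [uIcc_of_le hη.2] at hy
    exact (sinPair_srcR hS ⟨hη.1.trans hy.1, hy.2⟩).symm
  -- Integration over a layer of length L exactly compensates the factor L⁻¹ of the curvature term.
  rw [hSg, ← sq_funQ₃ hL0, ← sq_normL2' hL0, ← hP,
    show 42 * L⁻¹ * (L * P) = 42 * P by field_simp] at hint
  have ha1 := inflowNormL2_nonneg h
  have ha2 := normL2_nonneg L S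
  have hb1 : 0 ≤ funR₂ L S := funR₂_nonneg L S
  have hb2 : 0 ≤ funQ₂ L S := funQ₂_nonneg L S
  have hb3 : 0 ≤ funQ₃ L S := funQ₃_nonneg L S
  have hA0 : 0 ≤ tailQ L S 0 := tailQ_nonneg hL0.le
  have hA : tailQ L S 0 ≤ normL2 L S + funQ₂ L S :=
    (tailQ_zero_le hL1 hS).trans (by linarith [tailQ_one_le_funQ₂ hL1 hS])
  have hZ2 : tailQ L S 0 ^ 2 ≤ (normL2 L S + funQ₂ L S) ^ 2 := pow_le_pow_left₀ hA0 hA 2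
  set a₁ := inflowNormL2 h
  set a₂ := normL2 L S
  set b₁ := funR₂ L S
  set b₂ := funQ₂ L S
  set b₃ := funQ₃ L S
  have hZ3 : tailQ L S 0 ^ 2 ≤ 2 * a₂ ^ 2 + 2 * b₂ ^ 2 := by
    linarith [sq_nonneg (a₂ - b₂)]
  -- The constant is 200².
  have hfin : normL2 L (fun η φ => f η φ - fL) ^ 2 ≤
      40000 * (a₁ ^ 2 + a₂ ^ 2 + b₁ ^ 2 + b₂ ^ 2 + b₃ ^ 2) := by
    linarith [sq_nonneg a₁, sq_nonneg a₂, sq_nonneg b₁, sq_nonneg b₂, sq_nonneg b₃]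
  refine (abs_le_of_sq_le_sq' (hfin.trans ?_) (by positivity)).2
  have hexp : a₁ ^ 2 + a₂ ^ 2 + b₁ ^ 2 + b₂ ^ 2 + b₃ ^ 2 ≤ (a₁ + a₂ + b₁ + b₂ + b₃) ^ 2 := by
    have : (a₁ + a₂ + b₁ + b₂ + b₃) ^ 2 = a₁ ^ 2 + a₂ ^ 2 + b₁ ^ 2 + b₂ ^ 2 + b₃ ^ 2 +
      2 * (a₁ * (a₂ + b₁ + b₂ + b₃) + a₂ * (b₁ + b₂ + b₃) + b₁ * (b₂ + b₃) + b₂ * b₃) := by ring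
    rw [this]
    have : 0 ≤ a₁ * (a₂ + b₁ + b₂ + b₃) + a₂ * (b₁ + b₂ + b₃) + b₁ * (b₂ + b₃) + b₂ * b₃ := by
      positivity
    linarith
  calc _ ≤ 40000 * (a₁ + a₂ + b₁ + b₂ + b₃) ^ 2 := by gcongr
    _ = _ := by ring

end

section

/-! ### Supremum norms and the choice of the small parameter -/

variable {L : ℝ} {h : ℝ → ℝ} {g : ℝ → ℝ → ℝ}

theorem abs_le_inflowNormSup (hhM : ∃ M, ∀ φ ∈ inflow, |h φ| ≤ M) {φ : ℝ} (hφ : φ ∈ inflow) :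
    |h φ| ≤ inflowNormSup h := by
  obtain ⟨M, hM⟩ := hhM
  refine le_csSup ⟨M, ?_⟩ ⟨φ, hφ, rfl⟩
  rintro _ ⟨ψ, hψ, rfl⟩
  exact hM ψ hψ

theorem abs_le_normSup (hp : ∀ η, Function.Periodic (g η) (2 * π))
    (hM : ∃ M, ∀ η ∈ Icc 0 L, ∀ φ, |g η φ| ≤ M) {η : ℝ} (hη : η ∈ Icc 0 L) (φ : ℝ) :
    |g η φ| ≤ normSup L g := by
  obtain ⟨M, hM⟩ := hM
  obtain ⟨ψ, hψ, h1⟩ := (hp η).exists_mem_Ico two_pi_pos φ (-π)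
  rw [h1]
  refine le_csSup ⟨M, ?_⟩ ⟨η, hη, ψ, ⟨hψ.1, by linarith [hψ.2]⟩, rfl⟩
  rintro _ ⟨x, hx, p, -, rfl⟩
  exact hM x hx p

theorem normSup_le (hL : 0 ≤ L) {M : ℝ} (hM : ∀ η ∈ Icc 0 L, ∀ φ, |g η φ| ≤ M) :
    normSup L g ≤ M := by
  refine csSup_le ⟨_, 0, ⟨le_rfl, hL⟩, 0, ⟨by linarith [pi_pos], pi_pos⟩, rfl⟩ ?_
  rintro _ ⟨x, hx, p, -, rfl⟩
  exact hM x hx p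

theorem inflowNormSup_nonneg (h : ℝ → ℝ) : 0 ≤ inflowNormSup h := by
  refine Real.sSup_nonneg ?_
  rintro _ ⟨φ, -, rfl⟩
  exact abs_nonneg _

theorem normSup_nonneg (L : ℝ) (g : ℝ → ℝ → ℝ) : 0 ≤ normSup L g := by
  refine Real.sSup_nonneg ?_
  rintro _ ⟨_, -, φ, -, rfl⟩
  exact abs_nonneg _

/-- For small `ε` the layer is long, but short compared to the radius of curvature. -/
theorem exists_layerLength_bounds {Rmin δ : ℝ} (hR : 0 < Rmin) (hδ : 0 < δ) :
    ∃ ε₀ > (0 : ℝ), ∀ R ε : ℝ, Rmin ≤ R → 0 < ε → ε < ε₀ →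
      1 ≤ layerLength ε ∧ 2 * layerLength ε ≤ R / ε ∧ 6 ≤ δ * (R / ε - layerLength ε) := by
  -- With ε₀ = K⁻² one gets L ≥ K, so L ≥ 1, Rmin L ≥ 2 and δ L ≥ 6. Since R / ε = R L², these give
  -- the three bounds.
  set K : ℝ := 1 + 2 / Rmin + 6 / δ with hK
  have h2 : 0 < 2 / Rmin := by positivity
  have h6 : 0 < 6 / δ := by positivity
  have hK0 : 0 < K := by positivity
  refine ⟨(K ^ 2)⁻¹, by positivity, fun R ε hRR hε hε0 => ?_⟩
  have hl : layerLength ε = (√ε)⁻¹ := by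
    rw [layerLength, rpow_neg hε.le, sqrt_eq_rpow]
  have hs : 0 < √ε := Real.sqrt_pos.2 hε
  have hKL : K ≤ layerLength ε := by
    rw [hl, le_inv_comm₀ hK0 hs]
    refine Real.sqrt_le_iff.2 ⟨by positivity, ?_⟩
    rw [inv_pow]
    exact hε0.le
  have hsq : layerLength ε ^ 2 = ε⁻¹ := by rw [hl, inv_pow, Real.sq_sqrt hε.le]
  set l := layerLength ε
  have hl0 : 0 < l := hK0.trans_le hKL
  have hRl : 2 ≤ Rmin * l := by
    rw [← div_le_iff₀' hR]
    linarith
  have hδl : 6 ≤ δ * l := by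
    rw [← div_le_iff₀' hδ]
    linarith
  have h2l : 2 * l ≤ R / ε := by
    rw [div_eq_mul_inv, ← hsq]
    calc 2 * l ≤ Rmin * l * l := by gcongr
      _ = Rmin * l ^ 2 := by ring
      _ ≤ R * l ^ 2 := by gcongr
  refine ⟨by linarith, h2l, hδl.trans ?_⟩
  gcongr
  linarith

end

end EpsMilne

end

/-! ### Assembly of the theorem. -/

open EpsMilne in
theorem mainTheorem6 (Rmin : ℝ) (hRmin : 0 < Rmin) :
    ∃ ε₀ > (0 : ℝ), ∃ C > (0 : ℝ), ∀ R ε L : ℝ, Rmin ≤ R → 0 < ε → ε < ε₀ → L = layerLength ε →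
      ∀ (h : ℝ → ℝ) (S : ℝ → ℝ → ℝ),
        Measurable h → (∃ M, ∀ φ ∈ inflow, |h φ| ≤ M) →
        Measurable (Function.uncurry S) → (∀ η, Function.Periodic (S η) (2 * Real.pi)) →
        (∃ M, ∀ η ∈ Set.Icc 0 L, ∀ φ, |S η φ| ≤ M) →
        ∃ f : ℝ → ℝ → ℝ, IsSolution R ε L h S f ∧
          (∀ g : ℝ → ℝ → ℝ, IsSolution R ε L h S g →
            ∀ η ∈ Set.Icc 0 L, ∀ φ, ¬ IsGrazing η φ → g η φ = f η φ) ∧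
          ∃ fL : ℝ,
            normSup L (fun η φ => f η φ - fL) ≤
              C * (inflowNormL2 h + normL2 L S + inflowNormSup h + normSup L S)
                + C * funR₂ L S + C * funR₁ L S + C * funQ₁ L S + C * funQ₂ L S
                + C * funQ₃ L S ∧
            normL2 L (fun η φ => f η φ - fL) ≤
              C * (inflowNormL2 h + normL2 L S) + C * funR₂ L S + C * funQ₂ L S
                + C * funQ₃ L S ∧
            normSup L (fun η φ => f η φ - fL) ≤
              C * (|fL| + inflowNormSup h + normSup L S + normL2 L (fun η φ => f η φ - fL)) ∧
            |fL| ≤ C * (inflowNormL2 h + normL2 L S) + C * funR₁ L S + C * funQ₁ L S := by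
  obtain ⟨δ, hδ, K, hK, hsup⟩ := exists_abs_sub_le
  obtain ⟨ε₀, hε₀, hlen⟩ := exists_layerLength_bounds hRmin hδ
  refine ⟨ε₀, hε₀, 600 * K, by linarith, ?_⟩
  rintro R ε L hR hε hεε₀ rfl h S hh hhM hS hSp hSM
  obtain ⟨hL1, hL2, h6⟩ := hlen R ε hR hε hεε₀
  set L := layerLength ε
  have hL0 : 0 < L := by linarith
  have hL : 0 < R / ε - L := by linarith
  obtain ⟨f, hf, hf0⟩ := exists_isSolution hε hL0 hL hh hhM hS hSp hSM
  have hfar := hf.abs_farField_le hε hL1 hL2 ⟨hS, hSM⟩ hSp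
  have h2 := hf.normL2_sub_farField_le hε hL1 hL2 ⟨hS, hSM⟩ hSp
  refine ⟨f, hf, fun g hg η hη φ hgr => hf.unique hε hL0 hL hS hSp hSM hg hη hgr,
    farField L f, ?_⟩
  set fL := farField L f
  have n1 := inflowNormL2_nonneg h
  have n2 := normL2_nonneg L S
  have n3 := inflowNormSup_nonneg h
  have n4 := normSup_nonneg L S
  have n5 := normL2_nonneg L fun η φ => f η φ - fL
  have m1 := funR₁_nonneg L S
  have m2 := funR₂_nonneg L S
  have m3 := funQ₁_nonneg L S
  have m4 := funQ₂_nonneg L S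
  have m5 := funQ₃_nonneg L S
  have n6 : 0 ≤ |fL| := abs_nonneg _
  have h3 : normSup L (fun η φ => f η φ - fL) ≤
      K * (|fL| + inflowNormSup h + normSup L S + normL2 L fun η φ => f η φ - fL) := by
    refine normSup_le hL0.le fun η hη φ => ?_
    -- On the grazing set f was chosen to be 0, so the difference there is |f_L|, which the right
    -- side contains.
    by_cases hg : IsGrazing η φ
    · rw [hf0 η φ hg, zero_sub, abs_neg]
      have : |fL| ≤ |fL| + inflowNormSup h + normSup L S + normL2 L fun η φ => f η φ - fL := by
        linarith
      exact this.trans (le_mul_of_one_le_left (n6.trans this) hK)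
    · exact hsup R ε L hε hL0 h6 h S f hS hSp hf _ _ fL (fun φ hφ => abs_le_inflowNormSup hhM hφ)
        (fun η hη φ => abs_le_normSup hSp hSM hη φ) η hη φ hg
  have scale : ∀ {x y : ℝ}, 0 ≤ y → x ≤ 600 * y → x ≤ 600 * K * y := fun {x y} hy hx => by
    have : y ≤ K * y := le_mul_of_one_le_left hy hK
    linarith
  refine ⟨?_, ?_, ?_, ?_⟩
  · have h4 : |fL| + inflowNormSup h + normSup L S + (normL2 L fun η φ => f η φ - fL) ≤
        600 * (inflowNormL2 h + normL2 L S + inflowNormSup h + normSup L S + funR₂ L S +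
          funR₁ L S + funQ₁ L S + funQ₂ L S + funQ₃ L S) := by
      linarith
    have h5 := h3.trans (mul_le_mul_of_nonneg_left h4 (by linarith))
    linarith
  · have h4 := scale (y := inflowNormL2 h + normL2 L S + funR₂ L S + funQ₂ L S + funQ₃ L S)
      (by positivity) (h2.trans (by linarith))
    linarith
  · have h4 : 0 ≤ K * (|fL| + inflowNormSup h + normSup L S +
        normL2 L fun η φ => f η φ - fL) := mul_nonneg (by linarith) (by linarith)
    linarith
  · have h4 := scale (y := inflowNormL2 h + normL2 L S + funR₁ L S + funQ₁ L S)
      (by positivity) (hfar.trans (by linarith))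
    linarith
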